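/- Let $G=(V,E)$ be a finite simple undirected graph with $n\ge 2$ vertices, $m$ edges and no isolated vertex, and let $0<\phi\le 1$. For $S\subseteq V$ let $\operatorname{vol}(S)$ be the sum of the degrees $d_v$, $v\in S$, let $\bar S=V\setminus S$, and let $E(S,\bar S)$ be the set of edges between $S$ and $\bar S$. A cut is a partition $(S,\bar S)$ of $V$ into two non-empty sets; its conductance is $\Phi_G(S)=|E(S,\bar S)|/\min(\operatorname{vol}(S),\operatorname{vol}(\bar S))$, and $\Phi(G)$ is the minimum conductance of a cut. A set $A\subseteq V$ is a near $\psi$-expander in $G$ if $|E(X,V\setminus X)|\ge\psi\operatorname{vol}(X)$ for all $X\subseteq A$ with $\operatorname{vol}(X)\le\operatorname{vol}(A)/2$. Let $G\{A\}$ be the subgraph induced by $A$ with a self-loop (counted once in the degree) added for each edge leaving $A$, and let $\mathcal A_A$, $D_A$ be its adjacency and degree matrix. Write $\log=\log_2$. The cut procedure sets $T=\lceil 1/(12\phi)\rceil$, $\gamma=343\sqrt{\phi\log(32m^3)\log^2 n}$, $\beta=2\sqrt\phi/\log^{3/2}m$, $A=V$, $L=\emptyset$. In iteration $t=1,\dots,T$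 it draws a fresh uniformly random unit vector $r\in\mathbb R^n$ and computes $u=D^{-1}Wr$, where $D$ is the degree matrix of $G$ and $W$ is the product of the lazy random walk matrices $\tfrac12 I+\tfrac12\mathcal A_{A}D_{A}^{-1}$ of the sets $A$ of iterations $1,\dots,t-1$, and shifts $u$ by a constant so that $\sum_{v\in A}d_vu_v=0$. It considers the sweep cuts $\{v\in A:u_v\le c\}$, represented by their smaller side, with conductance measured in $G\{A\}$. If none has conductance below $\gamma$, it goes on to the next iteration. If one has conductance below $\gamma$ and volume at least $\beta m$, let $S$ be such a cut; otherwise let $S$ be a set of largest volume among the two-ended sweep cuts $\{v\in A: u_v\notin[a,b]\}$ of volume at most $\operatorname{vol}(A)/2$ and conductance below $\gamma$. If $\operatorname{vol}(S)\ge\beta m$, it returns the cut $(S,\bar S)$. Otherwise it moves $S$ from $A$ to $L$, and returns the cut $(A,L)$ if now $\operatorname{vol}(L)\ge\beta m$. After $T$ iterations it certifies expansion if $L=\emptyset$, and returns the cut $(A,L)$ otherwise. **Theorem (Cut Procedure).** The cut procedure can be implemented on a real RAM such that, for all values of the random vectors, it takes $\mathcal O\big((m\log n)/\phi^2\big)$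 steps. With high probability (for every constant $c>0$, with probability at least $1-n^{-c}$ for all $n\ge n_0(c)$) it terminates with one of these cases: 1. It certifies that $G$ has conductance $\Phi(G)\ge\phi$, and this is true. 2. It returns a cut $(A,\bar A)$ of $G$ of conductance $\Phi_G(A)=\mathcal O(\sqrt\phi\,\log^{3/2}m)$, and * (a) either $\operatorname{vol}(A)$ and $\operatorname{vol}(\bar A)$ are both $\Omega(m\sqrt\phi/\log^{3/2}m)$, * (b) or $\operatorname{vol}(\bar A)=\mathcal O(m\sqrt\phi/\log^{3/2}m)$ and $A$ is a near $6\phi$-expander in $G$. The constants in $\mathcal O$ and $\Omega$ are absolute. -/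

import Mathlib

open MeasureTheory ProbabilityTheory

noncomputable section

namespace CutProc

/-! ### Volumes, borders, conductance, near expanders -/

section Graph

variable {n : ℕ} (G : SimpleGraph (Fin n)) [DecidableRel G.Adj]

/-- The number of edges. -/
def numEdges : ℕ := G.edgeFinset.card

/-- The volume of a vertex set: the sum of the degrees of its vertices. -/
def vol (S : Finset (Fin n)) : ℕ := ∑ v ∈ S, G.degree v

/-- The number of edges with exactly one endpoint in `S`
(each is listed once, as the pair whose first component lies in `S`). -/
def border (S : Finset (Fin n)) : ℕ := (G.interedges S Sᶜ).card

/-- A 2-cut `(S, V \ S)`: both sides are non-empty. -/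
def IsCut (S : Finset (Fin n)) : Prop := S.Nonempty ∧ Sᶜ.Nonempty

/-- The conductance of the cut `(S, V \ S)`: its border over the volume of the smaller side. -/
def cutConductance (S : Finset (Fin n)) : ℝ :=
  (border G S : ℝ) / (min (vol G S) (vol G Sᶜ) : ℕ)

/-- The conductance of the graph: the minimum conductance of a cut, and `1` if there is no cut. -/
def conductance : ℝ :=
  open Classical in
  let cuts : Finset (Finset (Fin n)) := Finset.univ.filter IsCut
  if h : cuts.Nonempty then cuts.inf' h (cutConductance G) else 1

/-- `A` is a near `φ`-expander in `G`: every `X ⊆ A` with `vol X ≤ vol A / 2` has at least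
`φ * vol X` edges to `V \ X`. -/
def IsNearExpander (φ : ℝ) (A : Finset (Fin n)) : Prop :=
  ∀ X ⊆ A, (vol G X : ℝ) ≤ (vol G A : ℝ) / 2 → φ * (vol G X : ℝ) ≤ (border G X : ℝ)

end Graph

/-! ### Step counting

The programs below are written for a real random access machine. A value of type `Timed α` is the
result of a computation together with the number of its steps. Arrays are functions, an array is
written by `Function.update`, one entry at a time; one step stands for a bounded number of
elementary operations (arithmetic operation or comparison of numbers, array access, list or tree
constructor). An array is created or copied at the cost of its length. -/

/-- A result together with the number of steps spent on it. -/
structure Timed (α : Type) where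
  val : α
  steps : ℕ

instance : Monad Timed where
  pure a := ⟨a, 0⟩
  bind x f := ⟨(f x.val).val, x.steps + (f x.val).steps⟩

/-- Spend `k` steps. -/
def tick (k : ℕ) : Timed Unit := ⟨(), k⟩

/-- Run through a list, updating a state; each round costs one step plus the cost of its body. -/
def loop {α σ : Type} (f : σ → α → Timed σ) : σ → List α → Timed σ
  | s, [] => pure s
  | s, a :: l => do
    tick 1
    let s' ← f s a
    loop f s' l

/-! ### Merge sort -/

/-- Merge two lists that are sorted by `u`. -/
def merge {n : ℕ} (u : Fin n → ℝ) : List (Fin n) → List (Fin n) → Timed (List (Fin n))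
  | [], ys => do
    tick 1
    pure ys
  | x :: xs, [] => do
    tick 1
    pure (x :: xs)
  | x :: xs, y :: ys =>
    if u x ≤ u y then do
      tick 1
      let l ← merge u xs (y :: ys)
      pure (x :: l)
    else do
      tick 1
      let l ← merge u (x :: xs) ys
      pure (y :: l)
  termination_by xs ys => xs.length + ys.length

/-- Sort a list of length at most `2 ^ h` by `u`, in increasing order. -/
def sortBy {n : ℕ} (u : Fin n → ℝ) : ℕ → List (Fin n) → Timed (List (Fin n))
  | 0, l => do
    tick 1
    pure l
  | h + 1, l => do
    tick (1 + l.length)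
    let l₁ ← sortBy u h (l.take (2 ^ h))
    let l₂ ← sortBy u h (l.drop (2 ^ h))
    merge u l₁ l₂

/-! ### A search tree with a value at each leaf

The leaves carry the indices `0, 1, 2, …` from left to right, and non-negative numbers `vol` that
increase with the index. The tree supports adding a number to all values from an index on, and
finding the last leaf with `vol ≤ κ` and value above `θ`. -/

/-- In a `node`, `mid` and `midVol` are the index and `vol` of the first leaf of the right subtree,
`pend` is a number to be added to the values of all leaves below the node, and `top` is the largest
value of a leaf below it, with `pend` included. -/
inductive SegTree : Type
  | leaf (idx : ℕ) (vol val : ℝ) : SegTree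
  | node (mid : ℕ) (midVol pend top : ℝ) (l r : SegTree) : SegTree

namespace SegTree

/-- The largest value in the tree. -/
def maxVal : SegTree → ℝ
  | leaf _ _ val => val
  | node _ _ _ top _ _ => top

/-- Add `x` to all values. -/
def shift (x : ℝ) : SegTree → SegTree
  | leaf idx vol val => leaf idx vol (val + x)
  | node mid midVol pend top l r => node mid midVol (pend + x) (top + x) l r

/-- The tree with leaves `s, …, s + 2 ^ h - 1`. -/
def build (vol val : ℕ → ℝ) : ℕ → ℕ → Timed SegTree
  | 0, s => do
    tick 1
    pure (leaf s (vol s) (val s))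
  | h + 1, s => do
    tick 1
    let l ← build vol val h s
    let r ← build vol val h (s + 2 ^ h)
    pure (node (s + 2 ^ h) (vol (s + 2 ^ h)) 0 (max l.maxVal r.maxVal) l r)

/-- Add `x` to the values of all leaves with index at least `p`. -/
def addFrom (p : ℕ) (x : ℝ) : SegTree → Timed SegTree
  | leaf idx vol val => do
    tick 1
    pure (leaf idx vol (if p ≤ idx then val + x else val))
  | node mid midVol pend _ l r => do
    tick 1
    if p ≤ mid then
      let l' ← addFrom p x l
      let r' := r.shift x
      pure (node mid midVol pend (pend + max l'.maxVal r'.maxVal) l' r')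
    else
      let r' ← addFrom p x r
      pure (node mid midVol pend (pend + max l.maxVal r'.maxVal) l r')

/-- The index and `vol` of the last leaf with `vol ≤ κ` and value above `θ`, if there is one. -/
def findLast (κ : ℝ) : ℝ → SegTree → Timed (Option (ℕ × ℝ))
  | θ, leaf idx vol val => do
    tick 1
    pure (if vol ≤ κ ∧ θ < val then some (idx, vol) else none)
  | θ, node _ midVol pend top l r => do
    tick 1
    if top ≤ θ then
      pure none
    else if midVol ≤ κ then
      let o ← findLast κ (θ - pend) r
      match o with
      | some res => pure (some res)
      | none => findLast κ (θ - pend) l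
    else
      findLast κ (θ - pend) l

end SegTree

/-! ### The cut procedure -/

section Procedure

variable {n : ℕ} (G : SimpleGraph (Fin n)) [DecidableRel G.Adj]

/-- The adjacency list of `v`. The graph is given by `n`, the number of edges, the vertex degrees
and the adjacency lists. -/
def nbrs (v : Fin n) : List (Fin n) := (List.finRange n).filter (fun w => G.Adj v w)

/-- One step of the lazy random walk on `G{A}` (the subgraph induced by `A`, in which each edge
that leaves `A` is replaced by a self-loop, so that no degree changes), applied to a vector of
degree-normalised values: with `𝒜` and `D` the adjacency and degree matrices of `G{A}`, the entries
in `A` are multiplied by `1/2 I + 1/2 D⁻¹ 𝒜`. -/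
def walkStep (A : Fin n → Bool) (u : Fin n → ℝ) : Timed (Fin n → ℝ) :=
  loop (fun (u' : Fin n → ℝ) v =>
    if A v then do
      let s ← loop (fun (s : ℝ) w => pure (s + if A w then u w else u v)) 0 (nbrs G v)
      pure (Function.update u' v (1 / 2 * u v + 1 / 2 * (s / (G.degree v : ℝ))))
    else pure u') u (List.finRange n)

/-- The projected walk vector: for `hist = [A (t-1), …, A 1]` this is
`(1/2 I + 1/2 D⁻¹ 𝒜 (t-1)) ⋯ (1/2 I + 1/2 D⁻¹ 𝒜 1) D⁻¹ r = D⁻¹ W r`, where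
`W = (1/2 I + 1/2 𝒜 (t-1) D⁻¹) ⋯ (1/2 I + 1/2 𝒜 1 D⁻¹)` is the random walk matrix. The `n` steps
at the start are for sampling `r`. -/
def walkVector (hist : List (Fin n → Bool)) (r : Fin n → ℝ) : Timed (Fin n → ℝ) := do
  tick n
  let u₀ ← loop (fun (u : Fin n → ℝ) v => pure (Function.update u v (r v / (G.degree v : ℝ))))
    (fun _ => 0) (List.finRange n)
  tick (1 + hist.length)
  loop (fun u A => walkStep G A u) u₀ hist.reverse

/-- The volume of `A`. -/
def volOf (A : Fin n → Bool) : Timed ℝ :=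
  loop (fun (s : ℝ) v => pure (if A v then s + (G.degree v : ℝ) else s)) 0 (List.finRange n)

/-- Subtract the degree-weighted average over `A`, so that `u` becomes orthogonal to the degree
vector of `G{A}`. -/
def center (A : Fin n → Bool) (volA : ℝ) (u : Fin n → ℝ) : Timed (Fin n → ℝ) := do
  let s ← loop (fun (s : ℝ) v => pure (if A v then s + (G.degree v : ℝ) * u v else s)) 0
    (List.finRange n)
  loop (fun (u' : Fin n → ℝ) v => pure (Function.update u' v (u v - s / volA))) u
    (List.finRange n)

/-- The vertices of `A` grouped by their value in `u`: `block 0, …, block (num - 1)` are the groups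
of equal value in increasing order, and `rank v` is the number of the group of `v`; `last` is the
value of the last group. -/
structure Blocks (n : ℕ) where
  rank : Fin n → ℕ
  block : ℕ → List (Fin n)
  num : ℕ
  last : Option ℝ

/-- Sort `A` by `u` and group equal values. -/
def mkBlocks (A : Fin n → Bool) (u : Fin n → ℝ) : Timed (Blocks n) := do
  tick n
  let l ← sortBy u (Nat.clog 2 n) ((List.finRange n).filter (fun v => A v))
  tick (1 + n)
  loop (fun (s : Blocks n) v =>
    let j := if s.last = some (u v) then s.num - 1 else s.num
    pure
      { rank := Function.update s.rank v j
        block := Function.update s.block j (v :: s.block j)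
        num := j + 1
        last := some (u v) })
    { rank := fun _ => 0, block := fun _ => [], num := 0, last := none } l

/-- Volumes `pvol i` and borders `cut i` (both in `G{A}`) of the prefixes
`{v ∈ A | rank v < i}`, for `i ≤ num`. Past the end, `pvol` has a value above `vol A`. -/
structure Prefixes where
  volume : ℝ
  bord : ℝ
  pvol : ℕ → ℝ
  cut : ℕ → ℝ

/-- Compute the volumes and borders of all prefixes. -/
def mkPrefixes (A : Fin n → Bool) (volA : ℝ) (B : Blocks n) : Timed Prefixes := do
  tick (1 + n)
  loop (fun (s : Prefixes) i => do
    let p ← loop (fun (p : ℝ × ℝ) v => do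
      let c ← loop (fun (c : ℝ) w =>
        pure (if A w then
            (if B.rank v < B.rank w then c + 1 else if B.rank w < B.rank v then c - 1 else c)
          else c)) p.2 (nbrs G v)
      pure (p.1 + (G.degree v : ℝ), c)) (s.volume, s.bord) (B.block i)
    pure
      { volume := p.1
        bord := p.2
        pvol := Function.update s.pvol (i + 1) p.1
        cut := Function.update s.cut (i + 1) p.2 })
    { volume := 0
      bord := 0
      pvol := Function.update (fun _ => volA + 1) 0 0
      cut := fun _ => 0 } (List.range B.num)

/-- Look at all sweep cuts `{v ∈ A | u v ≤ c}`. The first component tells whether one of them has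
conductance below `γ` in `G{A}`; the second one is the first such cut whose smaller side has volume
at least `τ`, if there is one. -/
def oneSided (γ τ volA : ℝ) (B : Blocks n) (P : Prefixes) : Timed (Bool × Option ℕ) :=
  loop (fun (s : Bool × Option ℕ) i =>
    let x := min (P.pvol (i + 1)) (volA - P.pvol (i + 1))
    pure (if P.cut (i + 1) < γ * x then
        (true, if s.2 = none ∧ τ ≤ x then some (i + 1) else s.2)
      else s)) (false, none) (List.range (B.num - 1))

/-- The two-ended sweep cut `{v ∈ A | u v ∉ [a, b]}` of largest volume among those that have
conductance below `γ` in `G{A}` (and that are the smaller side of their cut, that is, have volume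
at most `vol A / 2`). The result `(i, j, x)` stands for the set `{v ∈ A | rank v < i ∨ j ≤ rank v}`
of volume `x`.

The search goes through `j = num, …, 1`. For each `j` the leaf `i` of the tree has the value
`γ * pvol i - cut i + 2 * e`, where `e` is the number of edges between `{rank < i}` and
`{j ≤ rank}`; the border of the two-ended cut is `cut i + cut j - 2 * e`. -/
def twoSided (A : Fin n → Bool) (γ volA : ℝ) (B : Blocks n) (P : Prefixes) :
    Timed (Option (ℕ × ℕ × ℝ)) := do
  tick (1 + B.num)
  let tree ← SegTree.build P.pvol (fun i => γ * P.pvol i - P.cut i) (Nat.clog 2 (B.num + 1)) 0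
  let res ← loop (fun (s : SegTree × Option (ℕ × ℕ × ℝ)) j => do
    let o ← s.1.findLast (P.pvol (j + 1) - volA / 2)
      (P.cut (j + 1) - γ * (volA - P.pvol (j + 1)))
    let best : Option (ℕ × ℕ × ℝ) :=
      match o, s.2 with
      | none, b => b
      | some (i, x), none => some (i, j + 1, x + (volA - P.pvol (j + 1)))
      | some (i, x), some b =>
        if b.2.2 < x + (volA - P.pvol (j + 1)) then
          some (i, j + 1, x + (volA - P.pvol (j + 1)))
        else some b
    let tree' ← loop (fun (t : SegTree) v =>
      loop (fun (t : SegTree) w =>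
        if A w ∧ B.rank w < j then t.addFrom (B.rank w + 1) 2 else pure t) t (nbrs G v))
      s.1 (B.block j)
    pure (tree', best)) (tree, none) (List.range B.num).reverse
  pure res.2

/-- The array with the entries `p v`, for a test `p` that takes one step. -/
def tabulate (p : Fin n → Bool) : Timed (Fin n → Bool) :=
  loop (fun (S : Fin n → Bool) v => pure (Function.update S v (p v))) (fun _ => false)
    (List.finRange n)

/-- The sweep cut in `G{A}` along `u`, with its volume; `none` stands for the empty set.
* If no sweep cut has conductance below `γ`, the result is empty.
* If some sweep cut has conductance below `γ` and volume at least `τ`, such a cut is returned,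
  represented by its smaller side.
* Otherwise the result is the two-ended sweep cut of largest volume among those of conductance
  below `γ`. -/
def sweepCut (A : Fin n → Bool) (γ τ : ℝ) (u : Fin n → ℝ) :
    Timed (Option ((Fin n → Bool) × ℝ)) := do
  let volA ← volOf G A
  let u ← center G A volA u
  let B ← mkBlocks A u
  let P ← mkPrefixes G A volA B
  let one ← oneSided γ τ volA B P
  match one with
  | (_, some i) =>
    if P.pvol i ≤ volA - P.pvol i then do
      let S ← tabulate (fun v => A v && decide (B.rank v < i))
      pure (some (S, P.pvol i))
    else do
      let S ← tabulate (fun v => A v && decide (i ≤ B.rank v))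
      pure (some (S, volA - P.pvol i))
  | (false, none) => pure none
  | (true, none) => do
    let two ← twoSided G A γ volA B P
    match two with
    | some (i, j, x) => do
      let S ← tabulate (fun v => A v && (decide (B.rank v < i) || decide (j ≤ B.rank v)))
      pure (some (S, x))
    | none => pure none

/-- The possible outputs; a cut `(S, V \ S)` is represented by the array of `S`. -/
inductive Outcome (n : ℕ) : Type
  | expander : Outcome n
  | balanced (S : Fin n → Bool) : Outcome n
  | unbalanced (A : Fin n → Bool) : Outcome n

/-- The vertex set `A`, whether `L = V \ A` is empty, the volume of `L`, and the earlier sets `A`,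
the most recent one first. -/
structure State (n : ℕ) where
  A : Fin n → Bool
  emptyL : Bool
  volL : ℝ
  hist : List (Fin n → Bool)

/-- The iterations from iteration `t` on, when `k` of them remain, with cut threshold `γ` and volume
threshold `τ`; `r t` is the random unit vector of iteration `t`. -/
def iterate (γ τ : ℝ) (r : ℕ → Fin n → ℝ) : ℕ → ℕ → State n → Timed (Outcome n)
  | 0, _, s => do
    tick 1
    pure (if s.emptyL then Outcome.expander else Outcome.unbalanced s.A)
  | k + 1, t, s => do
    tick 1
    let u ← walkVector G s.hist (r t)
    let cut ← sweepCut G s.A γ τ u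
    match cut with
    | none => iterate γ τ r k (t + 1) { s with hist := s.A :: s.hist }
    | some (S, volS) =>
      if τ ≤ volS then
        pure (Outcome.balanced S)
      else do
        let A' ← tabulate (fun v => s.A v && !(S v))
        if τ ≤ s.volL + volS then
          pure (Outcome.balanced A')
        else
          iterate γ τ r k (t + 1)
            { A := A', emptyL := false, volL := s.volL + volS, hist := s.A :: s.hist }

/-- The number of iterations, `1 / (12 φ)` rounded up. -/
def iterations (φ : ℝ) : ℕ := ⌈1 / (12 * φ)⌉₊

/-- The cut threshold `343 √(φ log(32 m³) log² n)`. -/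
def cutThreshold (φ : ℝ) : ℝ :=
  343 * √(φ * Real.logb 2 (32 * (numEdges G : ℝ) ^ 3) * Real.logb 2 n ^ 2)

/-- The balance `2 √φ / log^{3/2} m`. -/
def balance (φ : ℝ) : ℝ := 2 * √φ / Real.logb 2 (numEdges G) ^ (3 / 2 : ℝ)

/-- The cut procedure on the graph `G` with target expansion `φ`; `r t` is the random unit vector
that is drawn in iteration `t = 1, 2, …`. -/
def cutProcedure (φ : ℝ) (r : ℕ → Fin n → ℝ) : Timed (Outcome n) := do
  tick (1 + n)
  iterate G (cutThreshold G φ) (balance G φ * numEdges G) r (iterations φ) 1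
    { A := fun _ => true, emptyL := true, volL := 0, hist := [] }

/-- What an output promises, with the constant `C` in all `O` and `Ω`. -/
def Guarantee (C φ : ℝ) : Outcome n → Prop
  | .expander => φ ≤ conductance G
  | .balanced S =>
    let A : Finset (Fin n) := Finset.univ.filter (fun v => S v)
    IsCut A ∧
      cutConductance G A ≤ C * (√φ * Real.logb 2 (numEdges G) ^ (3 / 2 : ℝ)) ∧
      C⁻¹ * (numEdges G * √φ / Real.logb 2 (numEdges G) ^ (3 / 2 : ℝ)) ≤ vol G A ∧
      C⁻¹ * (numEdges G * √φ / Real.logb 2 (numEdges G) ^ (3 / 2 : ℝ)) ≤ vol G Aᶜ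
  | .unbalanced S =>
    let A : Finset (Fin n) := Finset.univ.filter (fun v => S v)
    IsCut A ∧
      cutConductance G A ≤ C * (√φ * Real.logb 2 (numEdges G) ^ (3 / 2 : ℝ)) ∧
      vol G Aᶜ ≤ C * (numEdges G * √φ / Real.logb 2 (numEdges G) ^ (3 / 2 : ℝ)) ∧
      IsNearExpander G (6 * φ) A

end Procedure

/-- The unit sphere of `ℝⁿ`. -/
abbrev UnitSphere (n : ℕ) : Type := Metric.sphere (0 : EuclideanSpace ℝ (Fin n)) 1

/-- The uniform distribution on the unit sphere: the normalised surface measure. -/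
def uniformSphere (n : ℕ) : Measure (UnitSphere n) :=
  ((volume : Measure (EuclideanSpace ℝ (Fin n))).toSphere Set.univ)⁻¹ •
    (volume : Measure (EuclideanSpace ℝ (Fin n))).toSphere

end CutProc

end

noncomputable section

namespace CutProc

/-! ### Values and step counts of timed programs -/

section Programs

/-! The object followed through the run is the family of vectors `rows G hist v`, the rows of
`D⁻¹W`; their inner products with the random direction are the entries of the walk vector. Progress
is measured by `pot`, the degree-weighted variance of these vectors over `A`.

A small potential certifies expansion (`isNearExpander_of_pot`). If the walk starts from the
indicator of `X ⊆ A`, one step carries at most half of the border of `X` out of `X`. If the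
potential is at most `1 / (400 m²)`, the values on `X` are close to an average of at most `1/2`, so
after all iterations a constant fraction of the volume of `X` has left, and the border must be
large.

The potential does become small. One walk step lowers the sum of squares by a quarter of the
Dirichlet energy, and discarding `S` removes the share of `S` (`pot_walk_le`). For a single
projection these two gains are at least of order `γ²` times the projected variance (`scalar_drop`):
when no balanced cut is found, every sweep set expands apart from its overlap with `S`, by
submodularity and the maximality of `S` (`sweepExpands_some`), and a Cheeger argument around the
median (`cheeger`, `sqSum_median_le`) applies. A direction that stretches no relevant vector by much
transfers the gain to the vectors (`pot_drop`). As the projected variance has expectation `pot / n`,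
the potential contracts in expectation by a factor `1 - γ² / (128 η n)` with `η n = 8 log n`
(`lintegral_pot_le`).

Iterating this and applying Markov's inequality bounds the failure probability
(`measure_iterate_le`). The run sees the random vector only through the order of its projected
values (`sweepCut_congr`), so conditioning on finitely many orders suffices. This analysis needs `γ
≤ 1`; for `γ > 1` the first iteration almost surely finds a balanced cut
(`measure_not_guarantee_eq_zero`). The conductance of returned cuts comes from the invariant `Inv`:
the border between `L` and `A` is at most `γ` times the volume of `L`. The running time is a
deterministic count (`cutProcedure_steps_le`). -/

@[simp] lemma val_pure {α : Type} (a : α) : (pure a : Timed α).val = a := rfl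
@[simp] lemma steps_pure {α : Type} (a : α) : (pure a : Timed α).steps = 0 := rfl
@[simp] lemma val_bind {α β : Type} (x : Timed α) (f : α → Timed β) :
    (x >>= f).val = (f x.val).val := rfl
@[simp] lemma steps_bind {α β : Type} (x : Timed α) (f : α → Timed β) :
    (x >>= f).steps = x.steps + (f x.val).steps := rfl
@[simp] lemma val_tick (k : ℕ) : (tick k).val = () := rfl
@[simp] lemma steps_tick (k : ℕ) : (tick k).steps = k := rfl
lemma val_ite {α : Type} (p : Prop) [Decidable p] (x y : Timed α) :
    (if p then x else y).val = if p then x.val else y.val := by split_ifs <;> rfl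
lemma steps_ite {α : Type} (p : Prop) [Decidable p] (x y : Timed α) :
    (if p then x else y).steps = if p then x.steps else y.steps := by split_ifs <;> rfl

variable {α σ : Type}

@[simp] lemma loop_nil (f : σ → α → Timed σ) (s : σ) : loop f s [] = pure s := rfl

lemma loop_cons_val (f : σ → α → Timed σ) (s : σ) (a : α) (l : List α) :
    (loop f s (a :: l)).val = (loop f (f s a).val l).val := rfl

lemma loop_cons_steps (f : σ → α → Timed σ) (s : σ) (a : α) (l : List α) :
    (loop f s (a :: l)).steps = 1 + ((f s a).steps + (loop f (f s a).val l).steps) := rfl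

lemma loop_val (f : σ → α → Timed σ) (s : σ) (l : List α) :
    (loop f s l).val = l.foldl (fun s a => (f s a).val) s := by
  induction l generalizing s with
  | nil => rfl
  | cons a l ih => rw [loop_cons_val, ih, List.foldl_cons]

lemma loop_append_val (f : σ → α → Timed σ) (s : σ) (l l' : List α) :
    (loop f s (l ++ l')).val = (loop f (loop f s l).val l').val := by
  simp only [loop_val, List.foldl_append]

/-- Cost of a loop whose states satisfy an invariant. -/
lemma loop_steps_le_of_inv (f : σ → α → Timed σ) (Inv : σ → Prop) (K : α → ℕ) (l : List α)
    (h : ∀ s, Inv s → ∀ a ∈ l, Inv (f s a).val ∧ (f s a).steps ≤ K a) (s : σ) (hs : Inv s) :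
    (loop f s l).steps ≤ (l.map (fun a => 1 + K a)).sum := by
  induction l generalizing s with
  | nil => simp
  | cons a l ih =>
    rw [loop_cons_steps, List.map_cons, List.sum_cons]
    have h1 := h s hs a List.mem_cons_self
    have h2 := ih (fun s hs b hb => h s hs b (List.mem_cons_of_mem _ hb)) _ h1.1
    omega

lemma loop_steps_le (f : σ → α → Timed σ) (K : α → ℕ) (l : List α)
    (h : ∀ s, ∀ a ∈ l, (f s a).steps ≤ K a) (s : σ) :
    (loop f s l).steps ≤ (l.map (fun a => 1 + K a)).sum :=
  loop_steps_le_of_inv f (fun _ => True) K l (fun s _ a ha => ⟨trivial, h s a ha⟩) s trivial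

lemma loop_steps_le_const (f : σ → α → Timed σ) (K : ℕ) (l : List α)
    (h : ∀ s, ∀ a ∈ l, (f s a).steps ≤ K) (s : σ) :
    (loop f s l).steps ≤ l.length * (1 + K) := by
  refine (loop_steps_le f (fun _ => K) l h s).trans ?_
  simp

/-- Invariant rule for the value of a loop. -/
lemma loop_inv (f : σ → α → Timed σ) (P : List α → σ → Prop) (s : σ) (l : List α) (h0 : P [] s)
    (h : ∀ l₁ a l₂, l = l₁ ++ a :: l₂ → ∀ s, P l₁ s → P (l₁ ++ [a]) (f s a).val) :
    P l (loop f s l).val := by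
  have key : ∀ l₂ l₁ s, l = l₁ ++ l₂ → P l₁ s → P l (loop f s l₂).val := by
    intro l₂
    induction l₂ with
    | nil => intro l₁ s hl hs; simpa [hl] using hs
    | cons a l₂ ih =>
      intro l₁ s hl hs
      rw [loop_cons_val]
      exact ih (l₁ ++ [a]) _ (by simp [hl]) (h l₁ a l₂ hl s hs)
  exact key l [] s rfl h0

lemma foldl_update {n : ℕ} {β : Type} (g : Fin n → β) (l : List (Fin n)) (u : Fin n → β) :
    l.foldl (fun u v => Function.update u v (g v)) u = fun v => if v ∈ l then g v else u v := by
  induction l generalizing u with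
  | nil => simp
  | cons a l ih =>
    rw [List.foldl_cons, ih]
    funext v
    by_cases h : v = a
    · subst h; by_cases h' : v ∈ l <;> simp [h']
    · by_cases h' : v ∈ l <;> simp [h, h']

lemma foldl_add {α : Type} (g : α → ℝ) (l : List α) (s : ℝ) :
    l.foldl (fun s v => s + g v) s = s + (l.map g).sum := by
  induction l generalizing s with
  | nil => simp
  | cons a l ih => rw [List.foldl_cons, ih, List.map_cons, List.sum_cons, add_assoc]

lemma sum_map_finRange {n : ℕ} (g : Fin n → ℝ) : ((List.finRange n).map g).sum = ∑ v, g v := by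
  rw [← List.ofFn_eq_map, List.sum_ofFn]

@[simp] lemma tabulate_val {n : ℕ} (p : Fin n → Bool) : (tabulate p).val = p := by
  simp [tabulate, loop_val, foldl_update]

lemma tabulate_steps {n : ℕ} (p : Fin n → Bool) : (tabulate p).steps ≤ n := by
  have := loop_steps_le_const (fun (S : Fin n → Bool) v => pure (Function.update S v (p v))) 0
    (List.finRange n) (fun s a _ => by simp) (fun _ => false)
  simpa [tabulate] using this

end Programs

/-! ### Merge sort -/

section Sorting

variable {n : ℕ}

lemma merge_perm (u : Fin n → ℝ) (xs ys : List (Fin n)) :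
    (merge u xs ys).val.Perm (xs ++ ys) := by
  fun_induction merge u xs ys with
  | case1 ys => simp
  | case2 x xs => simp
  | case3 x xs y ys h ih => simpa using ih
  | case4 x xs y ys h ih =>
    simp only [val_bind, val_pure]
    exact (List.Perm.cons y ih).trans (List.perm_middle (l₁ := x :: xs)).symm

lemma merge_sorted (u : Fin n → ℝ) (xs ys : List (Fin n))
    (hx : xs.Pairwise (fun a b => u a ≤ u b)) (hy : ys.Pairwise (fun a b => u a ≤ u b)) :
    (merge u xs ys).val.Pairwise (fun a b => u a ≤ u b) := by
  fun_induction merge u xs ys with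
  | case1 ys => simpa using hy
  | case2 x xs => simpa using hx
  | case3 x xs y ys h ih =>
    simp only [val_bind, val_pure]
    rw [List.pairwise_cons] at hx ⊢
    refine ⟨fun b hb => ?_, ih hx.2 hy⟩
    rcases List.mem_append.1 ((merge_perm u _ _).mem_iff.1 hb) with hb | hb
    · exact hx.1 b hb
    · rcases List.mem_cons.1 hb with rfl | hb
      · exact h
      · exact h.trans ((List.pairwise_cons.1 hy).1 b hb)
  | case4 x xs y ys h ih =>
    simp only [val_bind, val_pure]
    rw [List.pairwise_cons] at hy ⊢
    refine ⟨fun b hb => ?_, ih hx hy.2⟩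
    rcases List.mem_append.1 ((merge_perm u _ _).mem_iff.1 hb) with hb | hb
    · rcases List.mem_cons.1 hb with rfl | hb
      · exact (not_le.1 h).le
      · exact (not_le.1 h).le.trans ((List.pairwise_cons.1 hx).1 b hb)
    · exact hy.1 b hb

lemma merge_steps (u : Fin n → ℝ) (xs ys : List (Fin n)) :
    (merge u xs ys).steps ≤ xs.length + ys.length + 1 := by
  fun_induction merge u xs ys with
  | case1 ys => simp
  | case2 x xs => simp
  | case3 x xs y ys h ih => simp at ih ⊢; omega
  | case4 x xs y ys h ih => simp at ih ⊢; omega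

/-- Two vectors order the vertices in the same way. -/
def SameOrder (u u' : Fin n → ℝ) : Prop := ∀ v w, u v ≤ u w ↔ u' v ≤ u' w

lemma merge_congr {u u' : Fin n → ℝ} (h : SameOrder u u') (xs ys : List (Fin n)) :
    (merge u xs ys).val = (merge u' xs ys).val := by
  fun_induction merge u xs ys with
  | case1 ys => rw [merge]
  | case2 x xs => rw [merge]
  | case3 x xs y ys hxy ih => rw [merge, if_pos ((h _ _).1 hxy)]; simp [ih]
  | case4 x xs y ys hxy ih => rw [merge, if_neg (fun h' => hxy ((h _ _).2 h'))]; simp [ih]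

lemma sortBy_perm (u : Fin n → ℝ) (h : ℕ) (l : List (Fin n)) : (sortBy u h l).val.Perm l := by
  induction h generalizing l with
  | zero => simp [sortBy]
  | succ h ih =>
    simp only [sortBy, val_bind]
    refine (merge_perm u _ _).trans (((ih _).append (ih _)).trans ?_)
    rw [List.take_append_drop]

lemma sortBy_sorted (u : Fin n → ℝ) (h : ℕ) (l : List (Fin n)) (hl : l.length ≤ 2 ^ h) :
    (sortBy u h l).val.Pairwise (fun a b => u a ≤ u b) := by
  induction h generalizing l with
  | zero =>
    simp only [sortBy, val_bind, val_pure]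
    match l, hl with
    | [], _ => simp
    | [a], _ => simp
  | succ h ih =>
    simp only [sortBy, val_bind]
    refine merge_sorted u _ _ (ih _ ?_) (ih _ ?_)
    · simp
    · simp only [List.length_drop]; rw [pow_succ] at hl; omega

lemma sortBy_congr {u u' : Fin n → ℝ} (hu : SameOrder u u') (h : ℕ) (l : List (Fin n)) :
    (sortBy u h l).val = (sortBy u' h l).val := by
  induction h generalizing l with
  | zero => rfl
  | succ h ih => simp only [sortBy, val_bind]; rw [ih, ih, merge_congr hu]

/-- The summand 2 on the left pays for the constant costs of splitting and merging, so that the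
bound reproduces itself in the recursion. -/
lemma sortBy_steps (u : Fin n → ℝ) (h : ℕ) (l : List (Fin n)) :
    (sortBy u h l).steps + 2 ≤ 2 * l.length * h + 3 * 2 ^ h := by
  induction h generalizing l with
  | zero => simp [sortBy]
  | succ h ih =>
    simp only [sortBy, steps_bind, steps_tick]
    have h1 := ih (l.take (2 ^ h))
    have h2 := ih (l.drop (2 ^ h))
    have h3 := merge_steps u (sortBy u h (l.take (2 ^ h))).val (sortBy u h (l.drop (2 ^ h))).val
    rw [(sortBy_perm u h _).length_eq, (sortBy_perm u h _).length_eq] at h3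
    have h4 : l.length = (l.take (2 ^ h)).length + (l.drop (2 ^ h)).length := by
      rw [← List.length_append, List.take_append_drop]
    set a := (l.take (2 ^ h)).length
    set b := (l.drop (2 ^ h)).length
    rw [h4, pow_succ]
    nlinarith

end Sorting

/-! ### The lazy walk, volumes and borders as sums -/

section Sums

variable {n : ℕ} (G : SimpleGraph (Fin n)) [DecidableRel G.Adj]

/-- The vertex set with indicator array `A`. -/
def supp (A : Fin n → Bool) : Finset (Fin n) := Finset.univ.filter (fun v => A v = true)

@[simp] lemma mem_supp {A : Fin n → Bool} {v : Fin n} : v ∈ supp A ↔ A v = true := by simp [supp]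

/-- The number of pairs of adjacent vertices in `X × Y`. -/
def edges (X Y : Finset (Fin n)) : ℝ := ∑ v ∈ X, ∑ w ∈ Y, if G.Adj v w then 1 else 0

/-- The lazy random walk on `G{A}` in degree-normalised values. -/
def walk {E : Type*} [AddCommGroup E] [Module ℝ E] (A : Fin n → Bool) (u : Fin n → E)
    (v : Fin n) : E :=
  if A v then (1 / 2 : ℝ) • u v + (1 / 2 : ℝ) • ((G.degree v : ℝ)⁻¹ •
    ∑ w, if G.Adj v w then (if A w then u w else u v) else 0) else u v

lemma cast_vol (S : Finset (Fin n)) : (vol G S : ℝ) = ∑ v ∈ S, (G.degree v : ℝ) := by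
  simp [vol]

lemma cast_degree (v : Fin n) : (G.degree v : ℝ) = ∑ w, if G.Adj v w then (1 : ℝ) else 0 := by
  rw [Finset.sum_boole, ← G.neighborFinset_eq_filter, SimpleGraph.card_neighborFinset_eq_degree]

lemma nodup_nbrs (v : Fin n) : (nbrs G v).Nodup := (List.nodup_finRange n).filter _

@[simp] lemma mem_nbrs (v w : Fin n) : w ∈ nbrs G v ↔ G.Adj v w := by simp [nbrs]

lemma sum_nbrs (v : Fin n) (f : Fin n → ℝ) :
    ((nbrs G v).map f).sum = ∑ w, if G.Adj v w then f w else 0 := by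
  rw [← List.sum_toFinset f (nodup_nbrs G v), ← Finset.sum_filter]
  congr 1
  ext w
  simp

lemma length_nbrs (v : Fin n) : (nbrs G v).length = G.degree v := by
  have h := sum_nbrs G v (fun _ => 1)
  rw [← cast_degree] at h
  simpa using h

lemma walkStep_val (A : Fin n → Bool) (u : Fin n → ℝ) : (walkStep G A u).val = walk G A u := by
  -- The induction generalises over the output array only: the averages are always read from the old
  -- vector `u`.
  have h : ∀ (l : List (Fin n)) (u' : Fin n → ℝ),
      (loop (fun (u' : Fin n → ℝ) v =>
        if A v then do
          let s ← loop (fun (s : ℝ) w => pure (s + if A w then u w else u v)) 0 (nbrs G v)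
          pure (Function.update u' v (1 / 2 * u v + 1 / 2 * (s / (G.degree v : ℝ))))
        else pure u') u' l).val =
      fun v => if v ∈ l ∧ A v = true then walk G A u v else u' v := by
    intro l
    induction l with
    | nil => intro u'; simp
    | cons a l ih =>
      intro u'
      rw [loop_cons_val, ih]
      funext v
      by_cases ha : A a = true
      · simp only [ha, if_true, val_bind, val_pure, loop_val, foldl_add, sum_nbrs, zero_add]
        by_cases hv : v = a
        · subst hv
          by_cases hl : v ∈ l
          · simp [hl, ha]
          · simp only [hl, false_and, if_false, Function.update_self, List.mem_cons, true_or, ha,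
              and_self, if_true, walk, smul_eq_mul, div_eq_mul_inv]
            ring
        · simp [hv]
      · simp only [ha]
        by_cases hv : v = a
        · subst hv; simp [ha]
        · simp [hv]
  rw [walkStep, h]
  funext v
  by_cases hv : A v = true <;> simp [hv, walk]

lemma sum_map_degree (l : List (Fin n)) (hl : l.Nodup) (c d : ℕ) (hc : l.length ≤ n) :
    (l.map (fun v => c + d * G.degree v)).sum ≤ c * n + d * (2 * numEdges G) := by
  have h1 : (l.map (fun v => c + d * G.degree v)).sum =
      c * l.length + d * ∑ v ∈ l.toFinset, G.degree v := by
    rw [List.sum_toFinset _ hl]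
    clear hl hc
    induction l with
    | nil => simp
    | cons a l ih => simp [ih]; ring
  have h2 : ∑ v ∈ l.toFinset, G.degree v ≤ ∑ v, G.degree v :=
    Finset.sum_le_sum_of_subset (Finset.subset_univ _)
  rw [G.sum_degrees_eq_twice_card_edges] at h2
  rw [h1]
  gcongr
  exact h2

lemma walkStep_steps (A : Fin n → Bool) (u : Fin n → ℝ) :
    (walkStep G A u).steps ≤ n + 2 * numEdges G := by
  refine (loop_steps_le _ (fun v => G.degree v) _ ?_ _).trans ?_
  · intro s v _
    rw [steps_ite]
    split_ifs
    · have := loop_steps_le_const (fun (s : ℝ) w => pure (s + if A w then u w else u v)) 0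
        (nbrs G v) (fun s a _ => by simp) 0
      simpa [length_nbrs] using this
    · simp
  · have := sum_map_degree G (List.finRange n) (List.nodup_finRange n) 1 1 (by simp)
    simpa using this

/-- The walks of a history, the most recent set first. -/
def walks {E : Type*} [AddCommGroup E] [Module ℝ E] (u : Fin n → E) :
    List (Fin n → Bool) → Fin n → E
  | [] => u
  | A :: hist => walk G A (walks u hist)

lemma walkVector_val (hist : List (Fin n → Bool)) (r : Fin n → ℝ) :
    (walkVector G hist r).val = walks G (fun v => r v / (G.degree v : ℝ)) hist := by
  have h : ∀ u : Fin n → ℝ, (hist.reverse).foldl (fun u A => walk G A u) u = walks G u hist := by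
    intro u
    rw [List.foldl_reverse]
    induction hist with
    | nil => rfl
    | cons A hist ih => rw [List.foldr_cons, ih, walks]
  simp only [walkVector, val_bind, loop_val, val_pure, walkStep_val, foldl_update,
    List.mem_finRange, if_true, h]

lemma walkVector_steps (hist : List (Fin n → Bool)) (r : Fin n → ℝ) :
    (walkVector G hist r).steps ≤
      2 * n + 1 + hist.length * (2 + n + 2 * numEdges G) := by
  simp only [walkVector, steps_bind, steps_tick]
  have h1 := loop_steps_le_const (fun (u : Fin n → ℝ) v =>
    pure (Function.update u v (r v / (G.degree v : ℝ)))) 0 (List.finRange n)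
    (fun s a _ => by simp) (fun _ => 0)
  have h2 := loop_steps_le_const (fun u A => walkStep G A u) (n + 2 * numEdges G) hist.reverse
    (fun s a _ => walkStep_steps G a s) (loop (fun (u : Fin n → ℝ) v =>
    pure (Function.update u v (r v / (G.degree v : ℝ)))) (fun _ => 0) (List.finRange n)).val
  simp only [List.length_finRange, List.length_reverse] at h1 h2
  nlinarith

lemma volOf_val (A : Fin n → Bool) : (volOf G A).val = vol G (supp A) := by
  have h : ∀ (s : ℝ) (v : Fin n), (if A v = true then s + (G.degree v : ℝ) else s) =
      s + if A v = true then (G.degree v : ℝ) else 0 := by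
    intro s v; split_ifs <;> simp
  simp only [volOf, loop_val, val_pure, h, foldl_add, sum_map_finRange, zero_add]
  rw [cast_vol, supp, Finset.sum_filter]

lemma volOf_steps (A : Fin n → Bool) : (volOf G A).steps ≤ n := by
  have := loop_steps_le_const (fun (s : ℝ) v => pure (if A v then s + (G.degree v : ℝ) else s)) 0
    (List.finRange n) (fun s a _ => by simp) 0
  simpa [volOf] using this

/-- Which constant is subtracted is irrelevant: sweep cuts depend on the order alone, and the
analysis uses its own mean-zero vector `centered`. -/
lemma center_val (A : Fin n → Bool) (x : ℝ) (u : Fin n → ℝ) :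
    ∃ c : ℝ, (center G A x u).val = fun v => u v - c := by
  simp only [center, val_bind, loop_val, val_pure, foldl_update, List.mem_finRange, if_true]
  exact ⟨_, rfl⟩

lemma center_steps (A : Fin n → Bool) (x : ℝ) (u : Fin n → ℝ) :
    (center G A x u).steps ≤ 2 * n := by
  have h1 := loop_steps_le_const (fun (s : ℝ) v => pure (if A v then s + (G.degree v : ℝ) * u v
    else s)) 0 (List.finRange n) (fun s a _ => by simp) 0
  have h2 := fun s : ℝ => loop_steps_le_const (fun (u' : Fin n → ℝ) v =>
    pure (Function.update u' v (u v - s / x))) 0 (List.finRange n) (fun s a _ => by simp) u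
  simp only [List.length_finRange] at h1 h2
  simp only [center, steps_bind]
  have h3 := h2 (loop (fun (s : ℝ) v => pure (if A v then s + (G.degree v : ℝ) * u v
    else s)) 0 (List.finRange n)).val
  omega

lemma SameOrder.sub_const {u u' : Fin n → ℝ} (h : SameOrder u u') (c c' : ℝ) :
    SameOrder (fun v => u v - c) (fun v => u' v - c') := by
  intro v w; simpa using h v w

end Sums

/-! ### Grouping equal values -/

section BlocksSection

variable {n : ℕ}

/-- `B` groups the vertices in `A` by their value in `u`. -/
structure IsGrouping (u : Fin n → ℝ) (A : Finset (Fin n)) (B : Blocks n) : Prop where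
  mem_block : ∀ j v, v ∈ B.block j ↔ v ∈ A ∧ B.rank v = j
  nodup : ∀ j, (B.block j).Nodup
  le_iff : ∀ v ∈ A, ∀ w ∈ A, (u v ≤ u w ↔ B.rank v ≤ B.rank w)
  rank_lt : ∀ v ∈ A, B.rank v < B.num
  num_le : B.num ≤ A.card

/-- One round of the grouping loop. -/
def addToBlocks (u : Fin n → ℝ) (s : Blocks n) (v : Fin n) : Timed (Blocks n) :=
  let j := if s.last = some (u v) then s.num - 1 else s.num
  pure
    { rank := Function.update s.rank v j
      block := Function.update s.block j (v :: s.block j)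
      num := j + 1
      last := some (u v) }

lemma mkBlocks_eq (A : Fin n → Bool) (u : Fin n → ℝ) : mkBlocks A u = (do
    tick n
    let l ← sortBy u (Nat.clog 2 n) ((List.finRange n).filter (fun v => A v))
    tick (1 + n)
    loop (addToBlocks u) { rank := fun _ => 0, block := fun _ => [], num := 0, last := none } l) :=
  rfl

lemma length_filter_finRange_le (A : Fin n → Bool) :
    ((List.finRange n).filter (fun v => A v)).length ≤ n := by
  simpa using List.length_filter_le (fun v => A v) (List.finRange n)

/-- After sorting, equal values are adjacent, so comparing with the last value is enough to decide
whether a new group begins. -/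
lemma isGrouping_mkBlocks (A : Fin n → Bool) (u : Fin n → ℝ) :
    IsGrouping u (supp A) (mkBlocks A u).val := by
  rw [mkBlocks_eq]
  simp only [val_bind]
  set l := (sortBy u (Nat.clog 2 n) ((List.finRange n).filter (fun v => A v))).val with hl
  have hperm : l.Perm ((List.finRange n).filter (fun v => A v)) := sortBy_perm _ _ _
  have hsort : l.Pairwise (fun a b => u a ≤ u b) := by
    refine sortBy_sorted _ _ _ ((length_filter_finRange_le A).trans ?_)
    exact Nat.le_pow_clog (by norm_num) n
  have hnodup : l.Nodup := hperm.nodup_iff.2 ((List.nodup_finRange n).filter _)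
  -- Besides the grouping, the invariant records that the open group has number `num - 1` and
  -- carries the largest value seen so far.
  have key := loop_inv (addToBlocks u) (fun l₁ s => IsGrouping u l₁.toFinset s ∧
    ((s.last = none ∧ l₁ = []) ∨ ∃ v ∈ l₁, s.last = some (u v) ∧ s.rank v + 1 = s.num ∧
      ∀ w ∈ l₁, u w ≤ u v)) { rank := fun _ => 0, block := fun _ => [], num := 0, last := none } l
    ⟨⟨by simp, by simp, by simp, by simp, by simp⟩, Or.inl ⟨rfl, rfl⟩⟩ ?_
  · have h : l.toFinset = supp A := by
      ext v
      rw [List.mem_toFinset, hperm.mem_iff]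
      simp
    rw [← h]
    exact key.1
  · rintro l₁ a l₂ hll s ⟨hs, hlast⟩
    rw [hll] at hsort hnodup
    have hle : ∀ w ∈ l₁, u w ≤ u a := fun w hw =>
      (List.pairwise_append.1 hsort).2.2 w hw a List.mem_cons_self
    have hna : a ∉ l₁ := fun h =>
      (List.nodup_append.1 hnodup).2.2 a h a List.mem_cons_self rfl
    set j := if s.last = some (u a) then s.num - 1 else s.num with hj
    have hval : (addToBlocks u s a).val =
      { rank := Function.update s.rank a j
        block := Function.update s.block j (a :: s.block j)
        num := j + 1
        last := some (u a) } := rfl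
    -- The new vertex takes the top rank, and ties in rank are exactly ties in value.
    have hrank : ∀ w ∈ l₁, s.rank w ≤ j ∧ (u a ≤ u w ↔ j ≤ s.rank w) := by
      intro w hw
      have h1 := hs.rank_lt w (List.mem_toFinset.2 hw)
      rcases hlast with ⟨-, rfl⟩ | ⟨v, hv, h2, h3, h4⟩
      · simp at hw
      · by_cases hc : s.last = some (u a)
        · rw [if_pos hc] at hj
          rw [hc] at h2
          have h5 : u a = u v := Option.some.inj h2
          have h6 := hs.le_iff v (List.mem_toFinset.2 hv) w (List.mem_toFinset.2 hw)
          refine ⟨by omega, ?_⟩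
          rw [h5, h6]
          omega
        · rw [if_neg hc] at hj
          refine ⟨by omega, ⟨fun h => ?_, fun h => by omega⟩⟩
          exfalso
          apply hc
          rw [h2]
          congr 1
          exact le_antisymm (hle v hv) (h.trans (h4 w hw))
    rw [hval]
    refine ⟨⟨?_, ?_, ?_, ?_, ?_⟩, Or.inr ⟨a, by simp, rfl, by simp, ?_⟩⟩
    · intro i v
      by_cases hv : v = a
      · subst hv
        by_cases hi : i = j
        · subst hi; simp
        · have := hs.mem_block i v
          simp [hi, this, hna, Ne.symm hi]
      · by_cases hi : i = j
        · have := hs.mem_block j v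
          simp [hi, hv, this]
        · have := hs.mem_block i v
          simp [hi, hv, this]
    · intro i
      by_cases hi : i = j
      · subst hi
        have := hs.mem_block j a
        simp [this, hna, hs.nodup]
      · simpa [hi] using hs.nodup i
    · intro v hv w hw
      simp only [List.toFinset_append, Finset.mem_union, List.mem_toFinset, List.mem_singleton]
        at hv hw
      by_cases hva : v = a
      · subst hva
        by_cases hwa : w = v
        · subst hwa; simp
        · simp only [hwa, or_false] at hw
          simpa [hwa] using (hrank w hw).2
      · simp only [hva, or_false] at hv
        by_cases hwa : w = a
        · subst hwa
          simp [hva, hle v hv, (hrank v hv).1]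
        · simp only [hwa, or_false] at hw
          simpa [hva, hwa] using
            hs.le_iff v (List.mem_toFinset.2 hv) w (List.mem_toFinset.2 hw)
    · intro v hv
      simp only [List.toFinset_append, Finset.mem_union, List.mem_toFinset, List.mem_singleton]
        at hv
      by_cases hva : v = a
      · subst hva; simp
      · simp only [hva, or_false] at hv
        have := (hrank v hv).1
        simp [hva]
        omega
    · have h1 := hs.num_le
      have h2 : (l₁ ++ [a]).toFinset = insert a l₁.toFinset := by ext; simp
      rw [h2, Finset.card_insert_of_notMem (by simpa using hna)]
      dsimp only
      split_ifs at hj <;> omega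
    · intro w hw
      rcases List.mem_append.1 hw with hw | hw
      · exact hle w hw
      · rw [List.mem_singleton.1 hw]

lemma SameOrder.eq_iff {u u' : Fin n → ℝ} (h : SameOrder u u') (v w : Fin n) :
    u v = u w ↔ u' v = u' w := by
  rw [le_antisymm_iff, le_antisymm_iff, h, h]

/-- The field `last` holds a real number and may differ, hence the claim concerns the other three
fields. In the induction both copies of `last` are values of one common vertex, so the equality
tests agree. -/
lemma mkBlocks_congr {u u' : Fin n → ℝ} (h : SameOrder u u') (A : Fin n → Bool) :
    (mkBlocks A u).val.rank = (mkBlocks A u').val.rank ∧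
    (mkBlocks A u).val.block = (mkBlocks A u').val.block ∧
    (mkBlocks A u).val.num = (mkBlocks A u').val.num := by
  simp only [mkBlocks_eq, val_bind]
  rw [sortBy_congr h]
  generalize (sortBy u' (Nat.clog 2 n) ((List.finRange n).filter (fun v => A v))).val = l
  have key : ∀ (l : List (Fin n)) (s s' : Blocks n), s.rank = s'.rank → s.block = s'.block →
      s.num = s'.num → ((s.last = none ∧ s'.last = none) ∨
        ∃ v, s.last = some (u v) ∧ s'.last = some (u' v)) →
      (loop (addToBlocks u) s l).val.rank = (loop (addToBlocks u') s' l).val.rank ∧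
      (loop (addToBlocks u) s l).val.block = (loop (addToBlocks u') s' l).val.block ∧
      (loop (addToBlocks u) s l).val.num = (loop (addToBlocks u') s' l).val.num := by
    intro l
    induction l with
    | nil => intro s s' h1 h2 h3 _; exact ⟨h1, h2, h3⟩
    | cons a l ih =>
      intro s s' h1 h2 h3 h4
      rw [loop_cons_val, loop_cons_val]
      have h5 : (s.last = some (u a)) ↔ (s'.last = some (u' a)) := by
        rcases h4 with ⟨h4, h4'⟩ | ⟨v, h4, h4'⟩
        · simp [h4, h4']
        · simp [h4, h4', h.eq_iff]
      have h6 : (if s.last = some (u a) then s.num - 1 else s.num) =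
          (if s'.last = some (u' a) then s'.num - 1 else s'.num) := by
        simp only [h5, h3]
      apply ih
      · simp only [addToBlocks, val_pure, h6, h1]
      · simp only [addToBlocks, val_pure, h6, h2]
      · simp only [addToBlocks, val_pure, h6]
      · exact Or.inr ⟨a, rfl, rfl⟩
  exact key l _ _ rfl rfl rfl (Or.inl ⟨rfl, rfl⟩)

lemma mkBlocks_steps (A : Fin n → Bool) (u : Fin n → ℝ) :
    (mkBlocks A u).steps ≤ 3 * n + 2 * n * Nat.clog 2 n + 3 * 2 ^ Nat.clog 2 n := by
  rw [mkBlocks_eq]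
  simp only [steps_bind, steps_tick]
  have hlen := length_filter_finRange_le A
  have h1 := sortBy_steps u (Nat.clog 2 n) ((List.finRange n).filter (fun v => A v))
  have h2 := loop_steps_le_const (addToBlocks u) 0
    (sortBy u (Nat.clog 2 n) ((List.finRange n).filter (fun v => A v))).val
    (fun s a _ => by simp [addToBlocks])
    { rank := fun _ => 0, block := fun _ => [], num := 0, last := none }
  rw [(sortBy_perm u _ _).length_eq] at h2
  have h3 := Nat.mul_le_mul_right (2 * Nat.clog 2 n) hlen
  nlinarith

end BlocksSection

/-! ### Loops over ranges -/

section Ranges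

variable {σ : Type}

lemma loop_range_inv (f : σ → ℕ → Timed σ) (P : ℕ → σ → Prop) (k : ℕ)
    (h : ∀ i < k, ∀ s, P i s → P (i + 1) (f s i).val) (s : σ) (hs : P 0 s) :
    P k (loop f s (List.range k)).val := by
  induction k with
  | zero => simpa using hs
  | succ k ih =>
    rw [List.range_succ, loop_append_val]
    exact h k (Nat.lt_succ_self k) _ (ih (fun i hi => h i (hi.trans (Nat.lt_succ_self k))))

lemma loop_range_reverse_inv (f : σ → ℕ → Timed σ) (P : ℕ → σ → Prop) (k : ℕ)
    (h : ∀ i < k, ∀ s, P (i + 1) s → P i (f s i).val) (s : σ) (hs : P k s) :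
    P 0 (loop f s (List.range k).reverse).val := by
  induction k generalizing s with
  | zero => simpa using hs
  | succ k ih =>
    rw [List.range_succ, List.reverse_append, List.reverse_singleton, List.singleton_append,
      loop_cons_val]
    exact ih (fun i hi => h i (hi.trans (Nat.lt_succ_self k))) _
      (h k (Nat.lt_succ_self k) s hs)

end Ranges

/-! ### The search tree -/

namespace SegTree

/-- The tree `t` has the leaves `s, …, s + 2 ^ h - 1` with the values `f i`. -/
def Rep (vol : ℕ → ℝ) : ℕ → ℕ → (ℕ → ℝ) → SegTree → Prop
  | 0, s, f, leaf idx v val => idx = s ∧ v = vol s ∧ val = f s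
  | h + 1, s, f, node mid mv pend top l r =>
    mid = s + 2 ^ h ∧ mv = vol (s + 2 ^ h) ∧ Rep vol h s (fun i => f i - pend) l ∧
      Rep vol h (s + 2 ^ h) (fun i => f i - pend) r ∧ top = pend + max l.maxVal r.maxVal
  | _, _, _, _ => False

variable {vol : ℕ → ℝ}

lemma Rep.congr {h : ℕ} {s : ℕ} {f g : ℕ → ℝ} {t : SegTree} (ht : Rep vol h s f t)
    (hfg : ∀ i, s ≤ i → i < s + 2 ^ h → f i = g i) : Rep vol h s g t := by
  induction h generalizing s f g t with
  | zero =>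
    cases t with
    | leaf idx v val =>
      obtain ⟨h1, h2, h3⟩ := ht
      exact ⟨h1, h2, h3.trans (hfg s le_rfl (by simp))⟩
    | node => exact ht.elim
  | succ h ih =>
    cases t with
    | leaf => exact ht.elim
    | node mid mv pend top l r =>
      obtain ⟨h1, h2, h3, h4, h5⟩ := ht
      have hp : 2 ^ (h + 1) = 2 ^ h + 2 ^ h := by ring
      refine ⟨h1, h2, ih h3 ?_, ih h4 ?_, h5⟩
      · intro i hi hi'; rw [hfg i hi (by omega)]
      · intro i hi hi'; rw [hfg i (by omega) (by omega)]

lemma maxVal_node (mid : ℕ) (mv pend top : ℝ) (l r : SegTree) :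
    (node mid mv pend top l r).maxVal = top := rfl

lemma Rep.le_maxVal {h : ℕ} {s : ℕ} {f : ℕ → ℝ} {t : SegTree} (ht : Rep vol h s f t)
    (i : ℕ) (hi : s ≤ i) (hi' : i < s + 2 ^ h) : f i ≤ t.maxVal := by
  induction h generalizing s f t with
  | zero =>
    cases t with
    | leaf idx v val =>
      obtain ⟨h1, h2, h3⟩ := ht
      have : i = s := by simp at hi'; omega
      subst this
      exact h3.symm.le
    | node => exact ht.elim
  | succ h ih =>
    cases t with
    | leaf => exact ht.elim
    | node mid mv pend top l r =>
      obtain ⟨h1, h2, h3, h4, h5⟩ := ht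
      have hp : 2 ^ (h + 1) = 2 ^ h + 2 ^ h := by ring
      rw [maxVal_node, h5]
      by_cases hc : i < s + 2 ^ h
      · have := ih h3 hi hc
        have := le_max_left l.maxVal r.maxVal
        linarith
      · have := ih h4 (by omega) (by omega)
        have := le_max_right l.maxVal r.maxVal
        linarith

lemma Rep.exists_maxVal {h : ℕ} {s : ℕ} {f : ℕ → ℝ} {t : SegTree} (ht : Rep vol h s f t) :
    ∃ i, s ≤ i ∧ i < s + 2 ^ h ∧ f i = t.maxVal := by
  induction h generalizing s f t with
  | zero =>
    cases t with
    | leaf idx v val => exact ⟨s, le_rfl, by simp, ht.2.2.symm⟩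
    | node => exact ht.elim
  | succ h ih =>
    cases t with
    | leaf => exact ht.elim
    | node mid mv pend top l r =>
      obtain ⟨h1, h2, h3, h4, h5⟩ := ht
      have hp : 2 ^ (h + 1) = 2 ^ h + 2 ^ h := by ring
      rw [maxVal_node, h5]
      rcases le_total l.maxVal r.maxVal with hc | hc
      · obtain ⟨i, hi1, hi2, hi3⟩ := ih h4
        exact ⟨i, by omega, by omega, by rw [max_eq_right hc, ← hi3]; ring⟩
      · obtain ⟨i, hi1, hi2, hi3⟩ := ih h3
        exact ⟨i, by omega, by omega, by rw [max_eq_left hc, ← hi3]; ring⟩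

lemma Rep.shift {h : ℕ} {s : ℕ} {f : ℕ → ℝ} {t : SegTree} (ht : Rep vol h s f t) (x : ℝ) :
    Rep vol h s (fun i => f i + x) (t.shift x) := by
  cases h with
  | zero =>
    cases t with
    | leaf idx v val =>
      obtain ⟨h1, h2, h3⟩ := ht
      exact ⟨h1, h2, by rw [h3]⟩
    | node => exact ht.elim
  | succ h =>
    cases t with
    | leaf => exact ht.elim
    | node mid mv pend top l r =>
      obtain ⟨h1, h2, h3, h4, h5⟩ := ht
      refine ⟨h1, h2, h3.congr fun i _ _ => by ring, h4.congr fun i _ _ => by ring, ?_⟩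
      rw [h5]; ring

lemma rep_build (vol val : ℕ → ℝ) (h s : ℕ) : Rep vol h s val (build vol val h s).val := by
  induction h generalizing s with
  | zero => exact ⟨rfl, rfl, rfl⟩
  | succ h ih =>
    exact ⟨rfl, rfl, (ih s).congr fun i _ _ => by ring, (ih _).congr fun i _ _ => by ring,
      (zero_add _).symm⟩

lemma build_steps (vol val : ℕ → ℝ) (h s : ℕ) :
    (build vol val h s).steps + 1 = 2 * 2 ^ h := by
  induction h generalizing s with
  | zero => rfl
  | succ h ih =>
    have h1 := ih s
    have h2 := ih (s + 2 ^ h)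
    simp only [build, steps_bind, steps_tick, steps_pure]
    rw [pow_succ]
    omega

/-- One of the two subtrees lies wholly on one side of `p`; it is shifted as a whole or left alone,
and the recursion follows a single path. -/
lemma Rep.addFrom {h : ℕ} {s : ℕ} {f : ℕ → ℝ} {t : SegTree} (ht : Rep vol h s f t) (p : ℕ)
    (x : ℝ) : Rep vol h s (fun i => f i + if p ≤ i then x else 0) (t.addFrom p x).val ∧
      (t.addFrom p x).steps ≤ h + 1 := by
  induction h generalizing s f t with
  | zero =>
    cases t with
    | leaf idx v val =>
      obtain ⟨h1, h2, h3⟩ := ht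
      subst h1 h2 h3
      refine ⟨⟨rfl, rfl, ?_⟩, le_of_eq rfl⟩
      by_cases hp : p ≤ idx <;> simp [hp]
    | node => exact ht.elim
  | succ h ih =>
    cases t with
    | leaf => exact ht.elim
    | node mid mv pend top l r =>
      obtain ⟨h1, h2, h3, h4, h5⟩ := ht
      have hp : 2 ^ (h + 1) = 2 ^ h + 2 ^ h := by ring
      simp only [SegTree.addFrom, val_bind, steps_bind, val_ite, steps_ite, steps_tick, val_pure,
        steps_pure]
      by_cases hc : p ≤ mid
      · simp only [hc, if_true]
        refine ⟨⟨h1, h2, (ih h3).1.congr fun i _ _ => by ring,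
          (h4.shift x).congr fun i hi _ => ?_, rfl⟩, ?_⟩
        · dsimp only; rw [if_pos (by omega)]; ring
        · have := (ih h3).2
          omega
      · simp only [hc, if_false]
        refine ⟨⟨h1, h2, h3.congr fun i _ hi => ?_,
          (ih h4).1.congr fun i hi _ => by ring, rfl⟩, ?_⟩
        · dsimp only; rw [if_neg (by omega)]; ring
        · have := (ih h4).2
          omega

/-- The two ways in which a search can end. -/
def FindSpec (vol f : ℕ → ℝ) (h s : ℕ) (κ θ : ℝ) : Option (ℕ × ℝ) → Prop
  | none => ∀ i, s ≤ i → i < s + 2 ^ h → vol i ≤ κ → f i ≤ θ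
  | some (i, x) => s ≤ i ∧ i < s + 2 ^ h ∧ x = vol i ∧ vol i ≤ κ ∧ θ < f i ∧
      ∀ i', i < i' → i' < s + 2 ^ h → vol i' ≤ κ → f i' ≤ θ

lemma findLast_node (κ θ : ℝ) (mid : ℕ) (midVol pend top : ℝ) (l r : SegTree) :
    findLast κ θ (node mid midVol pend top l r) = (do
      tick 1
      if top ≤ θ then
        pure none
      else if midVol ≤ κ then
        let o ← findLast κ (θ - pend) r
        match o with
        | some res => pure (some res)
        | none => findLast κ (θ - pend) l
      else
        findLast κ (θ - pend) l) := rfl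

/-- Both subtrees are visited only if the right one has no hit although its first leaf satisfies the
volume bound. All leaves on the left then satisfy it too, and there `top` decides in one step
whether a hit exists. The sharper bounds for failing searches and for trees without volume
restriction are what makes the induction for `4 * h + 1` close. -/
lemma Rep.findLast {h : ℕ} {s : ℕ} {f : ℕ → ℝ} {t : SegTree} (ht : Rep vol h s f t)
    (hvol : Monotone vol) (κ θ : ℝ) :
    FindSpec vol f h s κ θ (t.findLast κ θ).val ∧
      (t.findLast κ θ).steps ≤ 4 * h + 1 ∧
      ((t.findLast κ θ).val = none → (t.findLast κ θ).steps ≤ 2 * h + 1) ∧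
      ((∀ i, s ≤ i → i < s + 2 ^ h → vol i ≤ κ) → (t.findLast κ θ).steps ≤ 2 * h + 1 ∧
        ((t.findLast κ θ).val = none → (t.findLast κ θ).steps = 1)) := by
  induction h generalizing s f t θ with
  | zero =>
    cases t with
    | leaf idx v val =>
      obtain ⟨h1, h2, h3⟩ := ht
      subst h1 h2 h3
      have hs : (SegTree.findLast κ θ (leaf idx (vol idx) (f idx))).steps = 1 := rfl
      have hv : (SegTree.findLast κ θ (leaf idx (vol idx) (f idx))).val =
        if vol idx ≤ κ ∧ θ < f idx then some (idx, vol idx) else none := rfl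
      rw [hs, hv]
      refine ⟨?_, by omega, by omega, fun _ => ⟨by omega, fun _ => rfl⟩⟩
      split_ifs with hc
      · exact ⟨le_rfl, by simp, rfl, hc.1, hc.2, fun i' hi hi' => by simp at hi'; omega⟩
      · intro i hi hi' hk
        have : i = idx := by simp at hi'; omega
        subst this
        by_contra hcon
        exact hc ⟨hk, not_le.1 hcon⟩
    | node => exact ht.elim
  | succ h ih =>
    cases t with
    | leaf => exact ht.elim
    | node mid mv pend top l r =>
      have hmax := ht.le_maxVal
      have hex := ht.exists_maxVal
      obtain ⟨h1, h2, h3, h4, h5⟩ := ht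
      subst h1 h2
      have hp : 2 ^ (h + 1) = 2 ^ h + 2 ^ h := by ring
      obtain ⟨l1, l2, l3, l4⟩ := ih h3 (θ - pend)
      obtain ⟨r1, r2, r3, r4⟩ := ih h4 (θ - pend)
      simp only [findLast_node, val_bind, steps_bind, val_ite, steps_ite, steps_tick, val_pure,
        steps_pure]
      by_cases htop : top ≤ θ
      · simp only [htop, if_true]
        refine ⟨fun i hi hi' _ => (hmax i hi hi').trans htop, by omega, fun _ => by omega,
          fun _ => ⟨by omega, fun _ => trivial⟩⟩
      · simp only [htop, if_false]
        by_cases hmid : vol (s + 2 ^ h) ≤ κ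
        · simp only [hmid, if_true]
          have hl : ∀ i, s ≤ i → i < s + 2 ^ h → vol i ≤ κ := fun i _ hi =>
            (hvol hi.le).trans hmid
          have l4 := l4 hl
          rcases hr : (SegTree.findLast κ (θ - pend) r).val with _ | ⟨i, x⟩
          · rw [hr] at r1
            have r3 := r3 hr
            have hspec : FindSpec vol f (h + 1) s κ θ
                (SegTree.findLast κ (θ - pend) l).val := by
              rcases hlv : (SegTree.findLast κ (θ - pend) l).val with _ | ⟨i, x⟩
              · rw [hlv] at l1
                intro i hi hi' hk
                by_cases hc : i < s + 2 ^ h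
                · linarith [l1 i hi hc hk]
                · linarith [r1 i (by omega) (by omega) hk]
              · rw [hlv] at l1
                obtain ⟨a1, a2, a3, a4, a5, a6⟩ := l1
                refine ⟨a1, by omega, a3, a4, by linarith, fun i' hi hi' hk => ?_⟩
                by_cases hc : i' < s + 2 ^ h
                · linarith [a6 i' hi hc hk]
                · linarith [r1 i' (by omega) (by omega) hk]
            refine ⟨hspec, by dsimp only; omega, fun hn => ?_, fun hall => ⟨?_, fun hn => ?_⟩⟩
            · have := l4.2 hn
              dsimp only
              omega
            · have := (r4 (fun i hi hi' => hall i (by omega) (by omega))).2 hr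
              dsimp only
              omega
            -- If no leaf is excluded by volume, the leaf attaining `top > θ` is a hit, so the
            -- search cannot fail past the first test.
            · exfalso
              dsimp only at hn
              rw [hn] at hspec
              obtain ⟨i, hi, hi', hi2⟩ := hex
              have := hspec i hi hi' (hall i hi hi')
              rw [hi2] at this
              exact htop this
          · rw [hr] at r1
            obtain ⟨a1, a2, a3, a4, a5, a6⟩ := r1
            refine ⟨⟨by omega, by omega, a3, a4, by linarith, fun i' hi hi' hk => ?_⟩, ?_, ?_, ?_⟩
            · linarith [a6 i' hi (by omega) hk]
            · dsimp only [steps_pure]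
              omega
            · intro hn
              exact absurd hn (by simp)
            · intro hall
              refine ⟨?_, fun hn => absurd hn (by simp)⟩
              have := (r4 (fun i hi hi' => hall i (by omega) (by omega))).1
              dsimp only [steps_pure]
              omega
        · simp only [hmid, if_false]
          have hr : ∀ i, s + 2 ^ h ≤ i → ¬ vol i ≤ κ := fun i hi hk =>
            hmid ((hvol hi).trans hk)
          refine ⟨?_, by omega, fun hn => ?_, fun hall => ?_⟩
          · rcases hlv : (SegTree.findLast κ (θ - pend) l).val with _ | ⟨i, x⟩
            · rw [hlv] at l1
              intro i hi hi' hk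
              have hc : i < s + 2 ^ h := by
                by_contra hc
                exact hr i (by omega) hk
              linarith [l1 i hi hc hk]
            · rw [hlv] at l1
              obtain ⟨a1, a2, a3, a4, a5, a6⟩ := l1
              refine ⟨a1, by omega, a3, a4, by linarith, fun i' hi hi' hk => ?_⟩
              have hc : i' < s + 2 ^ h := by
                by_contra hc
                exact hr i' (by omega) hk
              linarith [a6 i' hi hc hk]
          · have := l3 hn
            omega
          · exact absurd (hall (s + 2 ^ h) (by omega) (by have := Nat.two_pow_pos h; omega)) hmid

end SegTree

/-! ### Borders -/

section Borders

variable {n : ℕ} (G : SimpleGraph (Fin n)) [DecidableRel G.Adj]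

lemma edges_comm (X Y : Finset (Fin n)) : edges G X Y = edges G Y X := by
  rw [edges, edges, Finset.sum_comm]
  simp only [G.adj_comm]

lemma edges_nonneg (X Y : Finset (Fin n)) : 0 ≤ edges G X Y :=
  Finset.sum_nonneg fun _ _ => Finset.sum_nonneg fun _ _ => by split_ifs <;> norm_num

lemma edges_union_left {X Y : Finset (Fin n)} (h : Disjoint X Y) (Z : Finset (Fin n)) :
    edges G (X ∪ Y) Z = edges G X Z + edges G Y Z := by
  rw [edges, Finset.sum_union h, edges, edges]

lemma edges_union_right {X Y : Finset (Fin n)} (h : Disjoint X Y) (Z : Finset (Fin n)) :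
    edges G Z (X ∪ Y) = edges G Z X + edges G Z Y := by
  rw [edges_comm, edges_union_left G h, edges_comm, edges_comm G Y]

lemma edges_mono {X X' Y Y' : Finset (Fin n)} (h : X ⊆ X') (h' : Y ⊆ Y') :
    edges G X Y ≤ edges G X' Y' := by
  have h0 : ∀ v w : Fin n, (0 : ℝ) ≤ if G.Adj v w then 1 else 0 := fun v w => by
    split_ifs <;> norm_num
  refine (Finset.sum_le_sum fun v _ => ?_).trans
    (Finset.sum_le_sum_of_subset_of_nonneg h fun v _ _ => ?_)
  · exact Finset.sum_le_sum_of_subset_of_nonneg h' fun w _ _ => h0 v w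
  · exact Finset.sum_nonneg fun w _ => h0 v w

lemma edges_le_vol (X Y : Finset (Fin n)) : edges G X Y ≤ vol G X := by
  refine (edges_mono G le_rfl (Finset.subset_univ Y)).trans ?_
  rw [edges, cast_vol]
  simp only [← cast_degree, le_refl]

@[simp] lemma edges_empty_left (X : Finset (Fin n)) : edges G ∅ X = 0 := by simp [edges]
@[simp] lemma edges_empty_right (X : Finset (Fin n)) : edges G X ∅ = 0 := by simp [edges]

/-- The border of `S` in `G{A}`. -/
def bd (A S : Finset (Fin n)) : ℝ := edges G S (A \ S)

lemma bd_nonneg (A S : Finset (Fin n)) : 0 ≤ bd G A S := edges_nonneg _ _ _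

lemma bd_sdiff {A S : Finset (Fin n)} (h : S ⊆ A) : bd G A (A \ S) = bd G A S := by
  rw [bd, bd, Finset.sdiff_sdiff_eq_self h, edges_comm]

lemma border_eq (S : Finset (Fin n)) : (border G S : ℝ) = edges G S Sᶜ := by
  rw [border, SimpleGraph.interedges, Rel.interedges, Finset.card_filter, Finset.sum_product]
  push_cast
  rfl

lemma vol_union {X Y : Finset (Fin n)} (h : Disjoint X Y) :
    vol G (X ∪ Y) = vol G X + vol G Y := Finset.sum_union h

lemma vol_mono {X Y : Finset (Fin n)} (h : X ⊆ Y) : vol G X ≤ vol G Y :=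
  Finset.sum_le_sum_of_subset h

lemma vol_union_add_inter (X Y : Finset (Fin n)) :
    vol G (X ∪ Y) + vol G (X ∩ Y) = vol G X + vol G Y := Finset.sum_union_inter

lemma vol_sdiff {X Y : Finset (Fin n)} (h : X ⊆ Y) : vol G (Y \ X) + vol G X = vol G Y :=
  Finset.sum_sdiff h

@[simp] lemma vol_empty : vol G ∅ = 0 := rfl

lemma vol_univ : vol G Finset.univ = 2 * numEdges G := G.sum_degrees_eq_twice_card_edges

/-- Borders are submodular. -/
lemma bd_submodular {A P S : Finset (Fin n)} (hP : P ⊆ A) (hS : S ⊆ A) :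
    bd G A (P ∪ S) + bd G A (P ∩ S) ≤ bd G A P + bd G A S := by
  set I := P ∩ S
  set P' := P \ S
  set S' := S \ P
  set R := A \ (P ∪ S)
  have e1 : P = I ∪ P' := by ext; simp [I, P']; tauto
  have e2 : S = I ∪ S' := by ext; simp [I, S']; tauto
  have e3 : P ∪ S = I ∪ (P' ∪ S') := by ext; simp [I, P', S']; tauto
  have e4 : A \ P = S' ∪ R := by
    ext v; have := @hS v; simp [S', R]; tauto
  have e5 : A \ S = P' ∪ R := by
    ext v; have := @hP v; simp [P', R]; tauto
  have e6 : A \ I = (P' ∪ S') ∪ R := by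
    ext v; have h1 := @hP v; have h2 := @hS v; simp [P', S', R, I]; tauto
  have d1 : Disjoint I P' := by
    rw [Finset.disjoint_left]; intro v; simp only [I, P', Finset.mem_inter, Finset.mem_sdiff]; tauto
  have d2 : Disjoint I S' := by
    rw [Finset.disjoint_left]; intro v; simp [I, S']; tauto
  have d3 : Disjoint P' S' := by
    rw [Finset.disjoint_left]; intro v; simp [P', S']; tauto
  have d4 : Disjoint S' R := by
    rw [Finset.disjoint_left]; intro v; simp [S', R]; tauto
  have d5 : Disjoint P' R := by
    rw [Finset.disjoint_left]; intro v; simp [P', R]; tauto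
  have d6 : Disjoint (P' ∪ S') R := Finset.disjoint_union_left.2 ⟨d5, d4⟩
  have d7 : Disjoint I (P' ∪ S') := Finset.disjoint_union_right.2 ⟨d1, d2⟩
  have b1 : bd G A (P ∪ S) = edges G I R + (edges G P' R + edges G S' R) := by
    rw [bd]; change edges G (P ∪ S) R = _
    rw [e3, edges_union_left G d7, edges_union_left G d3]
  have b2 : bd G A I = edges G I P' + edges G I S' + edges G I R := by
    rw [bd, e6, edges_union_right G d6, edges_union_right G d3]
  have b3 : bd G A P = edges G I S' + edges G I R + (edges G P' S' + edges G P' R) := by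
    rw [bd, e4, e1, edges_union_left G d1, edges_union_right G d4, edges_union_right G d4]
  have b4 : bd G A S = edges G I P' + edges G I R + (edges G S' P' + edges G S' R) := by
    rw [bd, e5, e2, edges_union_left G d2, edges_union_right G d5, edges_union_right G d5]
  -- The two sides differ exactly by the edges between `P \ S` and `S \ P`, counted in both
  -- directions.
  have := edges_nonneg G P' S'
  have := edges_nonneg G S' P'
  rw [b1, b2, b3, b4]
  linarith

end Borders

/-! ### Prefixes and suffixes of the sweep order -/

section Sweep

variable {n : ℕ} (G : SimpleGraph (Fin n)) [DecidableRel G.Adj]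

/-- The vertices of rank below `i`. -/
def pre (A : Finset (Fin n)) (B : Blocks n) (i : ℕ) : Finset (Fin n) :=
  A.filter (fun v => B.rank v < i)

/-- The vertices of rank at least `j`. -/
def suf (A : Finset (Fin n)) (B : Blocks n) (j : ℕ) : Finset (Fin n) :=
  A.filter (fun v => j ≤ B.rank v)

/-- The vertices of rank `j`. -/
def blk (A : Finset (Fin n)) (B : Blocks n) (j : ℕ) : Finset (Fin n) :=
  A.filter (fun v => B.rank v = j)

variable {A : Finset (Fin n)} {B : Blocks n}

lemma pre_subset (i : ℕ) : pre A B i ⊆ A := Finset.filter_subset _ _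
lemma suf_subset (i : ℕ) : suf A B i ⊆ A := Finset.filter_subset _ _

lemma sdiff_pre (i : ℕ) : A \ pre A B i = suf A B i := by
  ext v; simp only [pre, suf, Finset.mem_sdiff, Finset.mem_filter, not_and, not_lt]; tauto

lemma pre_succ (i : ℕ) : pre A B (i + 1) = pre A B i ∪ blk A B i := by
  ext v; simp only [pre, blk, Finset.mem_union, Finset.mem_filter, Nat.lt_succ_iff_lt_or_eq]
  tauto

lemma suf_eq_union (i : ℕ) : suf A B i = blk A B i ∪ suf A B (i + 1) := by
  ext v; simp only [suf, blk, Finset.mem_union, Finset.mem_filter]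
  have : i ≤ B.rank v ↔ B.rank v = i ∨ i + 1 ≤ B.rank v := by omega
  rw [this]; tauto

lemma disjoint_pre_blk (i : ℕ) : Disjoint (pre A B i) (blk A B i) := by
  rw [Finset.disjoint_left]; intro v; simp only [pre, blk, Finset.mem_filter]
  rintro ⟨_, h⟩ ⟨_, h'⟩; omega

lemma disjoint_blk_suf (i : ℕ) : Disjoint (blk A B i) (suf A B (i + 1)) := by
  rw [Finset.disjoint_left]; intro v; simp only [suf, blk, Finset.mem_filter]
  rintro ⟨_, h⟩ ⟨_, h'⟩; omega

lemma disjoint_pre_suf {i j : ℕ} (hij : i ≤ j) : Disjoint (pre A B i) (suf A B j) := by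
  rw [Finset.disjoint_left]; intro v; simp only [suf, pre, Finset.mem_filter]
  rintro ⟨_, h⟩ ⟨_, h'⟩; omega

lemma pre_mono {i j : ℕ} (h : i ≤ j) : pre A B i ⊆ pre A B j := by
  intro v; simp only [pre, Finset.mem_filter]; rintro ⟨h1, h2⟩; exact ⟨h1, by omega⟩

@[simp] lemma pre_zero : pre A B 0 = ∅ := by simp [pre]

/-- When a block joins the prefix, its edges to later blocks enter the border and its edges to
earlier blocks leave it; edges inside the block never count. This is the quantity accumulated by
`addBlock`. -/
lemma bd_pre_succ (i : ℕ) : bd G A (pre A B (i + 1)) =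
    bd G A (pre A B i) + edges G (blk A B i) (suf A B (i + 1)) -
      edges G (blk A B i) (pre A B i) := by
  rw [bd, bd, sdiff_pre, sdiff_pre, pre_succ, edges_union_left G (disjoint_pre_blk i),
    suf_eq_union i, edges_union_right G (disjoint_blk_suf i), edges_comm G (blk A B i) (pre A B i)]
  ring

/-- Edges between the two ends are counted in both one-sided borders but do not belong to the border
of the union. -/
lemma bd_two_ended {i j : ℕ} (hij : i ≤ j) : bd G A (pre A B i ∪ suf A B j) =
    bd G A (pre A B i) + bd G A (pre A B j) - 2 * edges G (suf A B j) (pre A B i) := by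
  set M := A \ (pre A B i ∪ suf A B j)
  have e1 : A \ pre A B i = M ∪ suf A B j := by
    ext v
    simp only [M, pre, suf, Finset.mem_union, Finset.mem_filter, Finset.mem_sdiff]
    by_cases h1 : B.rank v < i <;> by_cases h2 : j ≤ B.rank v <;> simp [h1, h2]
    omega
  have e2 : A \ suf A B j = M ∪ pre A B i := by
    ext v
    simp only [M, pre, suf, Finset.mem_union, Finset.mem_filter, Finset.mem_sdiff]
    by_cases h1 : B.rank v < i <;> by_cases h2 : j ≤ B.rank v <;> simp [h1, h2]
    omega
  have d1 : Disjoint M (suf A B j) := by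
    rw [Finset.disjoint_left]; intro v hv hv'
    exact (Finset.mem_sdiff.1 hv).2 (Finset.mem_union_right _ hv')
  have d2 : Disjoint M (pre A B i) := by
    rw [Finset.disjoint_left]; intro v hv hv'
    exact (Finset.mem_sdiff.1 hv).2 (Finset.mem_union_left _ hv')
  have b1 : bd G A (pre A B i) = edges G (pre A B i) M + edges G (pre A B i) (suf A B j) := by
    rw [bd, e1, edges_union_right G d1]
  have b2 : bd G A (pre A B j) = edges G (suf A B j) M + edges G (suf A B j) (pre A B i) := by
    rw [← bd_sdiff G (pre_subset j), sdiff_pre, bd, e2, edges_union_right G d2]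
  rw [b1, b2, bd, edges_union_left G (disjoint_pre_suf hij),
    edges_comm G (suf A B j) (pre A B i)]
  ring

section Grouping

variable {u : Fin n → ℝ} (hB : IsGrouping u A B)
include hB

lemma block_toFinset (j : ℕ) : (B.block j).toFinset = blk A B j := by
  ext v; rw [List.mem_toFinset, hB.mem_block, blk, Finset.mem_filter]

lemma sum_block {M : Type*} [AddCommMonoid M] (j : ℕ) (f : Fin n → M) :
    ((B.block j).map f).sum = ∑ v ∈ blk A B j, f v := by
  rw [← block_toFinset hB, List.sum_toFinset _ (hB.nodup j)]

/-- The blocks are disjoint, so costs charged block by block add up to at most one charge per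
vertex. -/
lemma sum_blocks_le (f : Fin n → ℕ) :
    ((List.range B.num).map (fun j => ((B.block j).map f).sum)).sum ≤ ∑ v, f v := by
  have h1 : ((List.range B.num).map (fun j => ((B.block j).map f).sum)).sum =
      ∑ j ∈ Finset.range B.num, ∑ v ∈ blk A B j, f v := by
    rw [← List.toFinset_range, List.sum_toFinset _ List.nodup_range]
    simp only [sum_block hB]
  rw [h1]
  have h2 := Finset.sum_fiberwise_of_maps_to (s := A) (t := Finset.range B.num) (g := B.rank)
    (fun v hv => Finset.mem_range.2 (hB.rank_lt v hv)) f
  simp only [blk]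
  rw [h2]
  exact Finset.sum_le_sum_of_subset (Finset.subset_univ _)

lemma pre_num : pre A B B.num = A := by
  ext v; simp only [pre, Finset.mem_filter]
  exact ⟨fun h => h.1, fun h => ⟨h, hB.rank_lt v h⟩⟩

lemma suf_num : suf A B B.num = ∅ := by
  rw [← sdiff_pre, pre_num hB, Finset.sdiff_self]

end Grouping

/-- Volumes and borders of all prefixes, with the value `vol A + 1` past the end. -/
structure IsPrefixes (A : Finset (Fin n)) (B : Blocks n) (P : Prefixes) : Prop where
  pvol : ∀ i ≤ B.num, P.pvol i = vol G (pre A B i)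
  cut : ∀ i ≤ B.num, P.cut i = bd G A (pre A B i)
  pvol_past : ∀ i, B.num < i → P.pvol i = vol G A + 1

/-- The inner loop of the prefix computation. -/
def addBlock (A : Fin n → Bool) (B : Blocks n) (p : ℝ × ℝ) (l : List (Fin n)) : Timed (ℝ × ℝ) :=
  loop (fun (p : ℝ × ℝ) v => do
      let c ← loop (fun (c : ℝ) w =>
        pure (if A w then
            (if B.rank v < B.rank w then c + 1 else if B.rank w < B.rank v then c - 1 else c)
          else c)) p.2 (nbrs G v)
      pure (p.1 + (G.degree v : ℝ), c)) p l

lemma mkPrefixes_eq (A : Fin n → Bool) (volA : ℝ) (B : Blocks n) :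
    mkPrefixes G A volA B = (do
      tick (1 + n)
      loop (fun (s : Prefixes) i => do
        let p ← addBlock G A B (s.volume, s.bord) (B.block i)
        pure
          { volume := p.1
            bord := p.2
            pvol := Function.update s.pvol (i + 1) p.1
            cut := Function.update s.cut (i + 1) p.2 })
        { volume := 0
          bord := 0
          pvol := Function.update (fun _ => volA + 1) 0 0
          cut := fun _ => 0 } (List.range B.num)) := rfl

lemma addBlock_val (A : Fin n → Bool) (B : Blocks n) (p : ℝ × ℝ) (l : List (Fin n)) :
    (addBlock G A B p l).val = (p.1 + (l.map (fun v => (G.degree v : ℝ))).sum,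
      p.2 + (l.map (fun v => ∑ w, if G.Adj v w then
        (if A w = true then (if B.rank v < B.rank w then (1 : ℝ) else
          if B.rank w < B.rank v then -1 else 0) else 0) else 0)).sum) := by
  induction l generalizing p with
  | nil => simp [addBlock]
  | cons v l ih =>
    have h : ∀ (c : ℝ) (w : Fin n), (if A w = true then
            (if B.rank v < B.rank w then c + 1 else if B.rank w < B.rank v then c - 1 else c)
          else c) = c + (if A w = true then (if B.rank v < B.rank w then (1 : ℝ) else
          if B.rank w < B.rank v then -1 else 0) else 0) := by
      intro c w; split_ifs <;> ring
    rw [addBlock, loop_cons_val]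
    have h2 := ih (p.1 + (G.degree v : ℝ), p.2 + ∑ w, if G.Adj v w then
        (if A w = true then (if B.rank v < B.rank w then (1 : ℝ) else
          if B.rank w < B.rank v then -1 else 0) else 0) else 0)
    rw [addBlock] at h2
    simp only [val_bind, val_pure, loop_val, h, foldl_add, sum_nbrs] at h2 ⊢
    rw [h2]
    simp only [List.map_cons, List.sum_cons, add_assoc]

lemma addBlock_steps (A : Fin n → Bool) (B : Blocks n) (p : ℝ × ℝ) (l : List (Fin n)) :
    (addBlock G A B p l).steps ≤ (l.map (fun v => 1 + G.degree v)).sum := by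
  refine loop_steps_le _ (fun v => G.degree v) l ?_ p
  intro s v _
  have := loop_steps_le_const (fun (c : ℝ) w =>
        pure (if A w then
            (if B.rank v < B.rank w then c + 1 else if B.rank w < B.rank v then c - 1 else c)
          else c)) 0 (nbrs G v) (fun s a _ => by simp) s.2
  simpa [length_nbrs] using this

lemma isPrefixes_mkPrefixes {A : Fin n → Bool} {B : Blocks n} {u : Fin n → ℝ}
    (hB : IsGrouping u (supp A) B) :
    IsPrefixes G (supp A) B (mkPrefixes G A (vol G (supp A)) B).val := by
  rw [mkPrefixes_eq, val_bind]
  have key := loop_range_inv (fun (s : Prefixes) i => do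
        let p ← addBlock G A B (s.volume, s.bord) (B.block i)
        pure
          { volume := p.1
            bord := p.2
            pvol := Function.update s.pvol (i + 1) p.1
            cut := Function.update s.cut (i + 1) p.2 })
    (fun k s => (s.volume = vol G (pre (supp A) B k) ∧ s.bord = bd G (supp A) (pre (supp A) B k)) ∧
      (∀ i ≤ k, s.pvol i = vol G (pre (supp A) B i)) ∧
      (∀ i ≤ k, s.cut i = bd G (supp A) (pre (supp A) B i)) ∧
      ∀ i, k < i → s.pvol i = vol G (supp A) + 1) B.num ?_
    { volume := 0
      bord := 0
      pvol := Function.update (fun _ => (vol G (supp A) : ℝ) + 1) 0 0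
      cut := fun _ => 0 } ?_
  · exact ⟨key.2.1, key.2.2.1, key.2.2.2⟩
  · rintro k hk s ⟨⟨h1, h2⟩, h3, h4, h5⟩
    simp only [val_bind, val_pure, addBlock_val]
    have hv : s.volume + ((B.block k).map (fun v => (G.degree v : ℝ))).sum =
        vol G (pre (supp A) B (k + 1)) := by
      rw [sum_block hB, pre_succ, vol_union G (disjoint_pre_blk k), h1]
      push_cast
      rw [cast_vol G (blk _ _ _)]
    have hc : s.bord + ((B.block k).map (fun v => ∑ w, if G.Adj v w then
        (if A w = true then (if B.rank v < B.rank w then (1 : ℝ) else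
          if B.rank w < B.rank v then -1 else 0) else 0) else 0)).sum =
        bd G (supp A) (pre (supp A) B (k + 1)) := by
      rw [sum_block hB, bd_pre_succ, h2, add_sub_assoc, edges, edges, ← Finset.sum_sub_distrib]
      congr 1
      refine Finset.sum_congr rfl fun v hv => ?_
      simp only [blk, Finset.mem_filter] at hv
      rw [suf, pre, supp, Finset.sum_filter, Finset.sum_filter, Finset.sum_filter,
        Finset.sum_filter, ← Finset.sum_sub_distrib]
      refine Finset.sum_congr rfl fun w _ => ?_
      rw [hv.2]
      by_cases ha : G.Adj v w <;> by_cases hA : A w = true <;> by_cases h7 : k < B.rank w <;>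
        by_cases h8 : B.rank w < k <;> simp [ha, hA, h7, h8]; omega
    rw [hv, hc]
    refine ⟨⟨rfl, rfl⟩, ?_, ?_, ?_⟩
    · intro i hi
      by_cases h : i = k + 1
      · subst h; simp
      · rw [Function.update_of_ne h]; exact h3 i (by omega)
    · intro i hi
      by_cases h : i = k + 1
      · subst h; simp
      · rw [Function.update_of_ne h]; exact h4 i (by omega)
    · intro i hi
      rw [Function.update_of_ne (by omega)]; exact h5 i (by omega)
  · refine ⟨by simp [bd], ?_, ?_, ?_⟩
    · intro i hi
      obtain rfl : i = 0 := by omega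
      simp
    · intro i hi
      obtain rfl : i = 0 := by omega
      simp [bd]
    · intro i hi
      dsimp only; rw [Function.update_of_ne (by omega)]

lemma mkPrefixes_steps {A : Fin n → Bool} {A' : Finset (Fin n)} {B : Blocks n} {u : Fin n → ℝ}
    (hB : IsGrouping u A' B) (volA : ℝ) :
    (mkPrefixes G A volA B).steps ≤ 1 + 3 * n + 2 * numEdges G := by
  rw [mkPrefixes_eq, steps_bind, steps_tick]
  have h1 := loop_steps_le (fun (s : Prefixes) i => do
        let p ← addBlock G A B (s.volume, s.bord) (B.block i)
        pure
          { volume := p.1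
            bord := p.2
            pvol := Function.update s.pvol (i + 1) p.1
            cut := Function.update s.cut (i + 1) p.2 })
    (fun i => ((B.block i).map (fun v => 1 + G.degree v)).sum) (List.range B.num)
    (fun s i _ => addBlock_steps G A B (s.volume, s.bord) (B.block i))
    { volume := 0
      bord := 0
      pvol := Function.update (fun _ => volA + 1) 0 0
      cut := fun _ => 0 }
  rw [List.sum_map_add] at h1
  have h2 := sum_blocks_le hB (fun v => 1 + G.degree v)
  rw [Finset.sum_add_distrib, G.sum_degrees_eq_twice_card_edges] at h2
  have h3 := hB.num_le
  have h4 := Finset.card_le_univ A'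
  simp only [Finset.sum_const, Finset.card_univ, Fintype.card_fin, smul_eq_mul, mul_one,
    List.map_const', List.length_range, List.sum_replicate] at h1 h2 h4
  have : numEdges G = G.edgeFinset.card := rfl
  omega

end Sweep

/-! ### The sweep cut -/

section SweepCut

variable {n : ℕ} (G : SimpleGraph (Fin n)) [DecidableRel G.Adj]

/-- A set of vertices of `A` that is closed under smaller values of `u`. -/
def IsLower (u : Fin n → ℝ) (A P : Finset (Fin n)) : Prop :=
  P ⊆ A ∧ ∀ v ∈ P, ∀ w ∈ A, u w ≤ u v → w ∈ P

/-- A set of vertices of `A` that is closed under larger values of `u`. -/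
def IsUpper (u : Fin n → ℝ) (A P : Finset (Fin n)) : Prop :=
  P ⊆ A ∧ ∀ v ∈ P, ∀ w ∈ A, u v ≤ u w → w ∈ P

/-- A two-ended sweep cut. -/
def IsTwoEnded (u : Fin n → ℝ) (A Q : Finset (Fin n)) : Prop :=
  ∃ L U, IsLower u A L ∧ IsUpper u A U ∧ Q = L ∪ U

/-- What the sweep cut procedure promises. -/
def SweepSpec (A : Finset (Fin n)) (u : Fin n → ℝ) (γ τ : ℝ) :
    Option ((Fin n → Bool) × ℝ) → Prop
  | none => ∀ P, IsLower u A P ∨ IsUpper u A P → 2 * vol G P ≤ vol G A → γ * vol G P ≤ bd G A P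
  | some (S, x) => supp S ⊆ A ∧ x = vol G (supp S) ∧ 2 * vol G (supp S) ≤ vol G A ∧
      bd G A (supp S) < γ * vol G (supp S) ∧
      (x < τ → IsTwoEnded u A (supp S) ∧ ∀ Q, IsTwoEnded u A Q → 2 * vol G Q ≤ vol G A →
        bd G A Q < γ * vol G Q → vol G Q ≤ vol G (supp S))

variable {A : Finset (Fin n)} {B : Blocks n} {u : Fin n → ℝ}

lemma isLower_pre (hB : IsGrouping u A B) (i : ℕ) : IsLower u A (pre A B i) := by
  refine ⟨pre_subset i, fun v hv w hw hwv => ?_⟩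
  simp only [pre, Finset.mem_filter] at hv ⊢
  have := (hB.le_iff w hw v hv.1).1 hwv
  exact ⟨hw, by omega⟩

lemma isUpper_suf (hB : IsGrouping u A B) (i : ℕ) : IsUpper u A (suf A B i) := by
  refine ⟨suf_subset i, fun v hv w hw hwv => ?_⟩
  simp only [suf, Finset.mem_filter] at hv ⊢
  have := (hB.le_iff v hv.1 w hw).1 hwv
  exact ⟨hw, by omega⟩

lemma IsLower.exists_pre (hB : IsGrouping u A B) {P : Finset (Fin n)} (hP : IsLower u A P) :
    ∃ i ≤ B.num, P = pre A B i := by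
  -- The prefix ends just after the highest rank that occurs; for the empty set the supremum is 0.
  refine ⟨P.sup (fun v => B.rank v + 1), Finset.sup_le fun v hv => hB.rank_lt v (hP.1 hv), ?_⟩
  ext v
  simp only [pre, Finset.mem_filter, Finset.lt_sup_iff]
  constructor
  · exact fun hv => ⟨hP.1 hv, v, hv, Nat.lt_succ_self _⟩
  · rintro ⟨hv, w, hw, h⟩
    exact hP.2 w hw v hv ((hB.le_iff v hv w (hP.1 hw)).2 (by omega))

lemma IsUpper.sdiff {P : Finset (Fin n)} (hP : IsUpper u A P) : IsLower u A (A \ P) := by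
  refine ⟨Finset.sdiff_subset, fun v hv w hw hwv => ?_⟩
  rw [Finset.mem_sdiff] at hv ⊢
  exact ⟨hw, fun h => hv.2 (hP.2 w h v hv.1 hwv)⟩

lemma IsUpper.exists_suf (hB : IsGrouping u A B) {P : Finset (Fin n)} (hP : IsUpper u A P) :
    ∃ i ≤ B.num, P = suf A B i := by
  obtain ⟨i, hi, h⟩ := hP.sdiff.exists_pre hB
  exact ⟨i, hi, by rw [← sdiff_pre, ← h, Finset.sdiff_sdiff_eq_self hP.1]⟩

lemma isLower_sub_const (c : ℝ) {P : Finset (Fin n)} :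
    IsLower (fun v => u v - c) A P ↔ IsLower u A P := by
  simp [IsLower]

lemma isUpper_sub_const (c : ℝ) {P : Finset (Fin n)} :
    IsUpper (fun v => u v - c) A P ↔ IsUpper u A P := by
  simp [IsUpper]

lemma sweepSpec_sub_const (c γ τ : ℝ) (o : Option ((Fin n → Bool) × ℝ)) :
    SweepSpec G A (fun v => u v - c) γ τ o ↔ SweepSpec G A u γ τ o := by
  rcases o with _ | ⟨S, x⟩ <;>
    simp only [SweepSpec, IsTwoEnded, isLower_sub_const, isUpper_sub_const]

/-! #### One-sided cuts -/

/-- The last prefix is all of `A` and is left out because its other side is empty. That no balanced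
cut was overlooked need not be recorded: the two-ended search is maximal on its own. -/
lemma oneSided_spec (γ τ volA : ℝ) (B : Blocks n) (P : Prefixes) :
    ((oneSided γ τ volA B P).val.1 = false → ∀ i < B.num - 1,
      ¬ P.cut (i + 1) < γ * min (P.pvol (i + 1)) (volA - P.pvol (i + 1))) ∧
    ((oneSided γ τ volA B P).val.1 = true → ∃ i < B.num - 1,
      P.cut (i + 1) < γ * min (P.pvol (i + 1)) (volA - P.pvol (i + 1))) ∧
    (∀ i, (oneSided γ τ volA B P).val.2 = some i → 1 ≤ i ∧ i ≤ B.num - 1 ∧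
      P.cut i < γ * min (P.pvol i) (volA - P.pvol i) ∧
      τ ≤ min (P.pvol i) (volA - P.pvol i)) := by
  have key := loop_range_inv (fun (s : Bool × Option ℕ) i =>
    let x := min (P.pvol (i + 1)) (volA - P.pvol (i + 1))
    pure (if P.cut (i + 1) < γ * x then
        (true, if s.2 = none ∧ τ ≤ x then some (i + 1) else s.2)
      else s))
    (fun k s => (s.1 = false → ∀ i < k,
      ¬ P.cut (i + 1) < γ * min (P.pvol (i + 1)) (volA - P.pvol (i + 1))) ∧
    (s.1 = true → ∃ i < k,
      P.cut (i + 1) < γ * min (P.pvol (i + 1)) (volA - P.pvol (i + 1))) ∧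
    (∀ i, s.2 = some i → 1 ≤ i ∧ i ≤ k ∧
      P.cut i < γ * min (P.pvol i) (volA - P.pvol i) ∧
      τ ≤ min (P.pvol i) (volA - P.pvol i))) (B.num - 1) ?_ (false, none) ?_
  · exact key
  · rintro k hk s ⟨h1, h2, h3⟩
    simp only [val_pure]
    split_ifs with hc hc2
    · refine ⟨by simp, fun _ => ⟨k, by omega, hc⟩, fun i hi => ?_⟩
      obtain rfl : k + 1 = i := by simpa using hi
      exact ⟨by omega, le_rfl, hc, hc2.2⟩
    · refine ⟨by simp, fun _ => ⟨k, by omega, hc⟩, fun i hi => ?_⟩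
      have := h3 i hi
      exact ⟨this.1, by omega, this.2.2⟩
    · refine ⟨fun h i hi => ?_, fun h => ?_, fun i hi => ?_⟩
      · rcases Nat.lt_succ_iff_lt_or_eq.1 hi with hi | rfl
        · exact h1 h i hi
        · exact hc
      · obtain ⟨i, hi, h4⟩ := h2 h
        exact ⟨i, by omega, h4⟩
      · have := h3 i hi
        exact ⟨this.1, by omega, this.2.2⟩
  · simp

lemma oneSided_steps (γ τ volA : ℝ) (B : Blocks n) (P : Prefixes) :
    (oneSided γ τ volA B P).steps ≤ B.num := by
  have := loop_steps_le_const (fun (s : Bool × Option ℕ) i =>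
    let x := min (P.pvol (i + 1)) (volA - P.pvol (i + 1))
    pure (if P.cut (i + 1) < γ * x then
        (true, if s.2 = none ∧ τ ≤ x then some (i + 1) else s.2)
      else s)) 0 (List.range (B.num - 1)) (fun s a _ => by simp) (false, none)
  have h : (oneSided γ τ volA B P).steps ≤ (List.range (B.num - 1)).length * (1 + 0) := this
  simp at h
  omega

/-! #### Two-ended cuts -/

/-- The update of the tree when the vertices in `l` join the right end. -/
def addEdges (A : Fin n → Bool) (B : Blocks n) (j : ℕ) (t : SegTree) (l : List (Fin n)) :
    Timed SegTree :=
  loop (fun (t : SegTree) v =>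
      loop (fun (t : SegTree) w =>
        if A w ∧ B.rank w < j then t.addFrom (B.rank w + 1) 2 else pure t) t (nbrs G v)) t l

/-- One round of the search for the best two-ended cut. -/
def twoRound (A : Fin n → Bool) (γ volA : ℝ) (B : Blocks n) (P : Prefixes)
    (s : SegTree × Option (ℕ × ℕ × ℝ)) (j : ℕ) : Timed (SegTree × Option (ℕ × ℕ × ℝ)) := do
  let o ← s.1.findLast (P.pvol (j + 1) - volA / 2)
    (P.cut (j + 1) - γ * (volA - P.pvol (j + 1)))
  let best : Option (ℕ × ℕ × ℝ) :=
    match o, s.2 with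
    | none, b => b
    | some (i, x), none => some (i, j + 1, x + (volA - P.pvol (j + 1)))
    | some (i, x), some b =>
      if b.2.2 < x + (volA - P.pvol (j + 1)) then
        some (i, j + 1, x + (volA - P.pvol (j + 1)))
      else some b
  let tree' ← addEdges G A B j s.1 (B.block j)
  pure (tree', best)

lemma twoSided_eq (A : Fin n → Bool) (γ volA : ℝ) (B : Blocks n) (P : Prefixes) :
    twoSided G A γ volA B P = (do
      tick (1 + B.num)
      let tree ← SegTree.build P.pvol (fun i => γ * P.pvol i - P.cut i)
        (Nat.clog 2 (B.num + 1)) 0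
      let res ← loop (twoRound G A γ volA B P) (tree, none) (List.range B.num).reverse
      pure res.2) := rfl

-- An edge from the right end to `w` with rank below `j` joins the two ends exactly for the prefixes
-- that contain `w`, that is, for the leaves from index `B.rank w + 1` on.
open SegTree in
lemma addEdges_spec {vol : ℕ → ℝ} {h : ℕ} (A : Fin n → Bool) (B : Blocks n) (j : ℕ)
    (l : List (Fin n)) (t : SegTree) (f : ℕ → ℝ) (ht : Rep vol h 0 f t) :
    Rep vol h 0 (fun i => f i + (l.map (fun v => ∑ w, if G.Adj v w then
      (if A w = true ∧ B.rank w < j ∧ B.rank w < i then (2 : ℝ) else 0) else 0)).sum)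
      (addEdges G A B j t l).val ∧
    (addEdges G A B j t l).steps ≤ (l.map (fun v => 1 + G.degree v * (h + 2))).sum := by
  have inner : ∀ (l : List (Fin n)) (t : SegTree) (f : ℕ → ℝ), Rep vol h 0 f t →
      Rep vol h 0 (fun i => f i + (l.map (fun w =>
        if A w = true ∧ B.rank w < j ∧ B.rank w < i then (2 : ℝ) else 0)).sum)
        (loop (fun (t : SegTree) w =>
          if A w ∧ B.rank w < j then t.addFrom (B.rank w + 1) 2 else pure t) t l).val ∧
      (loop (fun (t : SegTree) w =>
          if A w ∧ B.rank w < j then t.addFrom (B.rank w + 1) 2 else pure t) t l).steps ≤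
        l.length * (h + 2) := by
    intro l
    induction l with
    | nil => intro t f ht; simpa using ht
    | cons w l ih =>
      intro t f ht
      rw [loop_cons_val, loop_cons_steps]
      by_cases hc : A w = true ∧ B.rank w < j
      · rw [if_pos hc]
        obtain ⟨h1, h2⟩ := ht.addFrom (B.rank w + 1) 2
        obtain ⟨h3, h4⟩ := ih _ _ h1
        refine ⟨h3.congr fun i _ _ => ?_, ?_⟩
        · simp only [List.map_cons, List.sum_cons, hc, true_and, Nat.succ_le_iff]
          ring
        · rw [List.length_cons]
          have : (l.length + 1) * (h + 2) = l.length * (h + 2) + (h + 2) := by ring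
          omega
      · rw [if_neg hc]
        obtain ⟨h3, h4⟩ := ih _ _ ht
        refine ⟨h3.congr fun i _ _ => ?_, ?_⟩
        · have : ¬ (A w = true ∧ B.rank w < j ∧ B.rank w < i) := fun h => hc ⟨h.1, h.2.1⟩
          simp only [List.map_cons, List.sum_cons, this, if_false, zero_add]
        · rw [List.length_cons]
          have : (l.length + 1) * (h + 2) = l.length * (h + 2) + (h + 2) := by ring
          simp only [steps_pure, val_pure]
          omega
  induction l generalizing t f with
  | nil => simpa [addEdges] using ht
  | cons v l ih =>
    rw [addEdges, loop_cons_val, loop_cons_steps]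
    obtain ⟨h1, h2⟩ := inner (nbrs G v) t f ht
    obtain ⟨h3, h4⟩ := ih _ _ h1
    rw [addEdges] at h3 h4
    refine ⟨h3.congr fun i _ _ => ?_, ?_⟩
    · simp only [sum_nbrs, List.map_cons, List.sum_cons]
      ring
    · rw [length_nbrs] at h2
      rw [List.map_cons, List.sum_cons]
      omega

/-- The pair `(i, j)` describes a two-ended cut of conductance below `γ`. -/
def ValidPair (A : Finset (Fin n)) (B : Blocks n) (γ : ℝ) (i j : ℕ) : Prop :=
  i < j ∧ j ≤ B.num ∧ 2 * vol G (pre A B i ∪ suf A B j) ≤ vol G A ∧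
    bd G A (pre A B i ∪ suf A B j) < γ * vol G (pre A B i ∪ suf A B j)

/-- The best pair `(i, j)` with `k < j`, together with the volume of its cut. -/
def BestPair (A : Finset (Fin n)) (B : Blocks n) (γ : ℝ) (k : ℕ) :
    Option (ℕ × ℕ × ℝ) → Prop
  | none => ∀ i j, k < j → ¬ ValidPair G A B γ i j
  | some (i, j, x) => ValidPair G A B γ i j ∧ x = vol G (pre A B i ∪ suf A B j) ∧
      ∀ i' j', k < j' → ValidPair G A B γ i' j' →
        vol G (pre A B i' ∪ suf A B j') ≤ vol G (pre A B i ∪ suf A B j)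

variable {G}

/-- The tree may have leaves past index `num`; the artificial value `vol A + 1` there keeps the
array increasing. -/
lemma IsPrefixes.monotone {P : Prefixes} (hP : IsPrefixes G A B P) : Monotone P.pvol := by
  intro i j hij
  by_cases hj : j ≤ B.num
  · rw [hP.pvol j hj, hP.pvol i (hij.trans hj)]
    exact_mod_cast vol_mono G (pre_mono hij)
  · rw [hP.pvol_past j (by omega)]
    by_cases hi : i ≤ B.num
    · rw [hP.pvol i hi]
      have := vol_mono G (pre_subset (A := A) (B := B) i)
      have : (vol G (pre A B i) : ℝ) ≤ vol G A := by exact_mod_cast this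
      linarith
    · rw [hP.pvol_past i (by omega)]

lemma vol_two_ended {i j : ℕ} (hij : i ≤ j) :
    (vol G (pre A B i ∪ suf A B j) : ℝ) = vol G (pre A B i) + (vol G A - vol G (pre A B j)) := by
  have h := vol_sdiff G (pre_subset (A := A) (B := B) j)
  rw [sdiff_pre] at h
  rw [vol_union G (disjoint_pre_suf hij), ← h]
  push_cast
  ring

variable (G)

/-- The values in the tree before round `j - 1`. -/
def TreeInv (A : Finset (Fin n)) (B : Blocks n) (P : Prefixes) (γ : ℝ) (j : ℕ) (t : SegTree) :
    Prop :=
  ∃ f, SegTree.Rep P.pvol (Nat.clog 2 (B.num + 1)) 0 f t ∧ ∀ i ≤ j,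
    f i = γ * P.pvol i - P.cut i + 2 * edges G (suf A B j) (pre A B i)

lemma twoRound_tree {A : Fin n → Bool} {u : Fin n → ℝ} {γ volA : ℝ} {B : Blocks n} {P : Prefixes}
    (hB : IsGrouping u (supp A) B) {j : ℕ}
    {s : SegTree × Option (ℕ × ℕ × ℝ)} (hs : TreeInv G (supp A) B P γ (j + 1) s.1) :
    TreeInv G (supp A) B P γ j (twoRound G A γ volA B P s j).val.1 := by
  obtain ⟨f, hf, hfi⟩ := hs
  refine ⟨_, (addEdges_spec G A B j (B.block j) s.1 f hf).1, fun i hi => ?_⟩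
  have h : ((B.block j).map (fun v => ∑ w, if G.Adj v w then
      (if A w = true ∧ B.rank w < j ∧ B.rank w < i then (2 : ℝ) else 0) else 0)).sum =
      2 * edges G (blk (supp A) B j) (pre (supp A) B i) := by
    rw [sum_block hB, edges, Finset.mul_sum]
    refine Finset.sum_congr rfl fun v _ => ?_
    rw [pre, supp, Finset.sum_filter, Finset.sum_filter, Finset.mul_sum]
    refine Finset.sum_congr rfl fun w _ => ?_
    by_cases h1 : G.Adj v w <;> by_cases h2 : A w = true <;> by_cases h3 : B.rank w < i <;>
      simp [h1, h2, h3]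
    omega
  rw [h, hfi i (by omega), suf_eq_union j, edges_union_left G (disjoint_blk_suf j)]
  ring

/-- For fixed `j`, collecting the terms in `i` turns the volume condition into an upper bound on
`P.pvol i` and the sparsity condition into a lower bound on the leaf value. As `vol A` is positive,
the volume bound already forces `i < j`, the range in which the leaf values are known. -/
lemma find_iff {A : Finset (Fin n)} {B : Blocks n} {P : Prefixes} (hP : IsPrefixes G A B P)
    (hA : 0 < vol G A) {γ : ℝ} {j : ℕ} (hj : j ≤ B.num) {f : ℕ → ℝ}
    (hfi : ∀ i ≤ j, f i = γ * P.pvol i - P.cut i + 2 * edges G (suf A B j) (pre A B i)) (i : ℕ) :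
    (P.pvol i ≤ P.pvol j - vol G A / 2 ∧ P.cut j - γ * (vol G A - P.pvol j) < f i) ↔
      ValidPair G A B γ i j := by
  have hA' : (0 : ℝ) < vol G A := by exact_mod_cast hA
  constructor
  · rintro ⟨h1, h2⟩
    have hij : i < j := by
      by_contra hc
      have := hP.monotone (not_lt.1 hc)
      linarith
    rw [hfi i hij.le, hP.cut i (by omega), hP.cut j hj, hP.pvol i (by omega), hP.pvol j hj] at h2
    rw [hP.pvol i (by omega), hP.pvol j hj] at h1
    have hv := vol_two_ended (G := G) (A := A) (B := B) hij.le
    have hb := bd_two_ended G (A := A) (B := B) hij.le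
    refine ⟨hij, hj, ?_, ?_⟩
    · have : (2 : ℝ) * vol G (pre A B i ∪ suf A B j) ≤ vol G A := by rw [hv]; linarith
      exact_mod_cast this
    · rw [hb, hv]; linarith
  · rintro ⟨hij, -, h1, h2⟩
    have hv := vol_two_ended (G := G) (A := A) (B := B) hij.le
    have hb := bd_two_ended G (A := A) (B := B) hij.le
    rw [hfi i hij.le, hP.cut i (by omega), hP.cut j hj, hP.pvol i (by omega), hP.pvol j hj]
    have h3 : (2 : ℝ) * vol G (pre A B i ∪ suf A B j) ≤ vol G A := by exact_mod_cast h1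
    rw [hv] at h3
    rw [hb, hv] at h2
    constructor <;> linarith

/-- For fixed `j` the volume of the two-ended cut grows with `i`, so the last admissible leaf is the
best one. -/
lemma twoRound_best {A : Fin n → Bool} {γ : ℝ} {B : Blocks n} {P : Prefixes}
    (hP : IsPrefixes G (supp A) B P) (hA : 0 < vol G (supp A)) {j : ℕ} (hj : j < B.num)
    {s : SegTree × Option (ℕ × ℕ × ℝ)} (hs : TreeInv G (supp A) B P γ (j + 1) s.1)
    (hb : BestPair G (supp A) B γ (j + 1) s.2) :
    BestPair G (supp A) B γ j (twoRound G A γ (vol G (supp A)) B P s j).val.2 := by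
  obtain ⟨f, hf, hfi⟩ := hs
  have hfind := (hf.findLast hP.monotone (P.pvol (j + 1) - vol G (supp A) / 2)
    (P.cut (j + 1) - γ * (vol G (supp A) - P.pvol (j + 1)))).1
  have hiff := find_iff G hP hA (Nat.succ_le_of_lt hj) hfi
  have hlen : ∀ i, i < j + 1 → i < 0 + 2 ^ Nat.clog 2 (B.num + 1) := fun i hi => by
    have := Nat.le_pow_clog (b := 2) (by norm_num) (B.num + 1)
    omega
  simp only [twoRound, val_bind, val_pure]
  set o := (s.1.findLast (P.pvol (j + 1) - vol G (supp A) / 2)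
    (P.cut (j + 1) - γ * (vol G (supp A) - P.pvol (j + 1)))).val with ho
  rcases o with _ | ⟨i, x⟩
  · have hno : ∀ i, ¬ ValidPair G (supp A) B γ i (j + 1) := by
      intro i hi
      have h1 := (hiff i).2 hi
      exact absurd (hfind i (Nat.zero_le _) (hlen i hi.1) h1.1) (not_le.2 h1.2)
    rcases hs2 : s.2 with _ | ⟨i', j', x'⟩
    · rw [hs2] at hb
      intro i j' hj'
      rcases Nat.lt_or_ge (j + 1) j' with h | h
      · exact hb i j' h
      · obtain rfl : j' = j + 1 := by omega
        exact hno i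
    · rw [hs2] at hb
      refine ⟨hb.1, hb.2.1, fun i₂ j₂ hj₂ hv => ?_⟩
      rcases Nat.lt_or_ge (j + 1) j₂ with h | h
      · exact hb.2.2 i₂ j₂ h hv
      · obtain rfl : j₂ = j + 1 := by omega
        exact absurd hv (hno i₂)
  · obtain ⟨-, h1, h2, h3, h4, h5⟩ := hfind
    have hval := (hiff i).1 ⟨h3, h4⟩
    have hx : x + (vol G (supp A) - P.pvol (j + 1)) =
        vol G (pre (supp A) B i ∪ suf (supp A) B (j + 1)) := by
      rw [h2, hP.pvol i (by have := hval.1; omega), hP.pvol _ hj, vol_two_ended hval.1.le]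
    have hmax : ∀ i', ValidPair G (supp A) B γ i' (j + 1) →
        vol G (pre (supp A) B i' ∪ suf (supp A) B (j + 1)) ≤
          vol G (pre (supp A) B i ∪ suf (supp A) B (j + 1)) := by
      intro i' hi'
      by_cases hc : i < i'
      · have h6 := (hiff i').2 hi'
        exact absurd (h5 i' hc (hlen i' hi'.1) h6.1) (not_le.2 h6.2)
      · exact vol_mono G (Finset.union_subset_union (pre_mono (not_lt.1 hc)) subset_rfl)
    rcases hs2 : s.2 with _ | ⟨i', j', x'⟩
    · rw [hs2] at hb
      refine ⟨hval, hx, fun i₂ j₂ hj₂ hv => ?_⟩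
      rcases Nat.lt_or_ge (j + 1) j₂ with h | h
      · exact absurd hv (hb i₂ j₂ h)
      · obtain rfl : j₂ = j + 1 := by omega
        exact hmax i₂ hv
    · rw [hs2] at hb
      obtain ⟨b1, b2, b3⟩ := hb
      simp only
      split_ifs with hc
      · refine ⟨hval, hx, fun i₂ j₂ hj₂ hv => ?_⟩
        rcases Nat.lt_or_ge (j + 1) j₂ with h | h
        · rw [hx, b2] at hc
          exact (b3 i₂ j₂ h hv).trans (by exact_mod_cast hc.le)
        · obtain rfl : j₂ = j + 1 := by omega
          exact hmax i₂ hv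
      · refine ⟨b1, b2, fun i₂ j₂ hj₂ hv => ?_⟩
        rcases Nat.lt_or_ge (j + 1) j₂ with h | h
        · exact b3 i₂ j₂ h hv
        · obtain rfl : j₂ = j + 1 := by omega
          rw [hx, b2, not_lt] at hc
          exact (hmax i₂ hv).trans (by exact_mod_cast hc)

lemma treeInv_build {B : Blocks n} {P : Prefixes} {u : Fin n → ℝ} {A : Finset (Fin n)} (γ : ℝ)
    (hB : IsGrouping u A B) : TreeInv G A B P γ B.num (SegTree.build P.pvol
      (fun i => γ * P.pvol i - P.cut i) (Nat.clog 2 (B.num + 1)) 0).val := by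
  refine ⟨_, SegTree.rep_build _ _ _ _, fun i hi => ?_⟩
  rw [suf_num hB]
  simp

lemma twoSided_spec {A : Fin n → Bool} {u : Fin n → ℝ} {γ : ℝ} {B : Blocks n} {P : Prefixes}
    (hB : IsGrouping u (supp A) B) (hP : IsPrefixes G (supp A) B P) (hA : 0 < vol G (supp A)) :
    BestPair G (supp A) B γ 0 (twoSided G A γ (vol G (supp A)) B P).val := by
  rw [twoSided_eq]
  simp only [val_bind, val_pure]
  refine (loop_range_reverse_inv (twoRound G A γ (vol G (supp A)) B P)
    (fun k s => TreeInv G (supp A) B P γ k s.1 ∧ BestPair G (supp A) B γ k s.2) B.num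
    (fun j hj s hs => ⟨twoRound_tree G hB hs.1, twoRound_best G hP hA hj hs.1 hs.2⟩) _ ⟨?_, ?_⟩).2
  · exact treeInv_build G γ hB
  · intro i j hj hv
    have := hv.2.1
    omega

lemma twoSided_steps {A : Fin n → Bool} {u : Fin n → ℝ} {γ volA : ℝ} {B : Blocks n} {P : Prefixes}
    (hB : IsGrouping u (supp A) B) (hP : IsPrefixes G (supp A) B P) :
    (twoSided G A γ volA B P).steps ≤ 1 + 2 * 2 ^ (Nat.clog 2 (B.num + 1)) +
      n * (4 * Nat.clog 2 (B.num + 1) + 4) +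
      2 * numEdges G * (Nat.clog 2 (B.num + 1) + 2) := by
  rw [twoSided_eq]
  simp only [steps_bind, steps_pure, steps_tick]
  have h1 := SegTree.build_steps P.pvol (fun i => γ * P.pvol i - P.cut i)
    (Nat.clog 2 (B.num + 1)) 0
  set h := Nat.clog 2 (B.num + 1) with hh
  have h2 := loop_steps_le_of_inv (twoRound G A γ volA B P)
    (fun s => ∃ f, SegTree.Rep P.pvol h 0 f s.1)
    (fun j => (4 * h + 1) + ((B.block j).map (fun v => 1 + G.degree v * (h + 2))).sum) (List.range B.num).reverse ?_
    ((SegTree.build P.pvol (fun i => γ * P.pvol i - P.cut i) h 0).val, none)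
    ⟨_, SegTree.rep_build _ _ _ _⟩
  · rw [List.map_reverse, List.sum_reverse, List.sum_map_add, List.sum_map_add] at h2
    have h3 := sum_blocks_le hB (fun v => 1 + G.degree v * (h + 2))
    rw [Finset.sum_add_distrib, ← Finset.sum_mul, G.sum_degrees_eq_twice_card_edges] at h3
    have h4 := hB.num_le
    have h5 := Finset.card_le_univ (supp A)
    simp only [Finset.sum_const, Finset.card_univ, Fintype.card_fin, smul_eq_mul, mul_one,
      List.map_const', List.length_range, List.sum_replicate] at h2 h3 h5
    have h6 : numEdges G = G.edgeFinset.card := rfl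
    rw [h6]
    have h7 : B.num * (4 * h + 1) ≤ n * (4 * h + 1) := Nat.mul_le_mul_right _ (h4.trans h5)
    have h8 : n * (4 * h + 4) = n * (4 * h + 1) + 3 * n := by ring
    omega
  · rintro s ⟨f, hf⟩ j -
    have h3 := addEdges_spec G A B j (B.block j) s.1 f hf
    have h4 := (hf.findLast hP.monotone (P.pvol (j + 1) - volA / 2)
      (P.cut (j + 1) - γ * (volA - P.pvol (j + 1)))).2.1
    refine ⟨⟨_, h3.1⟩, ?_⟩
    simp only [twoRound, steps_bind, steps_pure]
    have := h3.2
    omega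

end SweepCut

/-! ### Correctness and cost of the whole sweep cut -/

section SweepCut

variable {n : ℕ} (G : SimpleGraph (Fin n)) [DecidableRel G.Adj]

/-- The part of the sweep cut procedure after the grouping. -/
def sweepRest (A : Fin n → Bool) (γ τ volA : ℝ) (B : Blocks n) :
    Timed (Option ((Fin n → Bool) × ℝ)) := do
  let P ← mkPrefixes G A volA B
  let one ← oneSided γ τ volA B P
  match one with
  | (_, some i) =>
    if P.pvol i ≤ volA - P.pvol i then do
      let S ← tabulate (fun v => A v && decide (B.rank v < i))
      pure (some (S, P.pvol i))
    else do
      let S ← tabulate (fun v => A v && decide (i ≤ B.rank v))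
      pure (some (S, volA - P.pvol i))
  | (false, none) => pure none
  | (true, none) => do
    let two ← twoSided G A γ volA B P
    match two with
    | some (i, j, x) => do
      let S ← tabulate (fun v => A v && (decide (B.rank v < i) || decide (j ≤ B.rank v)))
      pure (some (S, x))
    | none => pure none

lemma sweepCut_eq (A : Fin n → Bool) (γ τ : ℝ) (u : Fin n → ℝ) :
    sweepCut G A γ τ u = (do
      let volA ← volOf G A
      let u ← center G A volA u
      let B ← mkBlocks A u
      sweepRest G A γ τ volA B) := rfl

/-- Only comparisons between values of the vector at vertices influence the result. Hence a random
vector matters only through one of finitely many orders. -/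
lemma sweepCut_congr {u u' : Fin n → ℝ} (h : SameOrder u u') (A : Fin n → Bool) (γ τ : ℝ) :
    (sweepCut G A γ τ u).val = (sweepCut G A γ τ u').val := by
  simp only [sweepCut_eq, val_bind]
  obtain ⟨c, hc⟩ := center_val G A (volOf G A).val u
  obtain ⟨c', hc'⟩ := center_val G A (volOf G A).val u'
  rw [hc, hc']
  obtain ⟨h1, h2, h3⟩ := mkBlocks_congr (h.sub_const c c') A
  generalize (mkBlocks A fun v => u v - c).val = B at *
  generalize (mkBlocks A fun v => u' v - c').val = B' at *
  obtain ⟨b1, b2, b3, b4⟩ := B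
  obtain ⟨b1', b2', b3', b4'⟩ := B'
  dsimp only at h1 h2 h3
  subst h1 h2 h3
  rfl

lemma supp_pre (A : Fin n → Bool) (B : Blocks n) (i : ℕ) :
    supp (fun v => A v && decide (B.rank v < i)) = pre (supp A) B i := by
  ext v; simp [pre]

lemma supp_suf (A : Fin n → Bool) (B : Blocks n) (i : ℕ) :
    supp (fun v => A v && decide (i ≤ B.rank v)) = suf (supp A) B i := by
  ext v; simp [suf]

lemma supp_two_ended (A : Fin n → Bool) (B : Blocks n) (i j : ℕ) :
    supp (fun v => A v && (decide (B.rank v < i) || decide (j ≤ B.rank v))) =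
      pre (supp A) B i ∪ suf (supp A) B j := by
  ext v; simp [pre, suf]; tauto

lemma sweepRest_spec {A : Fin n → Bool} {u : Fin n → ℝ} {B : Blocks n}
    (hB : IsGrouping u (supp A) B) (hA : 0 < vol G (supp A)) (γ τ : ℝ) :
    SweepSpec G (supp A) u γ τ (sweepRest G A γ τ (vol G (supp A)) B).val := by
  have hP := isPrefixes_mkPrefixes G hB
  simp only [sweepRest, val_bind]
  set P := (mkPrefixes G A (vol G (supp A)) B).val
  obtain ⟨o1, o2, o3⟩ := oneSided_spec γ τ (vol G (supp A)) B P
  have hcompl : ∀ i, (vol G (suf (supp A) B i) : ℝ) = vol G (supp A) - vol G (pre (supp A) B i) := by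
    intro i
    have h := vol_sdiff G (pre_subset (A := supp A) (B := B) i)
    rw [sdiff_pre] at h
    rw [← h]; push_cast; ring
  have hbd : ∀ i, bd G (supp A) (suf (supp A) B i) = bd G (supp A) (pre (supp A) B i) := by
    intro i
    rw [← sdiff_pre, bd_sdiff G (pre_subset i)]
  rcases hone : (oneSided γ τ (vol G (supp A)) B P).val with ⟨b, _ | i⟩
  · rw [hone] at o1 o2
    rcases b with _ | _
    · -- no sparse one-sided cut
      have o1 := o1 rfl
      have hi : ∀ i ≤ B.num, ¬ (bd G (supp A) (pre (supp A) B i) <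
          γ * min (vol G (pre (supp A) B i) : ℝ)
            (vol G (supp A) - vol G (pre (supp A) B i))) := by
        intro i hi
        -- The loop skips `i = 0` and `i = num`; there one side is empty and the border vanishes, so
        -- these cuts are never sparse.
        rcases Nat.eq_zero_or_pos i with rfl | hpos
        · simp [bd]
        · rcases hi.lt_or_eq with hlt | rfl
          · have := o1 (i - 1) (by omega)
            rw [Nat.sub_add_cancel hpos, hP.pvol i hi, hP.cut i hi] at this
            exact this
          · rw [pre_num hB]
            simp [bd]
      intro Q hQ hvol
      have hvol' : (2 : ℝ) * vol G Q ≤ vol G (supp A) := by exact_mod_cast hvol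
      rcases hQ with hQ | hQ
      · obtain ⟨i, hin, rfl⟩ := hQ.exists_pre hB
        have := hi i hin
        rw [min_eq_left (by linarith), not_lt] at this
        exact this
      · obtain ⟨i, hin, rfl⟩ := hQ.exists_suf hB
        have := hi i hin
        rw [hcompl] at hvol'
        rw [min_eq_right (by linarith), not_lt] at this
        rw [hcompl, hbd]
        exact this
    · -- the two-ended search
      obtain ⟨i, hi, hsparse⟩ := o2 rfl
      have hbest := twoSided_spec G (γ := γ) hB hP hA
      simp only [val_bind]
      rcases htwo : (twoSided G A γ (vol G (supp A)) B P).val with _ | ⟨i', j', x⟩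
      -- The sparse one-sided cut found before is a two-ended cut with one empty end, so the search
      -- cannot come back empty-handed.
      · exfalso
        rw [htwo] at hbest
        rw [hP.pvol _ (by omega), hP.cut _ (by omega)] at hsparse
        rcases le_total (vol G (pre (supp A) B (i + 1)) : ℝ)
          (vol G (supp A) - vol G (pre (supp A) B (i + 1))) with h | h
        · rw [min_eq_left h] at hsparse
          refine hbest (i + 1) B.num (by omega) ⟨by omega, le_rfl, ?_, ?_⟩
          · rw [suf_num hB, Finset.union_empty]
            have : (2 : ℝ) * vol G (pre (supp A) B (i + 1)) ≤ vol G (supp A) := by linarith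
            exact_mod_cast this
          · rw [suf_num hB, Finset.union_empty]
            exact hsparse
        · rw [min_eq_right h] at hsparse
          refine hbest 0 (i + 1) (by omega) ⟨by omega, by omega, ?_, ?_⟩
          · rw [pre_zero, Finset.empty_union]
            have : (2 : ℝ) * vol G (suf (supp A) B (i + 1)) ≤ vol G (supp A) := by
              rw [hcompl]; linarith
            exact_mod_cast this
          · rw [pre_zero, Finset.empty_union, hcompl, hbd]
            exact hsparse
      · rw [htwo] at hbest
        obtain ⟨⟨b1, b2, b3, b4⟩, b5, b6⟩ := hbest
        simp only [val_bind, val_pure, tabulate_val, SweepSpec, supp_two_ended]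
        refine ⟨Finset.union_subset (pre_subset _) (suf_subset _), b5, b3, b4, fun _ =>
          ⟨⟨_, _, isLower_pre hB _, isUpper_suf hB _, rfl⟩, ?_⟩⟩
        rintro Q ⟨L, U, hL, hU, rfl⟩ hvol hcut
        obtain ⟨k, hk, rfl⟩ := hL.exists_pre hB
        obtain ⟨l, hl, rfl⟩ := hU.exists_suf hB
        -- Overlapping or touching ends would cover `A`, which exceeds half of its own volume.
        have hkl : k < l := by
          by_contra hc
          have : supp A ⊆ pre (supp A) B k ∪ suf (supp A) B l := by
            intro v hv
            simp only [pre, suf, Finset.mem_union, Finset.mem_filter, hv, true_and]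
            omega
          have := vol_mono G this
          omega
        exact b6 k l (by omega) ⟨hkl, hl, hvol, hcut⟩
  · rw [hone] at o3
    obtain ⟨h1, h2, h3, h4⟩ := o3 i rfl
    rw [hP.pvol i (by omega), hP.cut i (by omega)] at h3
    rw [hP.pvol i (by omega)] at h4
    simp only [val_ite, val_bind, val_pure, tabulate_val]
    split_ifs with hc
    · simp only [SweepSpec, supp_pre]
      rw [hP.pvol i (by omega)] at hc ⊢
      rw [min_eq_left hc] at h3 h4
      refine ⟨pre_subset _, rfl, ?_, h3, fun h => absurd h4 (not_le.2 h)⟩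
      have : (2 : ℝ) * vol G (pre (supp A) B i) ≤ vol G (supp A) := by linarith
      exact_mod_cast this
    · simp only [SweepSpec, supp_suf]
      rw [hP.pvol i (by omega)] at hc ⊢
      rw [min_eq_right (le_of_not_ge hc)] at h3 h4
      rw [hcompl, hbd]
      refine ⟨suf_subset _, rfl, ?_, h3, fun h => absurd h4 (not_le.2 h)⟩
      have : (2 : ℝ) * vol G (suf (supp A) B i) ≤ vol G (supp A) := by
        rw [hcompl]; linarith
      exact_mod_cast this

lemma sweepCut_spec {A : Fin n → Bool} (hA : 0 < vol G (supp A)) (γ τ : ℝ) (u : Fin n → ℝ) :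
    SweepSpec G (supp A) u γ τ (sweepCut G A γ τ u).val := by
  simp only [sweepCut_eq, val_bind, volOf_val]
  obtain ⟨c, hc⟩ := center_val G A (vol G (supp A)) u
  rw [hc, ← sweepSpec_sub_const G c]
  exact sweepRest_spec G (isGrouping_mkBlocks A _) hA γ τ

lemma sweepRest_steps {A : Fin n → Bool} {u : Fin n → ℝ} {B : Blocks n}
    (hB : IsGrouping u (supp A) B) (γ τ : ℝ) :
    (sweepRest G A γ τ (vol G (supp A)) B).steps ≤ 2 + 5 * n + 2 * numEdges G +
      2 * 2 ^ (Nat.clog 2 (B.num + 1)) +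
      n * (4 * Nat.clog 2 (B.num + 1) + 4) +
      2 * numEdges G * (Nat.clog 2 (B.num + 1) + 2) := by
  have hP := isPrefixes_mkPrefixes G hB
  have h1 := mkPrefixes_steps G (A := A) hB (vol G (supp A))
  simp only [sweepRest, steps_bind]
  set P := (mkPrefixes G A (vol G (supp A)) B).val
  have h2 := oneSided_steps γ τ (vol G (supp A)) B P
  have h3 := hB.num_le.trans (Finset.card_le_univ _)
  rw [Fintype.card_fin] at h3
  have h4 := twoSided_steps G (γ := γ) (volA := vol G (supp A)) hB hP
  rcases hone : (oneSided γ τ (vol G (supp A)) B P).val with ⟨b, _ | i⟩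
  · rcases b with _ | _
    · simp only [steps_pure]
      omega
    · simp only [steps_bind]
      rcases htwo : (twoSided G A γ (vol G (supp A)) B P).val with _ | ⟨i', j', x⟩
      · simp only [steps_pure]
        omega
      · simp only [steps_bind, steps_pure]
        have := tabulate_steps (fun v => A v && (decide (B.rank v < i') || decide (j' ≤ B.rank v)))
        omega
  · simp only [steps_ite, steps_bind, steps_pure]
    have := tabulate_steps (fun v => A v && decide (B.rank v < i))
    have := tabulate_steps (fun v => A v && decide (i ≤ B.rank v))
    split_ifs <;> omega

lemma sweepCut_steps (A : Fin n → Bool) (γ τ : ℝ) (u : Fin n → ℝ) :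
    (sweepCut G A γ τ u).steps ≤ 2 + 15 * n + 6 * numEdges G +
      5 * 2 ^ (Nat.clog 2 (n + 1)) + (6 * n + 2 * numEdges G) * Nat.clog 2 (n + 1) := by
  simp only [sweepCut_eq, steps_bind, volOf_val]
  have h1 := volOf_steps G A
  have h2 := center_steps G A (vol G (supp A)) u
  have h3 := mkBlocks_steps A (center G A (vol G (supp A)) u).val
  have hB := isGrouping_mkBlocks A (center G A (vol G (supp A)) u).val
  have h4 := sweepRest_steps G hB γ τ
  have h5 := hB.num_le.trans (Finset.card_le_univ _)
  rw [Fintype.card_fin] at h5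
  set B := (mkBlocks A (center G A (vol G (supp A)) u).val).val
  have h6 : Nat.clog 2 (B.num + 1) ≤ Nat.clog 2 (n + 1) := Nat.clog_mono_right 2 (by omega)
  have h7 : Nat.clog 2 n ≤ Nat.clog 2 (n + 1) := Nat.clog_mono_right 2 (by omega)
  have h8 : 2 ^ Nat.clog 2 (B.num + 1) ≤ 2 ^ Nat.clog 2 (n + 1) :=
    Nat.pow_le_pow_right (by norm_num) h6
  have h9 : 2 ^ Nat.clog 2 n ≤ 2 ^ Nat.clog 2 (n + 1) := Nat.pow_le_pow_right (by norm_num) h7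
  have h10 := Nat.mul_le_mul_left n h6
  have h11 := Nat.mul_le_mul_left n h7
  have h12 := Nat.mul_le_mul_left (numEdges G) h6
  nlinarith

end SweepCut

/-! ### The running time -/

section RunningTime

variable {n : ℕ} (G : SimpleGraph (Fin n)) [DecidableRel G.Adj]

/-- The walk vector is recomputed from the start in every iteration, at cost `D` per earlier set;
this yields the term quadratic in the number of iterations. `K` covers the sweep and everything
linear in `n`. -/
lemma iterate_steps (γ τ : ℝ) (r : ℕ → Fin n → ℝ) (K D : ℕ)
    (hK : ∀ A u, (sweepCut G A γ τ u).steps + 2 + 3 * n ≤ K) (hD : 2 + n + 2 * numEdges G ≤ D)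
    (k t : ℕ) (s : State n) :
    (iterate G γ τ r k t s).steps ≤ 1 + k * (K + (s.hist.length + k) * D) := by
  induction k generalizing t s with
  | zero => simp [iterate]
  | succ k ih =>
    have h1 := walkVector_steps G s.hist (r t)
    have h2 := hK s.A (walkVector G s.hist (r t)).val
    have h3 : s.hist.length * (2 + n + 2 * numEdges G) ≤ (s.hist.length + (k + 1)) * D :=
      Nat.mul_le_mul (by omega) hD
    have e : (k + 1) * (K + (s.hist.length + (k + 1)) * D) =
      k * (K + (s.hist.length + 1 + k) * D) + K + (s.hist.length + (k + 1)) * D := by ring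
    rw [iterate]
    simp only [steps_bind, steps_tick]
    rcases (sweepCut G s.A γ τ (walkVector G s.hist (r t)).val).val with _ | ⟨S, x⟩
    · have h4 := ih (t + 1) { s with hist := s.A :: s.hist }
      simp only [List.length_cons] at h4
      dsimp only
      omega
    · simp only [steps_ite, steps_bind, steps_pure, tabulate_val]
      have h4 := ih (t + 1) { A := fun v => s.A v && !(S v), emptyL := false, volL := s.volL + x,
                              hist := s.A :: s.hist }
      simp only [List.length_cons] at h4
      have h5 := tabulate_steps (fun v => s.A v && !(S v))
      split_ifs <;> omega

lemma numEdges_ge (hdeg : ∀ v, 0 < G.degree v) : n ≤ 2 * numEdges G := by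
  have h : ∑ _v : Fin n, 1 ≤ ∑ v, G.degree v := Finset.sum_le_sum fun v _ => hdeg v
  rw [G.sum_degrees_eq_twice_card_edges] at h
  change n ≤ 2 * G.edgeFinset.card
  simpa using h

lemma clog_le_logb (n : ℕ) : (Nat.clog 2 (n + 1) : ℝ) ≤ 2 * Real.logb 2 n + 1 := by
  have h1 : Nat.clog 2 (n + 1) ≤ Nat.log 2 n + 1 := by
    rw [Nat.clog_le_iff_le_pow (by norm_num)]
    exact Nat.lt_pow_succ_log_self (by norm_num) n
  have h2 : (Nat.log 2 n : ℝ) ≤ Real.logb 2 n := Real.natLog_le_logb n 2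
  have h3 : (Nat.clog 2 (n + 1) : ℝ) ≤ Nat.log 2 n + 1 := by exact_mod_cast h1
  have h4 : (0 : ℝ) ≤ Nat.log 2 n := Nat.cast_nonneg _
  linarith

lemma iterations_le {φ : ℝ} (h0 : 0 < φ) (h1 : φ ≤ 1) : (iterations φ : ℝ) ≤ 2 / φ := by
  have h2 : (iterations φ : ℝ) < 1 / (12 * φ) + 1 := Nat.ceil_lt_add_one (by positivity)
  have h3 : 1 / (12 * φ) ≤ 1 / φ := by
    apply one_div_le_one_div_of_le h0
    linarith
  have h4 : (1 : ℝ) ≤ 1 / φ := by rw [le_div_iff₀ h0]; linarith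
  have h5 : 2 / φ = 1 / φ + 1 / φ := by ring
  linarith

/-- With `T ≤ 2 / φ` iterations, the sweeps cost `O(T m log n)` and the walks `O(T² m)`. -/
theorem cutProcedure_steps_le (hn : 2 ≤ n) (hdeg : ∀ v, 0 < G.degree v) {φ : ℝ} (h0 : 0 < φ)
    (h1 : φ ≤ 1) (r : ℕ → Fin n → ℝ) :
    ((cutProcedure G φ r).steps : ℝ) ≤ 1000 * (numEdges G * Real.logb 2 n / φ ^ 2) := by
  have hm := numEdges_ge G hdeg
  set m := numEdges G with hm'
  set c := Nat.clog 2 (n + 1) with hc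
  have hpow : 2 ^ c ≤ 2 * n := by
    have h1 : c ≤ Nat.log 2 n + 1 := by
      rw [hc, Nat.clog_le_iff_le_pow (by norm_num)]
      exact Nat.lt_pow_succ_log_self (by norm_num) n
    calc 2 ^ c ≤ 2 ^ (Nat.log 2 n + 1) := Nat.pow_le_pow_right (by norm_num) h1
      _ = 2 * 2 ^ Nat.log 2 n := by ring
      _ ≤ 2 * n := Nat.mul_le_mul_left 2 (Nat.pow_log_le_self 2 (by omega))
  have hcpos : 1 ≤ c := by
    rw [hc]; exact Nat.clog_pos (by norm_num) (by omega)
  have hK : ∀ A u, (sweepCut G A (cutThreshold G φ) (balance G φ * m) u).steps + 2 + 3 * n ≤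
      90 * (m * c) := by
    intro A u
    have := sweepCut_steps G A (cutThreshold G φ) (balance G φ * m) u
    rw [← hc, ← hm'] at this
    have h2 : m ≤ m * c := Nat.le_mul_of_pos_right _ hcpos
    have h3 : n * c ≤ 2 * m * c := Nat.mul_le_mul_right c hm
    nlinarith
  have hit := iterate_steps G (cutThreshold G φ) (balance G φ * m) r (90 * (m * c)) (6 * m) hK
    (by omega) (iterations φ) 1 { A := fun _ => true, emptyL := true, volL := 0, hist := [] }
  have hsteps : (cutProcedure G φ r).steps ≤
      1 + n + (1 + iterations φ * (90 * (m * c) + iterations φ * (6 * m))) := by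
    simp only [List.length_nil, zero_add] at hit
    simp only [cutProcedure, steps_bind, steps_tick, ← hm']
    omega
  have hsteps' : ((cutProcedure G φ r).steps : ℝ) ≤
      1 + n + (1 + iterations φ * (90 * (m * c) + iterations φ * (6 * m))) := by
    exact_mod_cast hsteps
  have hT := iterations_le h0 h1
  have hlog : (c : ℝ) ≤ 3 * Real.logb 2 n := by
    have h2 := clog_le_logb n
    have h3 : (1 : ℝ) ≤ Real.logb 2 n := by
      rw [Real.le_logb_iff_rpow_le (by norm_num) (by positivity)]
      simpa using (by exact_mod_cast hn : (2 : ℝ) ≤ n)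
    linarith
  have hl1 : (1 : ℝ) ≤ Real.logb 2 n := by
    rw [Real.le_logb_iff_rpow_le (by norm_num) (by positivity)]
    simpa using (by exact_mod_cast hn : (2 : ℝ) ≤ n)
  have hx : (1 : ℝ) ≤ 1 / φ := by rw [le_div_iff₀ h0]; linarith
  have hm1 : (1 : ℝ) ≤ m := by exact_mod_cast (by omega : 1 ≤ m)
  have hnm : (n : ℝ) ≤ 2 * m := by exact_mod_cast hm
  set x := 1 / φ with hxd
  set ℓ := Real.logb 2 n
  have hgoal : 1000 * ((m : ℝ) * ℓ / φ ^ 2) = 1000 * (m * ℓ * x ^ 2) := by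
    rw [hxd]; field_simp
  have hT' : (iterations φ : ℝ) ≤ 2 * x := by rw [hxd]; rw [mul_one_div]; exact hT
  rw [hgoal]
  -- Since `ℓ ≥ 1` and `x = 1 / φ ≥ 1`, the product `m * ℓ * x ^ 2` dominates every term of the
  -- count.
  have hmx : (m : ℝ) ≤ m * ℓ * x ^ 2 := by
    have h2 : (1 : ℝ) ≤ ℓ * x ^ 2 := one_le_mul_of_one_le_of_one_le hl1 (one_le_pow₀ hx)
    calc (m : ℝ) = m * 1 := (mul_one _).symm
      _ ≤ m * (ℓ * x ^ 2) := by gcongr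
      _ = _ := by ring
  have h2 : (iterations φ : ℝ) * (90 * (m * c) + iterations φ * (6 * m)) ≤
      2 * x * (90 * (m * (3 * ℓ)) + 2 * x * (6 * m)) := by gcongr
  have h3 : 2 * x * (90 * (m * (3 * ℓ)) + 2 * x * (6 * m)) ≤ 564 * (m * ℓ * x ^ 2) := by
    have h4 : x * (m * ℓ) ≤ m * ℓ * x ^ 2 := by
      have : x ≤ x ^ 2 := by nlinarith
      calc x * (m * ℓ) ≤ x ^ 2 * (m * ℓ) := by gcongr
        _ = _ := by ring
    have h5 : x ^ 2 * m ≤ m * ℓ * x ^ 2 := by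
      calc x ^ 2 * m = m * 1 * x ^ 2 := by ring
        _ ≤ m * ℓ * x ^ 2 := by gcongr
    nlinarith
  linarith

end RunningTime

/-! ### The walk and the potential -/

section Walk

variable {n : ℕ} (G : SimpleGraph (Fin n)) [DecidableRel G.Adj]

section Linear

variable {E F : Type*} [AddCommGroup E] [Module ℝ E] [AddCommGroup F] [Module ℝ F]

/-- The walk forms real linear combinations, so it commutes with linear maps. Taking the inner
product with `r` for `f` identifies the projected vector walk with the scalar walk of the program.
-/
lemma map_walk (f : E →ₗ[ℝ] F) (A : Fin n → Bool) (q : Fin n → E) (v : Fin n) :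
    f (walk G A q v) = walk G A (fun v => f (q v)) v := by
  simp only [walk, apply_ite f, map_add, map_smul, map_sum, map_zero]

lemma map_walks (f : E →ₗ[ℝ] F) (hist : List (Fin n → Bool)) (q : Fin n → E) (v : Fin n) :
    f (walks G q hist v) = walks G (fun v => f (q v)) hist v := by
  induction hist generalizing v with
  | nil => rfl
  | cons A hist ih => simp only [walks, map_walk, ih]

variable {G}

/-- A step is an average over the edges at `v`: an edge inside `A` contributes the midpoint of its
end values, an edge leaving `A` contributes `q v`. The convexity estimates for the walk start from
this form. -/
lemma walk_of_mem {A : Fin n → Bool} {v : Fin n} (hv : A v = true) (hd : 0 < G.degree v)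
    (q : Fin n → E) (c : E) : walk G A q v - c = (G.degree v : ℝ)⁻¹ • ∑ w, if G.Adj v w then
      ((1 / 2 : ℝ) • (q v + if A w then q w else q v) - c) else 0 := by
  have hd' : (G.degree v : ℝ) ≠ 0 := by positivity
  have h1 : ∑ w, (if G.Adj v w then ((1 / 2 : ℝ) • (q v + if A w then q w else q v) - c) else 0) =
      (1 / 2 : ℝ) • ((G.degree v : ℝ) • q v + ∑ w, if G.Adj v w then
        (if A w then q w else q v) else 0) - (G.degree v : ℝ) • c := by
    rw [cast_degree, Finset.sum_smul, Finset.sum_smul, ← Finset.sum_add_distrib, Finset.smul_sum,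
      ← Finset.sum_sub_distrib]
    refine Finset.sum_congr rfl fun w _ => ?_
    by_cases h : G.Adj v w <;> simp [h]
  rw [h1, walk, if_pos hv]
  match_scalars <;> field_simp

lemma walk_sub_const (hdeg : ∀ v, 0 < G.degree v) (A : Fin n → Bool) (q : Fin n → E) (c : E)
    (v : Fin n) : walk G A (fun v => q v - c) v = walk G A q v - c := by
  by_cases hv : A v = true
  · rw [walk_of_mem hv (hdeg v), ← sub_zero (walk G A _ v), walk_of_mem hv (hdeg v)]
    congr 1
    refine Finset.sum_congr rfl fun w _ => ?_
    by_cases h : G.Adj v w <;> by_cases h2 : A w = true <;> simp [h, h2] <;> module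
  · simp [walk, hv]

end Linear

variable {E : Type*} [NormedAddCommGroup E]

/-- The degree-weighted sum of squares over `A`. -/
def sqSum (A : Finset (Fin n)) (q : Fin n → E) : ℝ := ∑ v ∈ A, (G.degree v : ℝ) * ‖q v‖ ^ 2

/-- The Dirichlet energy in `A`; each edge is counted twice. -/
def energy (A : Finset (Fin n)) (q : Fin n → E) : ℝ :=
  ∑ v ∈ A, ∑ w ∈ A, if G.Adj v w then ‖q v - q w‖ ^ 2 else 0

lemma sqSum_nonneg (A : Finset (Fin n)) (q : Fin n → E) : 0 ≤ sqSum G A q :=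
  Finset.sum_nonneg fun _ _ => by positivity

lemma energy_nonneg (A : Finset (Fin n)) (q : Fin n → E) : 0 ≤ energy G A q :=
  Finset.sum_nonneg fun _ _ => Finset.sum_nonneg fun _ _ => by split_ifs <;> positivity

variable [InnerProductSpace ℝ E]

/-- The degree-weighted mean over `A`. -/
def mean (A : Finset (Fin n)) (q : Fin n → E) : E :=
  (vol G A : ℝ)⁻¹ • ∑ v ∈ A, (G.degree v : ℝ) • q v

/-- The potential: the degree-weighted variance over `A`. -/
def pot (A : Finset (Fin n)) (q : Fin n → E) : ℝ := sqSum G A (fun v => q v - mean G A q)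

variable {G}

lemma pot_nonneg (A : Finset (Fin n)) (q : Fin n → E) : 0 ≤ pot G A q := sqSum_nonneg G _ _

/-- This is Cauchy–Schwarz for a sum with as many terms as the degree, or Jensen for the squared
norm. -/
lemma degree_mul_norm_average_sq_le (v : Fin n) (hd : 0 < G.degree v) (x : Fin n → E) :
    (G.degree v : ℝ) * ‖(G.degree v : ℝ)⁻¹ • ∑ w, (if G.Adj v w then x w else 0)‖ ^ 2 ≤
      ∑ w, if G.Adj v w then ‖x w‖ ^ 2 else 0 := by
  have hd' : (0 : ℝ) < G.degree v := by positivity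
  rw [← Finset.sum_filter, ← Finset.sum_filter]
  set s := Finset.univ.filter (fun w => G.Adj v w)
  have hs : (s.card : ℝ) = G.degree v := by rw [cast_degree, Finset.sum_boole]
  have h1 : ‖∑ w ∈ s, x w‖ ^ 2 ≤ G.degree v * ∑ w ∈ s, ‖x w‖ ^ 2 := by
    rw [← hs]
    refine le_trans ?_ (sq_sum_le_card_mul_sum_sq (s := s) (f := fun w => ‖x w‖))
    gcongr
    exact norm_sum_le _ _
  rw [norm_smul, mul_pow, norm_inv, Real.norm_of_nonneg hd'.le]
  calc (G.degree v : ℝ) * ((G.degree v : ℝ)⁻¹ ^ 2 * ‖∑ w ∈ s, x w‖ ^ 2)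
      = (G.degree v : ℝ)⁻¹ * ‖∑ w ∈ s, x w‖ ^ 2 := by field_simp
    _ ≤ (G.degree v : ℝ)⁻¹ * (G.degree v * ∑ w ∈ s, ‖x w‖ ^ 2) := by gcongr
    _ = ∑ w ∈ s, ‖x w‖ ^ 2 := by field_simp

lemma sum_supp_ite (A : Fin n → Bool) (v : Fin n) (f : Fin n → ℝ) :
    ∑ w ∈ supp A, (if G.Adj v w then f w else 0) =
      ∑ w, if G.Adj v w then (if A w then f w else 0) else 0 := by
  rw [supp, Finset.sum_filter]
  refine Finset.sum_congr rfl fun w _ => ?_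
  by_cases h : G.Adj v w <;> simp [h]

/-- One walk step decreases the sum of squares by a quarter of the energy. -/
lemma sqSum_walk_le (hdeg : ∀ v, 0 < G.degree v) (A : Fin n → Bool) (q : Fin n → E) :
    sqSum G (supp A) (walk G A q) ≤ sqSum G (supp A) q - 1 / 4 * energy G (supp A) q := by
  have h1 : ∀ v ∈ supp A, (G.degree v : ℝ) * ‖walk G A q v‖ ^ 2 ≤
      (G.degree v : ℝ) * ‖q v‖ ^ 2 + ∑ w ∈ supp A, (if G.Adj v w then
        (1 / 2 * ‖q w‖ ^ 2 - 1 / 2 * ‖q v‖ ^ 2) else 0) -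
        1 / 4 * ∑ w ∈ supp A, if G.Adj v w then ‖q v - q w‖ ^ 2 else 0 := by
    intro v hv
    have hv' := mem_supp.1 hv
    have h2 := walk_of_mem hv' (hdeg v) q 0
    rw [sub_zero] at h2
    rw [h2]
    refine (degree_mul_norm_average_sq_le v (hdeg v) _).trans (le_of_eq ?_)
    rw [sum_supp_ite, sum_supp_ite, cast_degree, Finset.sum_mul, Finset.mul_sum,
      ← Finset.sum_add_distrib, ← Finset.sum_sub_distrib]
    refine Finset.sum_congr rfl fun w _ => ?_
    by_cases h : G.Adj v w
    · by_cases hw : A w = true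
      · simp only [h, hw, if_true, sub_zero, one_mul]
        rw [norm_smul, mul_pow]
        -- The squared norm of a midpoint is the mean of the two squared norms minus a quarter of
        -- the squared distance; that quarter is the gain of the step.
        have := parallelogram_law_with_norm ℝ (q v) (q w)
        norm_num
        nlinarith
      · have e : (2⁻¹ : ℝ) • q v + (2⁻¹ : ℝ) • q v = q v := by module
        simp [h, hw, e]
    · simp [h]
  -- The summand is antisymmetric in the two vertices.
  have h2 : ∑ v ∈ supp A, ∑ w ∈ supp A, (if G.Adj v w then
      (1 / 2 * ‖q w‖ ^ 2 - 1 / 2 * ‖q v‖ ^ 2) else 0) = 0 := by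
    have h3 : ∑ v ∈ supp A, ∑ w ∈ supp A, (if G.Adj v w then
        (1 / 2 * ‖q w‖ ^ 2 - 1 / 2 * ‖q v‖ ^ 2) else 0) =
        -∑ v ∈ supp A, ∑ w ∈ supp A, (if G.Adj v w then
        (1 / 2 * ‖q w‖ ^ 2 - 1 / 2 * ‖q v‖ ^ 2) else 0) := by
      conv_lhs => rw [Finset.sum_comm]
      rw [← Finset.sum_neg_distrib]
      refine Finset.sum_congr rfl fun v _ => ?_
      rw [← Finset.sum_neg_distrib]
      refine Finset.sum_congr rfl fun w _ => ?_
      by_cases h : G.Adj v w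
      · simp [h, h.symm]
      · have h' : ¬ G.Adj w v := fun hc => h hc.symm
        simp [h, h']
    linarith
  have h3 := Finset.sum_le_sum h1
  rw [Finset.sum_sub_distrib, Finset.sum_add_distrib, h2, ← Finset.mul_sum, add_zero] at h3
  exact h3

/-- The displacement at `v` is an average of halved differences along edges, so Jensen bounds it by
a quarter of the energy. This allows comparing the values on `S` before and after the step. -/
lemma sqSum_walk_sub_le (hdeg : ∀ v, 0 < G.degree v) (A : Fin n → Bool) (q : Fin n → E) :
    sqSum G (supp A) (fun v => walk G A q v - q v) ≤ 1 / 4 * energy G (supp A) q := by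
  rw [sqSum, energy, Finset.mul_sum]
  refine Finset.sum_le_sum fun v hv => ?_
  rw [walk_of_mem (mem_supp.1 hv) (hdeg v)]
  refine (degree_mul_norm_average_sq_le v (hdeg v) _).trans (le_of_eq ?_)
  rw [sum_supp_ite, Finset.mul_sum]
  refine Finset.sum_congr rfl fun w _ => ?_
  by_cases h : G.Adj v w
  · by_cases hw : A w = true
    · simp only [h, hw, if_true]
      have e : (1 / 2 : ℝ) • (q v + q w) - q v = (-(1 / 2) : ℝ) • (q v - q w) := by module
      rw [e, norm_smul, mul_pow]
      norm_num
    · have e : (2⁻¹ : ℝ) • q v + (2⁻¹ : ℝ) • q v = q v := by module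
      simp [h, hw, e]
  · simp [h]

lemma sum_degree_smul_sub_mean {A : Finset (Fin n)} (hA : 0 < vol G A) (q : Fin n → E) :
    ∑ v ∈ A, (G.degree v : ℝ) • (q v - mean G A q) = 0 := by
  have hA' : (vol G A : ℝ) ≠ 0 := by positivity
  simp only [smul_sub, Finset.sum_sub_distrib, ← Finset.sum_smul, ← cast_vol]
  rw [mean, smul_smul, mul_inv_cancel₀ hA', one_smul, sub_self]

/-- The parallel axis theorem: the mixed term vanishes because the weighted deviations from the mean
sum to zero. -/
lemma sqSum_sub_const {A : Finset (Fin n)} (hA : 0 < vol G A) (q : Fin n → E) (c : E) :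
    sqSum G A (fun v => q v - c) = pot G A q + vol G A * ‖mean G A q - c‖ ^ 2 := by
  have h1 : ∀ v, (G.degree v : ℝ) * ‖q v - c‖ ^ 2 =
      (G.degree v : ℝ) * ‖q v - mean G A q‖ ^ 2 +
      2 * inner ℝ ((G.degree v : ℝ) • (q v - mean G A q)) (mean G A q - c) +
      (G.degree v : ℝ) * ‖mean G A q - c‖ ^ 2 := by
    intro v
    have e : q v - c = (q v - mean G A q) + (mean G A q - c) := by abel
    rw [e, norm_add_sq_real, real_inner_smul_left]
    ring
  simp only [pot, sqSum, h1, Finset.sum_add_distrib, ← Finset.mul_sum, ← sum_inner,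
    sum_degree_smul_sub_mean hA, ← Finset.sum_mul, ← cast_vol, inner_zero_left]
  ring

lemma pot_le_sqSum_sub_const {A : Finset (Fin n)} (hA : 0 < vol G A) (q : Fin n → E) (c : E) :
    pot G A q ≤ sqSum G A (fun v => q v - c) := by
  rw [sqSum_sub_const hA]
  have : (0 : ℝ) ≤ vol G A * ‖mean G A q - c‖ ^ 2 := by positivity
  linarith

lemma pot_le_sqSum {A : Finset (Fin n)} (hA : 0 < vol G A) (q : Fin n → E) :
    pot G A q ≤ sqSum G A q := by
  simpa using pot_le_sqSum_sub_const hA q 0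

/-- The potential after a round in which `S` leaves `A`. -/
lemma pot_walk_le (hdeg : ∀ v, 0 < G.degree v) {A : Fin n → Bool} {S : Finset (Fin n)}
    (hS : S ⊆ supp A) (hA : 0 < vol G (supp A \ S)) (p : Fin n → E) :
    pot G (supp A \ S) (walk G A p) ≤ pot G (supp A) p -
      (1 / 4 * energy G (supp A) (fun v => p v - mean G (supp A) p) +
        sqSum G S (walk G A (fun v => p v - mean G (supp A) p))) := by
  set q : Fin n → E := fun v => p v - mean G (supp A) p with hq
  -- The mean over the smaller set need not be known: the variance is at most the second moment
  -- about the old mean, and the walk commutes with subtracting that constant.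
  have h1 := pot_le_sqSum_sub_const hA (walk G A p) (mean G (supp A) p)
  have h2 : (fun v => walk G A p v - mean G (supp A) p) = walk G A q := by
    funext v; rw [hq, walk_sub_const hdeg]
  rw [h2] at h1
  have h3 : sqSum G (supp A \ S) (walk G A q) + sqSum G S (walk G A q) =
    sqSum G (supp A) (walk G A q) := Finset.sum_sdiff hS
  have h4 := sqSum_walk_le hdeg A q
  have h5 : pot G (supp A) p = sqSum G (supp A) q := rfl
  linarith

end Walk

/-! ### A Cheeger inequality for sweep cuts -/

section LayerCake

lemma intervalIntegral_ite_lt {a M : ℝ} (h0 : 0 ≤ a) (hM : a ≤ M) :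
    ∫ s in (0 : ℝ)..M, (if s < a then (1 : ℝ) else 0) = a ∧
      IntervalIntegrable (fun s => if s < a then (1 : ℝ) else 0) volume 0 M := by
  have h1 : (fun s : ℝ => if s < a then (1 : ℝ) else 0) =
      (Set.Iio a).indicator (fun _ => 1) := by
    funext s; simp [Set.indicator_apply]
  have hint : ∀ x y : ℝ, IntervalIntegrable (fun s => if s < a then (1 : ℝ) else 0) volume x y := by
    intro x y
    rw [h1, intervalIntegrable_iff]
    exact (integrableOn_const (by simp)).indicator measurableSet_Iio
  refine ⟨?_, hint 0 M⟩
  rw [← intervalIntegral.integral_add_adjacent_intervals (hint 0 a) (hint a M)]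
  have e1 : ∫ s in (0 : ℝ)..a, (if s < a then (1 : ℝ) else 0) = ∫ _s in (0 : ℝ)..a, (1 : ℝ) := by
    refine intervalIntegral.integral_congr_ae ?_
    have : ∀ᵐ s : ℝ ∂volume, s ≠ a := by
      simp [ae_iff]
    filter_upwards [this] with s hs hs'
    rw [Set.uIoc_of_le h0] at hs'
    rw [if_pos (lt_of_le_of_ne hs'.2 hs)]
  have e2 : ∫ s in a..M, (if s < a then (1 : ℝ) else 0) = ∫ _s in a..M, (0 : ℝ) := by
    refine intervalIntegral.integral_congr fun s hs => ?_
    rw [Set.uIcc_of_le hM] at hs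
    exact if_neg (not_lt.2 hs.1)
  rw [e1, e2]
  simp

/-- The indicator of `s < a`. -/
def above (s a : ℝ) : ℝ := if s < a then 1 else 0

/-- A linear inequality between level sets gives one between the functions. -/
lemma layer_cake {ι : Type*} (I : Finset ι) (c a : ι → ℝ) (ha : ∀ k ∈ I, 0 ≤ a k)
    (h : ∀ s : ℝ, 0 ≤ s → 0 ≤ ∑ k ∈ I, c k * above s (a k)) :
    0 ≤ ∑ k ∈ I, c k * a k := by
  set M := ∑ k ∈ I, a k
  have hM : ∀ k ∈ I, a k ≤ M := fun k hk => Finset.single_le_sum ha hk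
  have hM0 : 0 ≤ M := Finset.sum_nonneg ha
  have h1 : ∫ s in (0 : ℝ)..M, ∑ k ∈ I, c k * above s (a k) =
      ∑ k ∈ I, c k * a k := by
    rw [intervalIntegral.integral_finsetSum]
    · refine Finset.sum_congr rfl fun k hk => ?_
      simp only [above]
      rw [intervalIntegral.integral_const_mul, (intervalIntegral_ite_lt (ha k hk) (hM k hk)).1]
    · intro k hk
      exact (intervalIntegral_ite_lt (ha k hk) (hM k hk)).2.const_mul _
  rw [← h1]
  exact intervalIntegral.integral_nonneg hM0 fun s hs => h s hs.1

end LayerCake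

/-! ### From expanding level sets to a lower bound on the energy -/

section Cheeger

variable {n : ℕ} {G : SimpleGraph (Fin n)} [DecidableRel G.Adj]

/-- If every level set of `g` has enough border, apart from what it shares with `S`, then the
energy of `g` is large. -/
lemma cheeger {A S : Finset (Fin n)} (hS : S ⊆ A) {γ : ℝ} (hγ : 0 < γ)
    {g : Fin n → ℝ} (hg : ∀ v, 0 ≤ g v)
    (h : ∀ s : ℝ, 0 ≤ s → γ / 2 * vol G (A.filter (fun v => s < g v ^ 2)) ≤
      bd G A (A.filter (fun v => s < g v ^ 2)) +
        γ * vol G (A.filter (fun v => s < g v ^ 2) ∩ S)) :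
    sqSum G A g ≤ 4 / γ ^ 2 * energy G A g + 4 * sqSum G S g := by
  have hlevel : ∀ s : ℝ, 0 ≤ s →
      0 ≤ ∑ v ∈ A, ∑ w ∈ A, (if G.Adj v w then (1 : ℝ) else 0) * ((if s < g v ^ 2 then 1 else 0) -
        (if s < min (g v ^ 2) (g w ^ 2) then 1 else 0)) +
      γ * ∑ v ∈ S, (G.degree v : ℝ) * (if s < g v ^ 2 then 1 else 0) -
      γ / 2 * ∑ v ∈ A, (G.degree v : ℝ) * (if s < g v ^ 2 then 1 else 0) := by
    intro s hs
    have h1 := h s hs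
    rw [cast_vol, cast_vol] at h1
    have e1 : ∑ v ∈ A.filter (fun v => s < g v ^ 2), (G.degree v : ℝ) =
        ∑ v ∈ A, (G.degree v : ℝ) * (if s < g v ^ 2 then 1 else 0) := by
      rw [Finset.sum_filter]
      exact Finset.sum_congr rfl fun v _ => by split_ifs <;> simp
    have e2 : ∑ v ∈ A.filter (fun v => s < g v ^ 2) ∩ S, (G.degree v : ℝ) =
        ∑ v ∈ S, (G.degree v : ℝ) * (if s < g v ^ 2 then 1 else 0) := by
      have : A.filter (fun v => s < g v ^ 2) ∩ S = S.filter (fun v => s < g v ^ 2) := by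
        ext v; have := @hS v; simp only [Finset.mem_inter, Finset.mem_filter]; tauto
      rw [this, Finset.sum_filter]
      exact Finset.sum_congr rfl fun v _ => by split_ifs <;> simp
    have e3 : bd G A (A.filter (fun v => s < g v ^ 2)) =
        ∑ v ∈ A, ∑ w ∈ A, (if G.Adj v w then (1 : ℝ) else 0) * ((if s < g v ^ 2 then 1 else 0) -
        (if s < min (g v ^ 2) (g w ^ 2) then 1 else 0)) := by
      have : A \ A.filter (fun v => s < g v ^ 2) = A.filter (fun v => ¬ s < g v ^ 2) := by
        rw [Finset.filter_not]
      rw [bd, edges, this, Finset.sum_filter]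
      refine Finset.sum_congr rfl fun v _ => ?_
      rw [Finset.sum_filter]
      by_cases hv : s < g v ^ 2
      · simp only [hv, if_true]
        refine Finset.sum_congr rfl fun w _ => ?_
        by_cases hw : s < g w ^ 2 <;> simp [hv, hw]
      · simp [hv]
    rw [e1, e2, e3] at h1
    linarith
  have hcake : 0 ≤ ∑ v ∈ A, ∑ w ∈ A, (if G.Adj v w then (1 : ℝ) else 0) * (g v ^ 2 -
        min (g v ^ 2) (g w ^ 2)) + γ * sqSum G S g - γ / 2 * sqSum G A g := by
    -- The four kinds of terms are gathered in one family over a sum type, so that `layer_cake`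
    -- applies to a single sum. Both ends of an edge lie in the level set exactly when `s` is below
    -- the minimum of the two squares.
    let c : (Fin n × Fin n) ⊕ (Fin n × Fin n) ⊕ Fin n ⊕ Fin n → ℝ :=
      Sum.elim (fun p => if G.Adj p.1 p.2 then 1 else 0)
        (Sum.elim (fun p => -(if G.Adj p.1 p.2 then 1 else 0))
        (Sum.elim (fun v => γ * G.degree v) (fun v => -(γ / 2 * G.degree v))))
    let a : (Fin n × Fin n) ⊕ (Fin n × Fin n) ⊕ Fin n ⊕ Fin n → ℝ :=
      Sum.elim (fun p => g p.1 ^ 2)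
        (Sum.elim (fun p => min (g p.1 ^ 2) (g p.2 ^ 2))
        (Sum.elim (fun v => g v ^ 2) (fun v => g v ^ 2)))
    have key := layer_cake ((A ×ˢ A).disjSum ((A ×ˢ A).disjSum (S.disjSum A))) c a ?_ ?_
    · simp only [Finset.sum_disjSum, c, a, Sum.elim_inl, Sum.elim_inr, Finset.sum_product] at key
      simp only [sqSum, Real.norm_eq_abs, sq_abs, mul_sub, Finset.sum_sub_distrib, Finset.mul_sum]
      simp only [neg_mul, Finset.sum_neg_distrib, mul_assoc] at key
      linarith
    · rintro (p | p | v | v) _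
      · exact sq_nonneg _
      · exact le_min (sq_nonneg _) (sq_nonneg _)
      · exact sq_nonneg _
      · exact sq_nonneg _
    · intro s hs
      have := hlevel s hs
      simp only [Finset.sum_disjSum, c, a, Sum.elim_inl, Sum.elim_inr, Finset.sum_product]
      simp only [mul_sub, Finset.sum_sub_distrib, Finset.mul_sum] at this
      simp only [above, neg_mul, Finset.sum_neg_distrib, mul_assoc]
      linarith
  -- the edge term
  have hedge : ∑ v ∈ A, ∑ w ∈ A, (if G.Adj v w then (1 : ℝ) else 0) * (g v ^ 2 -
        min (g v ^ 2) (g w ^ 2)) ≤ 1 / γ * energy G A g + γ / 4 * sqSum G A g := by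
    -- Symmetrisation: the second part is antisymmetric and cancels in the double sum.
    have h1 : ∀ v w, (if G.Adj v w then (1 : ℝ) else 0) * (g v ^ 2 - min (g v ^ 2) (g w ^ 2)) =
        (if G.Adj v w then (1 : ℝ) else 0) * (1 / 2 * |g v ^ 2 - g w ^ 2|) +
        (if G.Adj v w then (1 : ℝ) else 0) * (1 / 2 * g v ^ 2 - 1 / 2 * g w ^ 2) := by
      intro v w
      rcases le_total (g v ^ 2) (g w ^ 2) with h | h
      · rw [min_eq_left h, abs_of_nonpos (by linarith)]; ring
      · rw [min_eq_right h, abs_of_nonneg (by linarith)]; ring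
    have h2 : ∑ v ∈ A, ∑ w ∈ A,
        (if G.Adj v w then (1 : ℝ) else 0) * (1 / 2 * g v ^ 2 - 1 / 2 * g w ^ 2) = 0 := by
      have h3 : ∑ v ∈ A, ∑ w ∈ A,
          (if G.Adj v w then (1 : ℝ) else 0) * (1 / 2 * g v ^ 2 - 1 / 2 * g w ^ 2) =
          -∑ v ∈ A, ∑ w ∈ A,
          (if G.Adj v w then (1 : ℝ) else 0) * (1 / 2 * g v ^ 2 - 1 / 2 * g w ^ 2) := by
        conv_lhs => rw [Finset.sum_comm]
        rw [← Finset.sum_neg_distrib]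
        refine Finset.sum_congr rfl fun v _ => ?_
        rw [← Finset.sum_neg_distrib]
        refine Finset.sum_congr rfl fun w _ => ?_
        by_cases hadj : G.Adj v w
        · simp [hadj, hadj.symm]
        · have hadj' : ¬ G.Adj w v := fun hc => hadj hc.symm
          simp [hadj, hadj']
      linarith
    have h3 : ∀ v w, (if G.Adj v w then (1 : ℝ) else 0) * (1 / 2 * |g v ^ 2 - g w ^ 2|) ≤
        1 / γ * (if G.Adj v w then ‖g v - g w‖ ^ 2 else 0) +
          (γ / 8 * ((if G.Adj v w then (1 : ℝ) else 0) * g v ^ 2) +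
            γ / 8 * ((if G.Adj v w then (1 : ℝ) else 0) * g w ^ 2)) := by
      intro v w
      by_cases hadj : G.Adj v w
      · simp only [hadj, if_true, one_mul, Real.norm_eq_abs, sq_abs]
        have e : g v ^ 2 - g w ^ 2 = (g v - g w) * (g v + g w) := by ring
        rw [e, abs_mul, abs_of_nonneg (add_nonneg (hg v) (hg w))]
        have h4 : (g v - g w) ^ 2 = |g v - g w| ^ 2 := (sq_abs _).symm
        rw [h4]
        set x := |g v - g w|
        set y := g v + g w
        -- The weights are chosen so that the terms in `y` sum to at most `γ / 4 * sqSum G A g`,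
        -- half of what the level sets provide; this half is absorbed on the left.
        have h5 : 1 / 2 * (x * y) ≤ 1 / γ * x ^ 2 + γ / 16 * y ^ 2 := by
          have : 1 / γ * x ^ 2 + γ / 16 * y ^ 2 - 1 / 2 * (x * y) =
              1 / γ * (x - γ / 4 * y) ^ 2 := by field_simp; ring
          have : 0 ≤ 1 / γ * (x - γ / 4 * y) ^ 2 := by positivity
          linarith
        have h6 : y ^ 2 ≤ 2 * g v ^ 2 + 2 * g w ^ 2 := by
          simp only [y]; nlinarith [sq_nonneg (g v - g w)]
        nlinarith
      · simp [hadj]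
    have hdegle : ∀ v, ∑ w ∈ A, (if G.Adj v w then (1 : ℝ) else 0) ≤ G.degree v := by
      intro v
      rw [cast_degree]
      exact Finset.sum_le_sum_of_subset_of_nonneg (Finset.subset_univ _)
        fun _ _ _ => by split_ifs <;> norm_num
    have h4 : ∑ v ∈ A, ∑ w ∈ A, (if G.Adj v w then (1 : ℝ) else 0) * g v ^ 2 ≤ sqSum G A g := by
      refine Finset.sum_le_sum fun v _ => ?_
      rw [← Finset.sum_mul, Real.norm_eq_abs, sq_abs]
      exact mul_le_mul_of_nonneg_right (hdegle v) (sq_nonneg _)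
    have h5 : ∑ v ∈ A, ∑ w ∈ A, (if G.Adj v w then (1 : ℝ) else 0) * g w ^ 2 ≤ sqSum G A g := by
      rw [Finset.sum_comm]
      refine Finset.sum_le_sum fun v _ => ?_
      rw [← Finset.sum_mul, Real.norm_eq_abs, sq_abs]
      refine mul_le_mul_of_nonneg_right (le_trans (le_of_eq ?_) (hdegle v)) (sq_nonneg _)
      exact Finset.sum_congr rfl fun w _ => by simp only [G.adj_comm w v]
    simp only [h1, Finset.sum_add_distrib, h2, add_zero]
    refine (Finset.sum_le_sum fun v _ => Finset.sum_le_sum fun w _ => h3 v w).trans ?_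
    simp only [Finset.sum_add_distrib, ← Finset.mul_sum]
    have h6 : (0 : ℝ) ≤ γ / 8 := by positivity
    have h7 := mul_le_mul_of_nonneg_left h4 h6
    have h8 := mul_le_mul_of_nonneg_left h5 h6
    rw [energy]
    linarith
  have h1 : γ / 4 * sqSum G A g ≤ 1 / γ * energy G A g + γ * sqSum G S g := by linarith
  have h2 := mul_le_mul_of_nonneg_left h1 (by positivity : 0 ≤ 4 / γ)
  have e1 : 4 / γ * (γ / 4 * sqSum G A g) = sqSum G A g := by field_simp
  have e2 : 4 / γ * (1 / γ * energy G A g + γ * sqSum G S g) =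
      4 / γ ^ 2 * energy G A g + 4 * sqSum G S g := by field_simp
  rw [e1, e2] at h2
  exact h2

/-- A weighted median. -/
lemma exists_median (A : Finset (Fin n)) (u : Fin n → ℝ) :
    ∃ c, 2 * vol G (A.filter (fun v => u v < c)) ≤ vol G A ∧
      2 * vol G (A.filter (fun v => c < u v)) ≤ vol G A ∧ (A.Nonempty → ∃ v ∈ A, u v = c) := by
  rcases A.eq_empty_or_nonempty with rfl | hne
  · exact ⟨0, by simp⟩
  -- The candidates are the vertices with at most half of the volume strictly below them; the median
  -- is the largest value among them.
  · set T := A.filter (fun x => 2 * vol G (A.filter (fun v => u v < u x)) ≤ vol G A) with hT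
    have hTne : T.Nonempty := by
      obtain ⟨x, hx, hmin⟩ := A.exists_min_image u hne
      refine ⟨x, Finset.mem_filter.2 ⟨hx, ?_⟩⟩
      have : A.filter (fun v => u v < u x) = ∅ :=
        Finset.filter_eq_empty_iff.2 fun v hv => not_lt.2 (hmin v hv)
      rw [this]; simp
    obtain ⟨x, hx, hmax⟩ := T.exists_max_image u hTne
    have hx' := Finset.mem_filter.1 hx
    refine ⟨u x, hx'.2, ?_, fun _ => ⟨x, hx'.1, rfl⟩⟩
    by_contra hc
    have hU : (A.filter (fun v => u x < u v)).Nonempty := by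
      by_contra h
      rw [Finset.not_nonempty_iff_eq_empty] at h
      rw [h] at hc
      simp at hc
    -- If more than half of the volume lay above `u x`, then at most half would lie below the next
    -- larger value `u y`, so `y` would be a candidate above `x`.
    obtain ⟨y, hy, hmin⟩ := (A.filter (fun v => u x < u v)).exists_min_image u hU
    have hy' := Finset.mem_filter.1 hy
    have h1 : Disjoint (A.filter (fun v => u v < u y)) (A.filter (fun v => u x < u v)) := by
      rw [Finset.disjoint_left]
      intro v hv hv'
      exact absurd (Finset.mem_filter.1 hv).2 (not_lt.2 (hmin v hv'))
    have h2 := vol_mono G (Finset.union_subset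
      (Finset.filter_subset (fun v => u v < u y) A) (Finset.filter_subset (fun v => u x < u v) A))
    rw [vol_union G h1] at h2
    have h3 : y ∈ T := Finset.mem_filter.2 ⟨hy'.1, by omega⟩
    exact absurd hy'.2 (not_lt.2 (hmax y h3))

/-- Every one-sided sweep cut has a large border, apart from what it shares with `S`. -/
def SweepExpands (G : SimpleGraph (Fin n)) [DecidableRel G.Adj] (A S : Finset (Fin n))
    (u : Fin n → ℝ) (γ : ℝ) : Prop :=
  ∀ P, IsLower u A P ∨ IsUpper u A P → 2 * vol G P ≤ vol G A →
    γ / 2 * vol G P ≤ bd G A P + γ * vol G (P ∩ S)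

lemma sweepExpands_none {A : Finset (Fin n)} {u : Fin n → ℝ} {γ τ : ℝ} (hγ : 0 < γ)
    (h : SweepSpec G A u γ τ none) : SweepExpands G A ∅ u γ := by
  intro P hP hvol
  have h1 := h P hP hvol
  have : 0 ≤ γ * vol G P := by positivity
  simp only [Finset.inter_empty, vol_empty, Nat.cast_zero, mul_zero, add_zero]
  linarith

lemma IsLower.union {A P Q : Finset (Fin n)} {u : Fin n → ℝ} (hP : IsLower u A P)
    (hQ : IsLower u A Q) : IsLower u A (P ∪ Q) := by
  refine ⟨Finset.union_subset hP.1 hQ.1, fun v hv w hw h => ?_⟩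
  rcases Finset.mem_union.1 hv with hv | hv
  · exact Finset.mem_union_left _ (hP.2 v hv w hw h)
  · exact Finset.mem_union_right _ (hQ.2 v hv w hw h)

lemma IsUpper.union {A P Q : Finset (Fin n)} {u : Fin n → ℝ} (hP : IsUpper u A P)
    (hQ : IsUpper u A Q) : IsUpper u A (P ∪ Q) := by
  refine ⟨Finset.union_subset hP.1 hQ.1, fun v hv w hw h => ?_⟩
  rcases Finset.mem_union.1 hv with hv | hv
  · exact Finset.mem_union_left _ (hP.2 v hv w hw h)
  · exact Finset.mem_union_right _ (hQ.2 v hv w hw h)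

lemma isLower_empty (A : Finset (Fin n)) (u : Fin n → ℝ) : IsLower u A ∅ := by simp [IsLower]
lemma isUpper_empty (A : Finset (Fin n)) (u : Fin n → ℝ) : IsUpper u A ∅ := by simp [IsUpper]

/-- Suppose a sweep set `P` violates the bound. It is sparse and two-ended, so its volume is at most
that of `S` by maximality. Submodularity makes `P ∪ S` sparse as well; it is two-ended, and its
volume is at most twice that of `S`, hence at most half of `A`. Maximality then shows that `P` adds
no volume to `S`, so its overlap with `S` alone already satisfies the bound. -/
lemma sweepExpands_some {A : Finset (Fin n)} {u : Fin n → ℝ} {γ τ x : ℝ} {S : Fin n → Bool}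
    (hγ : 0 < γ) (h : SweepSpec G A u γ τ (some (S, x))) (hx : x < τ)
    (hsmall : 4 * vol G (supp S) ≤ vol G A) : SweepExpands G A (supp S) u γ := by
  obtain ⟨hSA, -, -, hcut, hmax⟩ := h
  obtain ⟨⟨L, U, hL, hU, hLU⟩, hmax⟩ := hmax hx
  intro P hP hvol
  by_contra hc
  rw [not_le] at hc
  have hPA : P ⊆ A := by rcases hP with h | h <;> exact h.1
  have h0 : (0 : ℝ) ≤ γ * vol G (P ∩ supp S) := by positivity
  have h00 : (0 : ℝ) ≤ γ * vol G P := by positivity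
  have hP2 : IsTwoEnded u A P := by
    rcases hP with h | h
    · exact ⟨P, ∅, h, isUpper_empty A u, by simp⟩
    · exact ⟨∅, P, isLower_empty A u, h, by simp⟩
  have hPS : IsTwoEnded u A (P ∪ supp S) := by
    rcases hP with h | h
    · exact ⟨P ∪ L, U, h.union hL, hU, by rw [hLU, Finset.union_assoc]⟩
    · exact ⟨L, P ∪ U, hL, h.union hU, by rw [hLU, Finset.union_left_comm]⟩
  have hle : vol G P ≤ vol G (supp S) := hmax P hP2 hvol (by linarith)
  have hmod := vol_union_add_inter G P (supp S)
  have hbd := bd_submodular G hPA hSA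
  have hmod' : (vol G (P ∪ supp S) : ℝ) + vol G (P ∩ supp S) = vol G P + vol G (supp S) := by
    exact_mod_cast hmod
  have hbdI := bd_nonneg G A (P ∩ supp S)
  -- The overlap term in the violated inequality is exactly what pays for counting `P ∩ S` only once
  -- in the volume of the union.
  have h1 : bd G A (P ∪ supp S) < γ * vol G (P ∪ supp S) := by
    have e : γ * vol G (P ∪ supp S) = γ * vol G P + γ * vol G (supp S) -
        γ * vol G (P ∩ supp S) := by rw [← mul_add, ← hmod']; ring
    linarith
  have h2 := hmax _ hPS (by omega) h1
  have h3 : vol G P ≤ vol G (P ∩ supp S) := by omega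
  have h4 : γ * (vol G P : ℝ) ≤ γ * vol G (P ∩ supp S) := by gcongr
  have := bd_nonneg G A P
  linarith

/-- A pair on one side of `c` contributes to one part only. For a pair separated by `c`, the
difference splits into two non-negative summands, and the sum of their squares is at most the square
of their sum. -/
lemma energy_posPart (A : Finset (Fin n)) (u : Fin n → ℝ) (c : ℝ) :
    energy G A (fun v => max (c - u v) 0) + energy G A (fun v => max (u v - c) 0) ≤
      energy G A u := by
  simp only [energy, ← Finset.sum_add_distrib]
  refine Finset.sum_le_sum fun v _ => Finset.sum_le_sum fun w _ => ?_
  by_cases h : G.Adj v w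
  · simp only [h, if_true, Real.norm_eq_abs, sq_abs]
    rcases le_total (u v) c with h1 | h1 <;> rcases le_total (u w) c with h2 | h2
    · rw [max_eq_left (by linarith), max_eq_left (by linarith), max_eq_right (by linarith),
        max_eq_right (by linarith)]; nlinarith
    · rw [max_eq_left (by linarith), max_eq_right (by linarith), max_eq_right (by linarith),
        max_eq_left (by linarith)]; nlinarith
    · rw [max_eq_right (by linarith), max_eq_left (by linarith), max_eq_left (by linarith),
        max_eq_right (by linarith)]; nlinarith
    · rw [max_eq_right (by linarith), max_eq_right (by linarith), max_eq_left (by linarith),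
        max_eq_left (by linarith)]; nlinarith
  · simp [h]

lemma sqSum_posPart (A : Finset (Fin n)) (u : Fin n → ℝ) (c : ℝ) :
    sqSum G A (fun v => max (c - u v) 0) + sqSum G A (fun v => max (u v - c) 0) =
      sqSum G A (fun v => u v - c) := by
  simp only [sqSum, ← Finset.sum_add_distrib]
  refine Finset.sum_congr rfl fun v _ => ?_
  simp only [Real.norm_eq_abs, sq_abs]
  rcases le_total (u v) c with h1 | h1
  · rw [max_eq_left (by linarith), max_eq_right (by linarith)]; ring
  · rw [max_eq_right (by linarith), max_eq_left (by linarith)]; ring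

/-- `cheeger` is applied to the parts of `u` below and above the median `c`. Their level sets are
lower and upper sets inside `{u < c}` and `{c < u}`, hence sweep sets with at most half of the
volume. -/
lemma sqSum_median_le {A S : Finset (Fin n)} (hS : S ⊆ A) {u : Fin n → ℝ} {γ : ℝ} (hγ : 0 < γ)
    (hexp : SweepExpands G A S u γ) {c : ℝ}
    (h1 : 2 * vol G (A.filter (fun v => u v < c)) ≤ vol G A)
    (h2 : 2 * vol G (A.filter (fun v => c < u v)) ≤ vol G A) :
    sqSum G A (fun v => u v - c) ≤
      4 / γ ^ 2 * energy G A u + 4 * sqSum G S (fun v => u v - c) := by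
  have hl := cheeger (G := G) hS hγ (g := fun v => max (c - u v) 0) (fun v => le_max_right _ _) ?_
  · have hr := cheeger (G := G) hS hγ (g := fun v => max (u v - c) 0) (fun v => le_max_right _ _) ?_
    · have h3 := energy_posPart (G := G) A u c
      have h4 : 0 ≤ 4 / γ ^ 2 := by positivity
      have h5 := mul_le_mul_of_nonneg_left h3 h4
      rw [← sqSum_posPart (G := G) A u c, ← sqSum_posPart (G := G) S u c]
      linarith
    · intro s hs
      refine hexp _ (Or.inr ⟨Finset.filter_subset _ _, fun v hv w hw hvw => ?_⟩) ?_
      · rw [Finset.mem_filter] at hv ⊢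
        refine ⟨hw, hv.2.trans_le ?_⟩
        exact pow_le_pow_left₀ (le_max_right _ _) (max_le_max (by linarith) le_rfl) 2
      · refine le_trans (Nat.mul_le_mul_left 2 (vol_mono G ?_)) h2
        intro v hv
        rw [Finset.mem_filter] at hv ⊢
        refine ⟨hv.1, ?_⟩
        by_contra hc
        have h3 := hv.2
        rw [max_eq_right (by linarith)] at h3
        simp at h3
        linarith
  · intro s hs
    refine hexp _ (Or.inl ⟨Finset.filter_subset _ _, fun v hv w hw hvw => ?_⟩) ?_
    · rw [Finset.mem_filter] at hv ⊢
      refine ⟨hw, hv.2.trans_le ?_⟩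
      exact pow_le_pow_left₀ (le_max_right _ _) (max_le_max (by linarith) le_rfl) 2
    · refine le_trans (Nat.mul_le_mul_left 2 (vol_mono G ?_)) h1
      intro v hv
      rw [Finset.mem_filter] at hv ⊢
      refine ⟨hv.1, ?_⟩
      by_contra hc
      have h3 := hv.2
      rw [max_eq_right (by linarith)] at h3
      simp at h3
      linarith

end Cheeger

/-! ### The drop of the potential in one round -/

section Drop

variable {n : ℕ} {G : SimpleGraph (Fin n)} [DecidableRel G.Adj]

/-- On at least half of the volume `u` lies on the far side of `c` as seen from 0, so `c ^ 2 ≤ u ^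
2` there. -/
lemma median_sq_le {A : Finset (Fin n)} {u : Fin n → ℝ} {c : ℝ}
    (h1 : 2 * vol G (A.filter (fun v => u v < c)) ≤ vol G A)
    (h2 : 2 * vol G (A.filter (fun v => c < u v)) ≤ vol G A) :
    vol G A * c ^ 2 ≤ 2 * sqSum G A u := by
  have key : ∀ (p : Fin n → Prop) [DecidablePred p], 2 * vol G (A.filter p) ≤ vol G A →
      (∀ v, ¬ p v → c ^ 2 ≤ u v ^ 2) → vol G A * c ^ 2 ≤ 2 * sqSum G A u := by
    intro p _ hp hc
    have h3 : vol G (A.filter p) + vol G (A.filter (fun v => ¬ p v)) = vol G A :=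
      Finset.sum_filter_add_sum_filter_not _ _ _
    have h4 : vol G (A.filter (fun v => ¬ p v)) * c ^ 2 ≤ sqSum G A u := by
      rw [cast_vol, Finset.sum_mul]
      refine (Finset.sum_le_sum fun v hv => ?_).trans
        (Finset.sum_le_sum_of_subset_of_nonneg (Finset.filter_subset (fun v => ¬ p v) A)
          fun v _ _ => by positivity)
      rw [Real.norm_eq_abs, sq_abs]
      exact mul_le_mul_of_nonneg_left (hc v (Finset.mem_filter.1 hv).2) (Nat.cast_nonneg _)
    have h5 : (vol G A : ℝ) ≤ 2 * vol G (A.filter (fun v => ¬ p v)) := by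
      exact_mod_cast (by omega : vol G A ≤ 2 * vol G (A.filter (fun v => ¬ p v)))
    nlinarith [sq_nonneg c]
  rcases le_total 0 c with hc | hc
  · exact key _ h1 fun v hv => by nlinarith
  · exact key _ h2 fun v hv => by nlinarith

/-- Passing from the median `c` back to the mean costs `8 * (vol S * c ^ 2)`. By `median_sq_le` and
the factor 32 in the size of `S`, this is at most half of the left side and can be absorbed, which
doubles the constants. -/
lemma sqSum_centered_le {A S : Finset (Fin n)} (hA : 0 < vol G A) (hS : S ⊆ A) {u : Fin n → ℝ}
    {γ : ℝ} (hγ : 0 < γ) (hexp : SweepExpands G A S u γ) (hmean : mean G A u = 0)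
    (hsmall : 32 * vol G S ≤ vol G A) :
    sqSum G A u ≤ 8 / γ ^ 2 * energy G A u + 16 * sqSum G S u := by
  obtain ⟨c, h1, h2, -⟩ := exists_median (G := G) A u
  have h3 := sqSum_median_le hS hγ hexp h1 h2
  have h4 := median_sq_le h1 h2
  have h5 := sqSum_sub_const hA u c
  have h6 : pot G A u = sqSum G A u := by simp [pot, hmean]
  have h7 : sqSum G S (fun v => u v - c) ≤ 2 * sqSum G S u + 2 * (vol G S * c ^ 2) := by
    rw [cast_vol, sqSum, sqSum, Finset.mul_sum, Finset.sum_mul, Finset.mul_sum,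
      ← Finset.sum_add_distrib]
    refine Finset.sum_le_sum fun v _ => ?_
    simp only [Real.norm_eq_abs, sq_abs]
    have : (0 : ℝ) ≤ G.degree v * (u v + c) ^ 2 := by positivity
    nlinarith
  have h8 : 32 * ((vol G S : ℝ) * c ^ 2) ≤ vol G A * c ^ 2 := by
    rw [← mul_assoc]
    exact mul_le_mul_of_nonneg_right (by exact_mod_cast hsmall) (sq_nonneg c)
  have h9 : (0 : ℝ) ≤ vol G A * ‖mean G A u - c‖ ^ 2 := by positivity
  have e : 8 / γ ^ 2 * energy G A u = 2 * (4 / γ ^ 2 * energy G A u) := by ring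
  rw [e]
  linarith

/-- The set `S` is discarded after the walk step, so its share must be measured in the new values.
The old values on `S` are controlled by the new ones plus the displacement, and the displacement by
a quarter of the energy. The hypothesis `γ ≤ 1` keeps the coefficient of the share of `S` bounded.
-/
lemma scalar_drop (hdeg : ∀ v, 0 < G.degree v) {A : Fin n → Bool} {S : Finset (Fin n)}
    (hA : 0 < vol G (supp A)) (hS : S ⊆ supp A) {u : Fin n → ℝ} {γ : ℝ} (hγ : 0 < γ)
    (hγ1 : γ ≤ 1) (hexp : SweepExpands G (supp A) S u γ) (hmean : mean G (supp A) u = 0)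
    (hsmall : 32 * vol G S ≤ vol G (supp A)) :
    γ ^ 2 / 64 * sqSum G (supp A) u ≤
      1 / 4 * energy G (supp A) u + sqSum G S (walk G A u) := by
  have h1 := sqSum_centered_le hA hS hγ hexp hmean hsmall
  have h2 : 1 / 2 * sqSum G S u ≤ sqSum G S (walk G A u) +
      sqSum G S (fun v => walk G A u v - u v) := by
    rw [sqSum, sqSum, sqSum, Finset.mul_sum, ← Finset.sum_add_distrib]
    refine Finset.sum_le_sum fun v _ => ?_
    simp only [Real.norm_eq_abs, sq_abs]
    have : (0 : ℝ) ≤ G.degree v * (2 * walk G A u v - u v) ^ 2 := by positivity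
    nlinarith
  have h3 : sqSum G S (fun v => walk G A u v - u v) ≤ 1 / 4 * energy G (supp A) u :=
    (Finset.sum_le_sum_of_subset_of_nonneg hS fun v _ _ => by positivity).trans
      (sqSum_walk_sub_le hdeg A u)
  have h4 := sqSum_nonneg G S (walk G A u)
  have h5 := sqSum_nonneg G S u
  have h6 := energy_nonneg G (supp A) u
  have h7 : γ ^ 2 / 64 * sqSum G (supp A) u ≤
      γ ^ 2 / 64 * (8 / γ ^ 2 * energy G (supp A) u + 16 * sqSum G S u) := by gcongr
  have e : γ ^ 2 / 64 * (8 / γ ^ 2 * energy G (supp A) u + 16 * sqSum G S u) =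
      1 / 8 * energy G (supp A) u + γ ^ 2 * (1 / 4 * sqSum G S u) := by field_simp; ring
  have h8 : γ ^ 2 ≤ 1 := pow_le_one₀ hγ.le hγ1
  have h9 : γ ^ 2 * (1 / 4 * sqSum G S u) ≤ 1 * (1 / 4 * sqSum G S u) := by gcongr
  linarith

variable {E : Type*} [NormedAddCommGroup E] [InnerProductSpace ℝ E]

/-- The random direction `r` stretches no relevant vector by more than `η`. -/
def GoodDirection (G : SimpleGraph (Fin n)) [DecidableRel G.Adj] (A : Fin n → Bool)
    (p : Fin n → E) (η : ℝ) (r : E) : Prop :=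
  (∀ v w, inner ℝ r (p v - p w) ^ 2 ≤ η * ‖p v - p w‖ ^ 2) ∧
    (∀ v, inner ℝ r (walk G A p v - mean G (supp A) p) ^ 2 ≤
      η * ‖walk G A p v - mean G (supp A) p‖ ^ 2) ∧
    ∀ v, inner ℝ r (p v - mean G (supp A) p) ^ 2 ≤ η * ‖p v - mean G (supp A) p‖ ^ 2

/-- The projection of the centered vectors to `r`. -/
def centered (G : SimpleGraph (Fin n)) [DecidableRel G.Adj] (A : Fin n → Bool) (p : Fin n → E)
    (r : E) (v : Fin n) : ℝ :=
  inner ℝ r (p v - mean G (supp A) p)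

lemma mean_centered {A : Fin n → Bool} (hA : 0 < vol G (supp A)) (p : Fin n → E) (r : E) :
    mean G (supp A) (centered G A p r) = 0 := by
  have h : ∑ v ∈ supp A, (G.degree v : ℝ) • centered G A p r v =
      inner ℝ r (∑ v ∈ supp A, (G.degree v : ℝ) • (p v - mean G (supp A) p)) := by
    rw [inner_sum]
    refine Finset.sum_congr rfl fun v _ => ?_
    rw [inner_smul_right, centered, smul_eq_mul]
  rw [mean, h, sum_degree_smul_sub_mean hA, inner_zero_right, smul_zero]

/-- For a good direction, energy and share of `S` of the projection are at most `η` times those of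
the vectors, so the scalar estimate lifts to the potential with a loss of `η`. -/
lemma pot_drop (hdeg : ∀ v, 0 < G.degree v) {A : Fin n → Bool} {S : Finset (Fin n)}
    (hA : 0 < vol G (supp A)) (hAS : 0 < vol G (supp A \ S)) (hS : S ⊆ supp A)
    {p : Fin n → E} {r : E} {γ η : ℝ} (hγ : 0 < γ) (hγ1 : γ ≤ 1) (hη : 0 < η)
    (hexp : SweepExpands G (supp A) S (fun v => inner ℝ r (p v)) γ)
    (hsmall : 32 * vol G S ≤ vol G (supp A)) (hr : GoodDirection G A p η r) :
    pot G (supp A \ S) (walk G A p) ≤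
      pot G (supp A) p - γ ^ 2 / (64 * η) * sqSum G (supp A) (centered G A p r) := by
  have h1 := pot_walk_le hdeg hS hAS p
  set q : Fin n → E := fun v => p v - mean G (supp A) p with hq
  have hu : centered G A p r = fun v => inner ℝ r (p v) - inner ℝ r (mean G (supp A) p) := by
    funext v; rw [centered, inner_sub_right]
  have hexp' : SweepExpands G (supp A) S (centered G A p r) γ := by
    rw [hu]
    intro P hP
    rw [isLower_sub_const, isUpper_sub_const] at hP
    exact hexp P hP
  have h2 := scalar_drop hdeg hA hS hγ hγ1 hexp' (mean_centered hA p r) hsmall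
  have h3 : energy G (supp A) (centered G A p r) ≤ η * energy G (supp A) q := by
    rw [energy, energy, Finset.mul_sum]
    refine Finset.sum_le_sum fun v _ => ?_
    rw [Finset.mul_sum]
    refine Finset.sum_le_sum fun w _ => ?_
    split_ifs
    · have e : q v - q w = p v - p w := by simp only [hq]; abel
      have e2 : centered G A p r v - centered G A p r w = inner ℝ r (p v - p w) := by
        simp only [hu, inner_sub_right]; ring
      rw [e, e2, Real.norm_eq_abs, sq_abs]
      exact hr.1 v w
    · simp
  have h4 : sqSum G S (walk G A (centered G A p r)) ≤ η * sqSum G S (walk G A q) := by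
    rw [sqSum, sqSum, Finset.mul_sum]
    refine Finset.sum_le_sum fun v _ => ?_
    have e : walk G A (centered G A p r) v = inner ℝ r (walk G A q v) :=
      (map_walk G (innerₛₗ ℝ r) A q v).symm
    rw [e, hq, walk_sub_const hdeg, Real.norm_eq_abs, sq_abs, mul_left_comm]
    exact mul_le_mul_of_nonneg_left (hr.2.1 v) (Nat.cast_nonneg _)
  have h5 : γ ^ 2 / (64 * η) * sqSum G (supp A) (centered G A p r) ≤
      1 / 4 * energy G (supp A) q + sqSum G S (walk G A q) := by
    have h6 : γ ^ 2 / 64 * sqSum G (supp A) (centered G A p r) ≤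
        η * (1 / 4 * energy G (supp A) q + sqSum G S (walk G A q)) := by linarith
    have e : γ ^ 2 / (64 * η) * sqSum G (supp A) (centered G A p r) =
        (γ ^ 2 / 64 * sqSum G (supp A) (centered G A p r)) / η := by field_simp
    rw [e, div_le_iff₀ hη, mul_comm _ η]
    exact h6
  linarith

lemma pot_walk_le_pot (hdeg : ∀ v, 0 < G.degree v) {A : Fin n → Bool} {S : Finset (Fin n)}
    (hS : S ⊆ supp A) (hA : 0 < vol G (supp A \ S)) (p : Fin n → E) :
    pot G (supp A \ S) (walk G A p) ≤ pot G (supp A) p := by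
  have h1 := pot_walk_le hdeg hS hA p
  have h2 := energy_nonneg G (supp A) (fun v => p v - mean G (supp A) p)
  have h3 := sqSum_nonneg G S (walk G A (fun v => p v - mean G (supp A) p))
  linarith

end Drop

/-! ### Near expansion from a small potential -/

section NearExpander

variable {n : ℕ} {G : SimpleGraph (Fin n)} [DecidableRel G.Adj]

/-- The vectors whose projections are the walk vectors. -/
def rows (G : SimpleGraph (Fin n)) [DecidableRel G.Adj] (hist : List (Fin n → Bool)) :
    Fin n → EuclideanSpace ℝ (Fin n) :=
  walks G (fun v => (G.degree v : ℝ)⁻¹ • EuclideanSpace.single v (1 : ℝ)) hist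

lemma inner_rows (hist : List (Fin n → Bool)) (r : EuclideanSpace ℝ (Fin n)) (v : Fin n) :
    inner ℝ r (rows G hist v) = walks G (fun v => r v / (G.degree v : ℝ)) hist v := by
  have h := map_walks G (innerₛₗ ℝ r) hist
    (fun v => (G.degree v : ℝ)⁻¹ • EuclideanSpace.single v (1 : ℝ)) v
  rw [rows]
  refine Eq.trans h ?_
  congr 1
  funext v
  simp [EuclideanSpace.inner_single_right, div_eq_inv_mul]

lemma walkVector_eq_inner (hist : List (Fin n → Bool)) (r : EuclideanSpace ℝ (Fin n)) :
    (walkVector G hist (fun v => r v)).val = fun v => inner ℝ r (rows G hist v) := by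
  funext v; rw [walkVector_val, inner_rows]

lemma walk_mem_Icc (hdeg : ∀ v, 0 < G.degree v) (A : Fin n → Bool) {y : Fin n → ℝ}
    (hy : ∀ v, y v ∈ Set.Icc (0 : ℝ) 1) (v : Fin n) : walk G A y v ∈ Set.Icc (0 : ℝ) 1 := by
  by_cases hv : A v = true
  · have h := walk_of_mem hv (hdeg v) y 0
    rw [sub_zero] at h
    have hd : (0 : ℝ) < G.degree v := by exact_mod_cast hdeg v
    have hz : ∀ w, (if G.Adj v w then ((1 / 2 : ℝ) • (y v + if A w then y w else y v) - 0) else 0)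
        ∈ Set.Icc (0 : ℝ) (if G.Adj v w then 1 else 0) := by
      intro w
      have h1 := hy v
      have h2 := hy w
      simp only [Set.mem_Icc] at h1 h2 ⊢
      by_cases h : G.Adj v w <;> by_cases hw : A w = true <;> simp [h, hw] <;>
        constructor <;> linarith
    rw [h, smul_eq_mul]
    constructor
    · exact mul_nonneg (by positivity) (Finset.sum_nonneg fun w _ => (hz w).1)
    · rw [inv_mul_le_iff₀ hd, mul_one, cast_degree]
      exact Finset.sum_le_sum fun w _ => (hz w).2
  · simp only [walk, hv]
    exact hy v

/-- What leaves `X` in one walk step. -/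
lemma sum_walk_ge (hdeg : ∀ v, 0 < G.degree v) (A : Fin n → Bool) {y : Fin n → ℝ}
    (hy : ∀ v, y v ∈ Set.Icc (0 : ℝ) 1) (X : Finset (Fin n)) :
    ∑ v ∈ X, (G.degree v : ℝ) * y v - 1 / 2 * edges G X Xᶜ ≤
      ∑ v ∈ X, (G.degree v : ℝ) * walk G A y v := by
  have h1 : ∀ v, (G.degree v : ℝ) * walk G A y v = (G.degree v : ℝ) * y v +
      ∑ w, if G.Adj v w then (if A v = true ∧ A w = true then 1 / 2 * (y w - y v) else 0)
        else 0 := by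
    intro v
    by_cases hv : A v = true
    · have hd : (G.degree v : ℝ) ≠ 0 := by have := hdeg v; positivity
      have h := walk_of_mem hv (hdeg v) y 0
      rw [sub_zero] at h
      rw [h, smul_eq_mul, mul_inv_cancel_left₀ hd, cast_degree, Finset.sum_mul,
        ← Finset.sum_add_distrib]
      refine Finset.sum_congr rfl fun w _ => ?_
      by_cases h : G.Adj v w <;> by_cases hw : A w = true <;> simp [h, hw, hv] <;> ring
    · simp [walk, hv]
  set F : Fin n → Fin n → ℝ := fun v w =>
    if G.Adj v w then (if A v = true ∧ A w = true then 1 / 2 * (y w - y v) else 0) else 0 with hF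
  have hanti : ∀ v w, F v w = -F w v := by
    intro v w
    simp only [hF]
    by_cases h : G.Adj v w
    · by_cases hA : A v = true ∧ A w = true
      · simp [h, h.symm, hA]; ring
      · have hA' : ¬ (A w = true ∧ A v = true) := fun hc => hA ⟨hc.2, hc.1⟩
        rw [if_pos h, if_pos h.symm, if_neg hA, if_neg hA', neg_zero]
    · have h' : ¬ G.Adj w v := fun hc => h hc.symm
      simp [h, h']
  -- The flow `F` along edges is antisymmetric, so what moves inside `X` cancels. Only edges leaving
  -- `X` count, and each carries at most `1/2`.
  have hXX : ∑ v ∈ X, ∑ w ∈ X, F v w = 0 := by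
    have : ∑ v ∈ X, ∑ w ∈ X, F v w = -∑ v ∈ X, ∑ w ∈ X, F v w := by
      conv_lhs => rw [Finset.sum_comm]
      simp only [← Finset.sum_neg_distrib]
      exact Finset.sum_congr rfl fun v _ => Finset.sum_congr rfl fun w _ => hanti w v
    linarith
  have hF2 : ∀ v w, -(1 / 2 * (if G.Adj v w then (1 : ℝ) else 0)) ≤ F v w := by
    intro v w
    simp only [hF]
    have h2 := (hy v).2
    have h3 := (hy w).1
    split_ifs <;> linarith
  have h2 : ∑ v ∈ X, (G.degree v : ℝ) * walk G A y v = ∑ v ∈ X, (G.degree v : ℝ) * y v +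
      ∑ v ∈ X, ∑ w ∈ Xᶜ, F v w := by
    simp only [h1, Finset.sum_add_distrib]
    congr 1
    have : ∀ v, ∑ w, F v w = ∑ w ∈ X, F v w + ∑ w ∈ Xᶜ, F v w := fun v =>
      (Finset.sum_add_sum_compl X _).symm
    change ∑ v ∈ X, ∑ w, F v w = _
    simp only [this, Finset.sum_add_distrib, hXX, zero_add]
  have h3 : -(1 / 2 * edges G X Xᶜ) ≤ ∑ v ∈ X, ∑ w ∈ Xᶜ, F v w := by
    rw [edges, Finset.mul_sum, ← Finset.sum_neg_distrib]
    refine Finset.sum_le_sum fun v _ => ?_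
    rw [Finset.mul_sum, ← Finset.sum_neg_distrib]
    exact Finset.sum_le_sum fun w _ => hF2 v w
  linarith

/-- By induction, `X` loses at most half of its border per step, while the total degree-weighted
mass does not grow. -/
lemma walks_indicator (hdeg : ∀ v, 0 < G.degree v) (hist : List (Fin n → Bool))
    (X : Finset (Fin n)) :
    (∀ v, walks G (fun v => if v ∈ X then (1 : ℝ) else 0) hist v ∈ Set.Icc (0 : ℝ) 1) ∧
    vol G X - hist.length * (1 / 2 * edges G X Xᶜ) ≤
      ∑ v ∈ X, (G.degree v : ℝ) * walks G (fun v => if v ∈ X then (1 : ℝ) else 0) hist v ∧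
    ∑ v, (G.degree v : ℝ) * walks G (fun v => if v ∈ X then (1 : ℝ) else 0) hist v ≤ vol G X := by
  induction hist with
  | nil =>
    refine ⟨fun v => ?_, ?_, ?_⟩
    · simp only [walks]; split_ifs <;> simp
    · rw [cast_vol]
      simp [walks]
    · rw [cast_vol]
      simp [walks]
  | cons A hist ih =>
    obtain ⟨h1, h2, h3⟩ := ih
    refine ⟨fun v => walk_mem_Icc hdeg A h1 v, ?_, ?_⟩
    · have h4 := sum_walk_ge hdeg A h1 X
      simp only [walks, List.length_cons]
      push_cast
      linarith
    · have h4 : ∀ v, walk G A (fun v => 1 - walks G (fun v => if v ∈ X then (1 : ℝ) else 0) hist v) v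
          ∈ Set.Icc (0 : ℝ) 1 := walk_mem_Icc hdeg A fun v => by
        have := h1 v
        simp only [Set.mem_Icc] at this ⊢
        constructor <;> linarith
      -- The upper bound on the total mass is the lower bound for the complementary values `1 - y`
      -- on the whole vertex set, which has no border.
      have h5 := sum_walk_ge hdeg A (y := fun v =>
          1 - walks G (fun v => if v ∈ X then (1 : ℝ) else 0) hist v) (fun v => by
        have := h1 v
        simp only [Set.mem_Icc] at this ⊢
        constructor <;> linarith) Finset.univ
      have h6 : ∀ v, walk G A (fun v =>
          1 - walks G (fun v => if v ∈ X then (1 : ℝ) else 0) hist v) v =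
          1 - walk G A (walks G (fun v => if v ∈ X then (1 : ℝ) else 0) hist) v := by
        intro v
        have e1 : (fun v => 1 - walks G (fun v => if v ∈ X then (1 : ℝ) else 0) hist v) =
          fun v => (-(walks G (fun v => if v ∈ X then (1 : ℝ) else 0) hist v)) - (-1) := by
            funext v; ring
        have e2 : walk G A (fun v => -(walks G (fun v => if v ∈ X then (1 : ℝ) else 0) hist v)) v =
            -walk G A (walks G (fun v => if v ∈ X then (1 : ℝ) else 0) hist) v :=
          (map_walk G (-LinearMap.id : ℝ →ₗ[ℝ] ℝ) A _ v).symm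
        rw [e1, walk_sub_const hdeg, e2]
        ring
      simp only [h6, mul_sub, mul_one, Finset.sum_sub_distrib, Finset.compl_univ,
        edges_empty_right, mul_zero, sub_zero] at h5
      simp only [walks]
      linarith

/-- A set on which the walk mixes well is a near expander. -/
lemma isNearExpander_of_pot (hdeg : ∀ v, 0 < G.degree v) {A : Finset (Fin n)}
    {hist : List (Fin n → Bool)} {φ : ℝ} (hφ : 0 < φ)
    (hlen : hist.length * φ * 60 ≤ 8)
    (hpot : pot G A (rows G hist) * (400 * (numEdges G : ℝ) ^ 2) ≤ 1) :
    IsNearExpander G (6 * φ) A := by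
  intro X hX hvol
  rcases X.eq_empty_or_nonempty with rfl | ⟨x, hx⟩
  · simp
  have hX1 : 1 ≤ vol G X := (hdeg x).trans_le (Finset.single_le_sum
    (f := fun v => G.degree v) (fun _ _ => Nat.zero_le _) hx)
  have hX1' : (1 : ℝ) ≤ vol G X := by exact_mod_cast hX1
  have hApos : 0 < vol G A := by have := vol_mono G hX; omega
  have hA' : (0 : ℝ) < vol G A := by exact_mod_cast hApos
  set y := walks G (fun v => if v ∈ X then (1 : ℝ) else 0) hist with hy
  obtain ⟨h1, h2, h3⟩ := walks_indicator hdeg hist X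
  rw [← hy] at h1 h2 h3
  -- The degree vector of `X`: dividing by degrees turns it into the indicator of `X`, so the walked
  -- indicator is the projection of the rows to `d`.
  set d : EuclideanSpace ℝ (Fin n) := ∑ v ∈ X, (G.degree v : ℝ) • EuclideanSpace.single v (1 : ℝ)
    with hd
  have hdv : ∀ v, d v = if v ∈ X then (G.degree v : ℝ) else 0 := by
    intro v
    simp [hd, Finset.sum_apply, Pi.single_apply]
  have hyd : ∀ v, y v = inner ℝ d (rows G hist v) := by
    intro v
    rw [inner_rows, hy]
    congr 1
    funext w
    rw [hdv]
    have : (G.degree w : ℝ) ≠ 0 := by have := hdeg w; positivity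
    split_ifs
    · rw [div_self this]
    · rw [zero_div]
  have hdnorm : ‖d‖ ≤ 2 * numEdges G := by
    refine (norm_sum_le _ _).trans ?_
    have h4 : ∀ v ∈ X, ‖(G.degree v : ℝ) • EuclideanSpace.single v (1 : ℝ)‖ ≤ G.degree v := by
      intro v _
      rw [norm_smul]
      simp
    refine (Finset.sum_le_sum h4).trans ?_
    rw [← cast_vol]
    have h5 := vol_mono G (Finset.subset_univ X)
    rw [vol_univ] at h5
    exact_mod_cast h5
  set μ := mean G A (rows G hist) with hμ
  set b := inner ℝ d μ with hb
  have hyb : ∀ v, y v - b = inner ℝ d (rows G hist v - μ) := by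
    intro v; rw [inner_sub_right, hyd]
  -- the mean
  have hmean : b * vol G A ≤ vol G X := by
    have h4 := sum_degree_smul_sub_mean hApos (rows G hist)
    have h5 : ∑ v ∈ A, (G.degree v : ℝ) * (y v - b) = 0 := by
      simp only [hyb, ← inner_smul_right_eq_smul, ← smul_eq_mul]
      rw [← inner_sum]
      rw [h4, inner_zero_right]
    have h6 : ∑ v ∈ A, (G.degree v : ℝ) * y v ≤ ∑ v, (G.degree v : ℝ) * y v :=
      Finset.sum_le_sum_of_subset_of_nonneg (Finset.subset_univ _) fun v _ _ =>
        mul_nonneg (Nat.cast_nonneg _) (h1 v).1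
    simp only [mul_sub, Finset.sum_sub_distrib, ← Finset.sum_mul, ← cast_vol] at h5
    linarith
  have hb2 : b ≤ 1 / 2 := by
    by_contra hc
    rw [not_le] at hc
    have := mul_lt_mul_of_pos_right hc hA'
    linarith
  -- the deviation
  have hdev : ∑ v ∈ X, (G.degree v : ℝ) * (y v - b) ^ 2 ≤ 1 / 100 := by
    have h4 : ∑ v ∈ X, (G.degree v : ℝ) * (y v - b) ^ 2 ≤
        ‖d‖ ^ 2 * pot G A (rows G hist) := by
      rw [pot, sqSum, Finset.mul_sum]
      refine (Finset.sum_le_sum fun v _ => ?_).trans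
        (Finset.sum_le_sum_of_subset_of_nonneg hX fun v _ _ => by positivity)
      rw [hyb, mul_left_comm]
      refine mul_le_mul_of_nonneg_left ?_ (Nat.cast_nonneg _)
      rw [← mul_pow, ← sq_abs]
      exact pow_le_pow_left₀ (abs_nonneg _) (abs_real_inner_le_norm _ _) 2
    have h5 : ‖d‖ ^ 2 ≤ (2 * numEdges G) ^ 2 := pow_le_pow_left₀ (norm_nonneg _) hdnorm 2
    have h6 := mul_le_mul_of_nonneg_right h5 (pot_nonneg (G := G) A (rows G hist))
    linarith
  have hsum : ∑ v ∈ X, (G.degree v : ℝ) * y v ≤ 6 / 10 * vol G X := by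
    -- Here `z ≤ 1/20 + 5 z²` is used for `z = y v - b`. The squares contribute at most `5/100 ≤ vol
    -- X / 20`, and `1/2 + 1/20 + 1/20 = 6/10`.
    have h4 : ∀ v ∈ X, (G.degree v : ℝ) * y v ≤ (G.degree v : ℝ) * b +
        ((G.degree v : ℝ) * (1 / 20) + 5 * ((G.degree v : ℝ) * (y v - b) ^ 2)) := by
      intro v _
      have : (0 : ℝ) ≤ G.degree v * (y v - b - 1 / 10) ^ 2 := by positivity
      nlinarith
    have h5 := Finset.sum_le_sum h4
    simp only [Finset.sum_add_distrib, ← Finset.sum_mul, ← Finset.mul_sum, ← cast_vol] at h5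
    have h6 : (vol G X : ℝ) * b ≤ vol G X * (1 / 2) := by gcongr
    linarith
  rw [border_eq]
  -- At least `4/10` of the volume of `X` has left, at a rate of at most half of the border per
  -- step.
  have h7 : (8 / 10 : ℝ) * vol G X ≤ hist.length * edges G X Xᶜ := by linarith
  have h8 := edges_nonneg G X Xᶜ
  have h9 : (hist.length * φ * 60) * edges G X Xᶜ ≤ 8 * edges G X Xᶜ := by gcongr
  have h10 : (8 / 10 * (vol G X : ℝ)) * (60 * φ) ≤ (hist.length * edges G X Xᶜ) * (60 * φ) := by
    gcongr
  linarith

end NearExpander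

/-! ### The uniform distribution on the sphere -/

section Sphere

open scoped Pointwise
open Metric

variable {n : ℕ}

/-- The open cone over a set on the sphere. -/
def cone (S : Set (UnitSphere n)) : Set (EuclideanSpace ℝ (Fin n)) :=
  Set.Ioo (0 : ℝ) 1 • (((↑) : UnitSphere n → EuclideanSpace ℝ (Fin n)) '' S)

lemma mem_cone {S : Set (UnitSphere n)} {x : EuclideanSpace ℝ (Fin n)} :
    x ∈ cone S ↔ ∃ t : ℝ, 0 < t ∧ t < 1 ∧ ∃ y ∈ S, t • (y : EuclideanSpace ℝ (Fin n)) = x := by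
  simp only [cone, Set.mem_smul, Set.mem_Ioo, Set.mem_image]
  constructor
  · rintro ⟨t, ⟨h1, h2⟩, _, ⟨y, hy, rfl⟩, h⟩
    exact ⟨t, h1, h2, y, hy, h⟩
  · rintro ⟨t, h1, h2, y, hy, h⟩
    exact ⟨t, ⟨h1, h2⟩, _, ⟨y, hy, rfl⟩, h⟩

/-- The surface measure of a set is `n` times the volume of the cone over it, and the factor cancels
in the normalisation. Estimates on the sphere thus become estimates of volumes. -/
lemma uniformSphere_apply (hn : 0 < n) {S : Set (UnitSphere n)} (hS : MeasurableSet S) :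
    uniformSphere n S = volume (cone S) / volume (ball (0 : EuclideanSpace ℝ (Fin n)) 1) := by
  have hn' : (n : ENNReal) ≠ 0 := by simpa using hn.ne'
  have hn'' : (n : ENNReal) ≠ ⊤ := ENNReal.natCast_ne_top n
  rw [uniformSphere, Measure.smul_apply, Measure.toSphere_apply' _ hS,
    Measure.toSphere_apply_univ, finrank_euclideanSpace_fin, smul_eq_mul, mul_comm,
    ← div_eq_mul_inv]
  exact ENNReal.mul_div_mul_left _ _ hn' hn''

lemma isProbabilityMeasure_uniformSphere (hn : 0 < n) :
    IsProbabilityMeasure (uniformSphere n) := by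
  have : Nonempty (Fin n) := ⟨⟨0, hn⟩⟩
  constructor
  rw [uniformSphere, Measure.smul_apply, smul_eq_mul]
  refine ENNReal.inv_mul_cancel ?_ (measure_ne_top _ _)
  rw [Measure.measure_univ_ne_zero]
  exact Measure.toSphere_ne_zero _

lemma uniformSphere_le_of_cone_subset (hn : 0 < n) {S : Set (UnitSphere n)}
    (hS : MeasurableSet S) {x : EuclideanSpace ℝ (Fin n)} {ρ : ℝ} (hρ : 0 ≤ ρ)
    (h : cone S ⊆ closedBall x ρ) : uniformSphere n S ≤ ENNReal.ofReal (ρ ^ n) := by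
  rw [uniformSphere_apply hn hS]
  have h1 := measure_mono (μ := volume) h
  rw [Measure.addHaar_closedBall _ _ hρ, finrank_euclideanSpace_fin] at h1
  exact ENNReal.div_le_of_le_mul h1

lemma measurable_inner_sphere (a : EuclideanSpace ℝ (Fin n)) :
    Measurable (fun y : UnitSphere n => inner ℝ (y : EuclideanSpace ℝ (Fin n)) a) :=
  (Continuous.inner continuous_subtype_val continuous_const).measurable

/-- The cone over the cap lies in the ball around `s • a` of radius `√(1 - s²)`: the squared
distance of `t • y` from the centre is at most `t² - 2ts² + s²`, which is convex in `t` and at most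
`1 - s²` at both ends of `[0, 1]`, at `t = 0` because `s² ≤ 1/2`. -/
lemma uniformSphere_cap_le (hn : 0 < n) {a : EuclideanSpace ℝ (Fin n)} (ha : ‖a‖ = 1) {s : ℝ}
    (hs : 0 < s) (hs2 : s ^ 2 ≤ 1 / 2) :
    uniformSphere n {y | s < inner ℝ (y : EuclideanSpace ℝ (Fin n)) a} ≤
      ENNReal.ofReal (√(1 - s ^ 2) ^ n) := by
  refine uniformSphere_le_of_cone_subset hn
    (measurableSet_lt measurable_const (measurable_inner_sphere a)) (Real.sqrt_nonneg _)
    (x := s • a) ?_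
  intro x hx
  obtain ⟨t, h1, h2, y, hy, rfl⟩ := mem_cone.1 hx
  have hy' : s < inner ℝ (y : EuclideanSpace ℝ (Fin n)) a := hy
  have hny : ‖(y : EuclideanSpace ℝ (Fin n))‖ = 1 := by simp
  rw [mem_closedBall, dist_eq_norm]
  apply Real.le_sqrt_of_sq_le
  rw [norm_sub_sq_real, norm_smul, norm_smul, real_inner_smul_left, real_inner_smul_right, ha, hny,
    Real.norm_of_nonneg h1.le, Real.norm_of_nonneg hs.le]
  have h3 : t * (s * s) ≤ t * (s * inner ℝ (y : EuclideanSpace ℝ (Fin n)) a) := by gcongr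
  nlinarith [mul_pos h1 hs, mul_nonneg (sub_nonneg.2 h2.le) h1.le]

/-- After normalising `a`, the bad set is contained in two opposite caps of height `√η`, and `(1 -
η)^(n/2) ≤ exp (-η n / 2)`. -/
lemma uniformSphere_tail_le (hn : 0 < n) (a : EuclideanSpace ℝ (Fin n)) {η : ℝ} (hη : 0 < η)
    (hη2 : η ≤ 1 / 2) :
    uniformSphere n {y | ¬ inner ℝ (y : EuclideanSpace ℝ (Fin n)) a ^ 2 ≤ η * ‖a‖ ^ 2} ≤
      ENNReal.ofReal (2 * Real.exp (-(η * n / 2))) := by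
  rcases eq_or_ne a 0 with rfl | ha
  · simp
  have hna : 0 < ‖a‖ := norm_pos_iff.2 ha
  set b := ‖a‖⁻¹ • a with hb
  have hnb : ‖b‖ = 1 := by
    rw [hb, norm_smul, norm_inv, norm_norm, inv_mul_cancel₀ hna.ne']
  have hnb' : ‖-b‖ = 1 := by rw [norm_neg, hnb]
  have hab : a = ‖a‖ • b := by rw [hb, smul_smul, mul_inv_cancel₀ hna.ne', one_smul]
  have hs2 : √η ^ 2 = η := Real.sq_sqrt hη.le
  have hsub : {y : UnitSphere n | ¬ inner ℝ (y : EuclideanSpace ℝ (Fin n)) a ^ 2 ≤ η * ‖a‖ ^ 2} ⊆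
      {y | √η < inner ℝ (y : EuclideanSpace ℝ (Fin n)) b} ∪
      {y | √η < inner ℝ (y : EuclideanSpace ℝ (Fin n)) (-b)} := by
    intro y hy
    simp only [Set.mem_ofPred_eq, not_le, Set.mem_union, inner_neg_right] at hy ⊢
    have e : inner ℝ (y : EuclideanSpace ℝ (Fin n)) a =
        ‖a‖ * inner ℝ (y : EuclideanSpace ℝ (Fin n)) b := by
      conv_lhs => rw [hab]
      rw [inner_smul_right]
    rw [e, mul_pow, mul_comm] at hy
    have h1 := lt_of_mul_lt_mul_left hy (sq_nonneg ‖a‖)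
    rw [← hs2] at h1
    have h2 := sq_lt_sq.1 h1
    rw [abs_of_nonneg (Real.sqrt_nonneg η)] at h2
    rcases lt_abs.1 h2 with h | h
    · exact Or.inl h
    · exact Or.inr h
  have hexp : √(1 - √η ^ 2) ^ n ≤ Real.exp (-(η * n / 2)) := by
    rw [hs2]
    have h1 : √(1 - η) ≤ Real.exp (-(η / 2)) := by
      rw [Real.sqrt_le_left (Real.exp_pos _).le, ← Real.exp_nat_mul]
      have := Real.add_one_le_exp (-η)
      have e : ((2 : ℕ) : ℝ) * -(η / 2) = -η := by push_cast; ring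
      rw [e]; linarith
    calc √(1 - η) ^ n ≤ Real.exp (-(η / 2)) ^ n := by gcongr
      _ = Real.exp (-(η * n / 2)) := by rw [← Real.exp_nat_mul]; congr 1; ring
  have h1 := uniformSphere_cap_le hn hnb (Real.sqrt_pos.2 hη) (by rw [hs2]; exact hη2)
  have h2 := uniformSphere_cap_le hn hnb' (Real.sqrt_pos.2 hη) (by rw [hs2]; exact hη2)
  refine (measure_mono hsub).trans ((measure_union_le _ _).trans ((add_le_add h1 h2).trans ?_))
  rw [← ENNReal.ofReal_add (by positivity) (by positivity)]
  exact ENNReal.ofReal_le_ofReal (by linarith)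

/-- The cone lies in a proper linear subspace, which has volume zero. -/
lemma uniformSphere_hyperplane (hn : 0 < n) {a : EuclideanSpace ℝ (Fin n)} (ha : a ≠ 0) :
    uniformSphere n {y | inner ℝ (y : EuclideanSpace ℝ (Fin n)) a = 0} = 0 := by
  rw [uniformSphere_apply hn (measurableSet_eq_fun (measurable_inner_sphere a) measurable_const)]
  have h : volume (cone {y : UnitSphere n | inner ℝ (y : EuclideanSpace ℝ (Fin n)) a = 0}) = 0 := by
    refine measure_mono_null (t := ((ℝ ∙ a)ᗮ : Submodule ℝ (EuclideanSpace ℝ (Fin n)))) ?_ ?_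
    · intro x hx
      obtain ⟨t, -, -, y, hy, rfl⟩ := mem_cone.1 hx
      have hy' : inner ℝ (y : EuclideanSpace ℝ (Fin n)) a = 0 := hy
      rw [SetLike.mem_coe, Submodule.mem_orthogonal_singleton_iff_inner_left,
        real_inner_smul_left, hy', mul_zero]
    · refine Measure.addHaar_submodule _ _ fun h => ha ?_
      have h1 : a ∈ (ℝ ∙ a)ᗮ := by rw [h]; trivial
      rw [Submodule.mem_orthogonal_singleton_iff_inner_left] at h1
      exact inner_self_eq_zero.1 h1
  rw [h, ENNReal.zero_div]

/-- A linear isometry acts on the sphere. -/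
def sphereMap (L : EuclideanSpace ℝ (Fin n) ≃ₗᵢ[ℝ] EuclideanSpace ℝ (Fin n)) (y : UnitSphere n) :
    UnitSphere n :=
  ⟨L y, by simp [L.norm_map]⟩

lemma measurePreserving_sphereMap (hn : 0 < n)
    (L : EuclideanSpace ℝ (Fin n) ≃ₗᵢ[ℝ] EuclideanSpace ℝ (Fin n)) :
    MeasurePreserving (sphereMap L) (uniformSphere n) (uniformSphere n) := by
  have hm : Measurable (sphereMap L) :=
    ((L.continuous.comp continuous_subtype_val).subtype_mk _).measurable
  refine ⟨hm, Measure.ext fun S hS => ?_⟩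
  rw [Measure.map_apply hm hS, uniformSphere_apply hn (hm hS), uniformSphere_apply hn hS]
  congr 1
  have h : cone (sphereMap L ⁻¹' S) = L ⁻¹' cone S := by
    ext x
    rw [Set.mem_preimage, mem_cone, mem_cone]
    constructor
    · rintro ⟨t, h1, h2, y, hy, rfl⟩
      exact ⟨t, h1, h2, sphereMap L y, hy, by simp [sphereMap]⟩
    · rintro ⟨t, h1, h2, y, hy, h⟩
      refine ⟨t, h1, h2, sphereMap L.symm y, ?_, ?_⟩
      · have e : sphereMap L (sphereMap L.symm y) = y := Subtype.ext (by simp [sphereMap])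
        rw [Set.mem_preimage, e]
        exact hy
      · have e : L.symm (L x) = x := L.symm_apply_apply x
        rw [← e, ← h]
        simp [sphereMap]
  rw [h]
  exact L.measurePreserving.measure_preimage_equiv (f := L.toHomeomorph.toMeasurableEquiv) _

lemma integrable_inner_sq (hn : 0 < n) (a : EuclideanSpace ℝ (Fin n)) :
    Integrable (fun y : UnitSphere n => inner ℝ (y : EuclideanSpace ℝ (Fin n)) a ^ 2)
      (uniformSphere n) := by
  have := isProbabilityMeasure_uniformSphere hn
  refine Integrable.of_bound ((measurable_inner_sphere a).pow_const 2).aestronglyMeasurable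
    (‖a‖ ^ 2) (Filter.Eventually.of_forall fun y => ?_)
  have hny : ‖(y : EuclideanSpace ℝ (Fin n))‖ = 1 := by simp
  have h := abs_real_inner_le_norm (y : EuclideanSpace ℝ (Fin n)) a
  rw [hny, one_mul] at h
  rw [Real.norm_eq_abs, abs_pow]
  exact pow_le_pow_left₀ (abs_nonneg _) h 2

/-- The reflection in the hyperplane orthogonal to `a - b` maps `a` to `b` and preserves the uniform
distribution. -/
lemma integral_inner_sq_eq (hn : 0 < n) {a b : EuclideanSpace ℝ (Fin n)} (h : ‖a‖ = ‖b‖) :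
    ∫ y : UnitSphere n, inner ℝ (y : EuclideanSpace ℝ (Fin n)) a ^ 2 ∂uniformSphere n =
      ∫ y : UnitSphere n, inner ℝ (y : EuclideanSpace ℝ (Fin n)) b ^ 2 ∂uniformSphere n := by
  set L := (ℝ ∙ (a - b))ᗮ.reflection with hL
  have hLa : L a = b := Submodule.reflection_sub h
  have hmp := measurePreserving_sphereMap hn L
  rw [← hmp.map_eq, integral_map hmp.measurable.aemeasurable
    ((measurable_inner_sphere b).pow_const 2).aestronglyMeasurable, hmp.map_eq]
  refine integral_congr_ae (Filter.Eventually.of_forall fun y => ?_)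
  have e : inner ℝ (sphereMap L y : EuclideanSpace ℝ (Fin n)) b =
      inner ℝ (y : EuclideanSpace ℝ (Fin n)) a := by
    rw [← hLa]
    exact L.inner_map_map _ _
  simp only [e]

/-- Summed over the standard basis scaled to length `‖a‖`, the squares give `‖a‖ ^ 2` for every `y`;
by symmetry each of the `n` integrals equals the one for `a`. -/
lemma integral_inner_sq (hn : 0 < n) (a : EuclideanSpace ℝ (Fin n)) :
    ∫ y : UnitSphere n, inner ℝ (y : EuclideanSpace ℝ (Fin n)) a ^ 2 ∂uniformSphere n =
      ‖a‖ ^ 2 / n := by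
  have := isProbabilityMeasure_uniformSphere hn
  have hn' : (n : ℝ) ≠ 0 := by positivity
  have hsum : ∑ i : Fin n, ∫ y : UnitSphere n, inner ℝ (y : EuclideanSpace ℝ (Fin n))
      (‖a‖ • EuclideanSpace.single i (1 : ℝ)) ^ 2 ∂uniformSphere n = ‖a‖ ^ 2 := by
    rw [← integral_finsetSum _ fun i _ => integrable_inner_sq hn _]
    have e : ∀ y : UnitSphere n, ∑ i : Fin n, inner ℝ (y : EuclideanSpace ℝ (Fin n))
        (‖a‖ • EuclideanSpace.single i (1 : ℝ)) ^ 2 = ‖a‖ ^ 2 := by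
      intro y
      have hny : ‖(y : EuclideanSpace ℝ (Fin n))‖ = 1 := by simp
      have h1 := EuclideanSpace.real_norm_sq_eq (y : EuclideanSpace ℝ (Fin n))
      rw [hny] at h1
      simp only [inner_smul_right, EuclideanSpace.inner_single_right, mul_pow, ← Finset.mul_sum]
      simp only [conj_trivial]
      rw [← h1]
      ring
    simp only [e]
    simp
  have heq : ∀ i : Fin n, ∫ y : UnitSphere n, inner ℝ (y : EuclideanSpace ℝ (Fin n))
      (‖a‖ • EuclideanSpace.single i (1 : ℝ)) ^ 2 ∂uniformSphere n =
      ∫ y : UnitSphere n, inner ℝ (y : EuclideanSpace ℝ (Fin n)) a ^ 2 ∂uniformSphere n := by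
    intro i
    refine integral_inner_sq_eq hn ?_
    rw [norm_smul]
    simp
  simp only [heq, Finset.sum_const, Finset.card_univ, Fintype.card_fin, nsmul_eq_mul] at hsum
  rw [← hsum]
  field_simp

end Sphere

/-! ### The expected drop of the potential -/

section Expectation

variable {n : ℕ} {G : SimpleGraph (Fin n)} [DecidableRel G.Adj]

lemma measurableSet_goodDirection (A : Fin n → Bool) (p : Fin n → EuclideanSpace ℝ (Fin n))
    (η : ℝ) : MeasurableSet {y : UnitSphere n | GoodDirection G A p η
      (y : EuclideanSpace ℝ (Fin n))} := by
  have h : ∀ a : EuclideanSpace ℝ (Fin n), MeasurableSet {y : UnitSphere n |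
      inner ℝ (y : EuclideanSpace ℝ (Fin n)) a ^ 2 ≤ η * ‖a‖ ^ 2} := fun a =>
    measurableSet_le ((measurable_inner_sphere a).pow_const 2) measurable_const
  simp only [GoodDirection, Set.ofPred_and, Set.ofPred_forall]
  exact (MeasurableSet.iInter fun v => MeasurableSet.iInter fun w => h _).inter
    ((MeasurableSet.iInter fun v => h _).inter (MeasurableSet.iInter fun v => h _))

/-- A union bound over the `n² + 2n ≤ 2n²` vectors in `GoodDirection`. -/
lemma uniformSphere_not_goodDirection_le (hn : 2 ≤ n) (A : Fin n → Bool)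
    (p : Fin n → EuclideanSpace ℝ (Fin n)) {η : ℝ} (hη : 0 < η) (hη2 : η ≤ 1 / 2) :
    uniformSphere n {y : UnitSphere n | ¬ GoodDirection G A p η
      (y : EuclideanSpace ℝ (Fin n))} ≤
      ENNReal.ofReal (4 * n ^ 2 * Real.exp (-(η * n / 2))) := by
  set x := ENNReal.ofReal (2 * Real.exp (-(η * n / 2))) with hx
  have htail := fun a => uniformSphere_tail_le (by omega : 0 < n) a hη hη2
  rw [← hx] at htail
  have hsub : {y : UnitSphere n | ¬ GoodDirection G A p η (y : EuclideanSpace ℝ (Fin n))} ⊆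
      (⋃ v, ⋃ w, {y | ¬ inner ℝ (y : EuclideanSpace ℝ (Fin n)) (p v - p w) ^ 2 ≤
        η * ‖p v - p w‖ ^ 2}) ∪
      ((⋃ v, {y | ¬ inner ℝ (y : EuclideanSpace ℝ (Fin n)) (walk G A p v - mean G (supp A) p) ^ 2 ≤
        η * ‖walk G A p v - mean G (supp A) p‖ ^ 2}) ∪
      (⋃ v, {y | ¬ inner ℝ (y : EuclideanSpace ℝ (Fin n)) (p v - mean G (supp A) p) ^ 2 ≤
        η * ‖p v - mean G (supp A) p‖ ^ 2})) := by
    intro y hy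
    by_contra hc
    simp only [Set.mem_union, Set.mem_iUnion, Set.mem_ofPred_eq, not_or, not_exists, not_not]
      at hc
    exact hy hc
  have h1 : ∀ f : Fin n → EuclideanSpace ℝ (Fin n), uniformSphere n (⋃ v, {y : UnitSphere n |
      ¬ inner ℝ (y : EuclideanSpace ℝ (Fin n)) (f v) ^ 2 ≤ η * ‖f v‖ ^ 2}) ≤ n * x := by
    intro f
    refine (measure_iUnion_fintype_le _ _).trans ?_
    refine (Finset.sum_le_sum fun v _ => htail (f v)).trans ?_
    simp
  refine (measure_mono hsub).trans ((measure_union_le _ _).trans ?_)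
  have h2 := (measure_union_le _ _).trans (add_le_add
    (h1 fun v => walk G A p v - mean G (supp A) p) (h1 fun v => p v - mean G (supp A) p))
  have h3 : uniformSphere n (⋃ v, ⋃ w, {y : UnitSphere n |
      ¬ inner ℝ (y : EuclideanSpace ℝ (Fin n)) (p v - p w) ^ 2 ≤ η * ‖p v - p w‖ ^ 2}) ≤
      n * (n * x) := by
    refine (measure_iUnion_fintype_le _ _).trans ?_
    refine (Finset.sum_le_sum fun v _ => h1 fun w => p v - p w).trans ?_
    simp
  refine (add_le_add h3 h2).trans ?_
  have e : (n : ENNReal) * (n * x) + (n * x + n * x) = ENNReal.ofReal ((n * n + 2 * n) *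
      (2 * Real.exp (-(η * n / 2)))) := by
    rw [ENNReal.ofReal_mul (by positivity), ← hx]
    have : ENNReal.ofReal ((n : ℝ) * n + 2 * n) = n * n + 2 * n := by
      have h4 : (n : ℝ) * n + 2 * n = ((n * n + 2 * n : ℕ) : ℝ) := by push_cast; ring
      rw [h4, ENNReal.ofReal_natCast]
      push_cast
      ring
    rw [this]
    ring
  rw [e]
  refine ENNReal.ofReal_le_ofReal ?_
  have hn' : (2 : ℝ) ≤ n := by exact_mod_cast hn
  have h5 := Real.exp_pos (-(η * n / 2))
  have h6 : (n : ℝ) * n + 2 * n ≤ 2 * n ^ 2 := by nlinarith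
  nlinarith

lemma integrable_sqSum_centered (hn : 0 < n) (A : Fin n → Bool)
    (p : Fin n → EuclideanSpace ℝ (Fin n)) :
    Integrable (fun y : UnitSphere n =>
      sqSum G (supp A) (centered G A p (y : EuclideanSpace ℝ (Fin n)))) (uniformSphere n) := by
  simp only [sqSum, centered, Real.norm_eq_abs, sq_abs]
  exact integrable_finsetSum _ fun v _ => (integrable_inner_sq hn _).const_mul _

lemma integral_sqSum_centered (hn : 0 < n) (A : Fin n → Bool)
    (p : Fin n → EuclideanSpace ℝ (Fin n)) :
    ∫ y : UnitSphere n, sqSum G (supp A) (centered G A p (y : EuclideanSpace ℝ (Fin n)))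
      ∂uniformSphere n = pot G (supp A) p / n := by
  simp only [sqSum, centered, Real.norm_eq_abs, sq_abs]
  rw [integral_finsetSum _ fun v _ => (integrable_inner_sq hn _).const_mul _]
  simp only [integral_const_mul, integral_inner_sq hn, pot, sqSum, Finset.sum_div]
  exact Finset.sum_congr rfl fun v _ => by ring

lemma sqSum_centered_le_pot (A : Fin n → Bool) (p : Fin n → EuclideanSpace ℝ (Fin n))
    (y : UnitSphere n) :
    sqSum G (supp A) (centered G A p (y : EuclideanSpace ℝ (Fin n))) ≤ pot G (supp A) p := by
  refine Finset.sum_le_sum fun v _ => mul_le_mul_of_nonneg_left ?_ (Nat.cast_nonneg _)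
  refine pow_le_pow_left₀ (norm_nonneg _) ?_ 2
  have h := abs_real_inner_le_norm (y : EuclideanSpace ℝ (Fin n)) (p v - mean G (supp A) p)
  have hny : ‖(y : EuclideanSpace ℝ (Fin n))‖ = 1 := by simp
  rwa [hny, one_mul] at h

open Classical in
/-- If a good direction decreases the potential by a multiple of the projected one, then the
potential decreases in expectation. -/
lemma lintegral_pot_le (hn : 2 ≤ n) (A : Fin n → Bool) (p : Fin n → EuclideanSpace ℝ (Fin n))
    {η κ : ℝ} (hη : 0 < η) (hη2 : η ≤ 1 / 2) (hκ : 0 ≤ κ) (hκη : κ * η ≤ 1)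
    (hprob : 4 * n ^ 2 * Real.exp (-(η * n / 2)) ≤ 1 / (2 * n)) (Ψ : UnitSphere n → ℝ)
    (hΨ : ∀ y, Ψ y ≤ pot G (supp A) p)
    (hdrop : ∀ y : UnitSphere n, GoodDirection G A p η (y : EuclideanSpace ℝ (Fin n)) →
      Ψ y ≤ pot G (supp A) p -
        κ * sqSum G (supp A) (centered G A p (y : EuclideanSpace ℝ (Fin n)))) :
    ∫⁻ y, ENNReal.ofReal (Ψ y) ∂uniformSphere n ≤
      ENNReal.ofReal ((1 - κ / (2 * n)) * pot G (supp A) p) := by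
  have hn0 : 0 < n := by omega
  have := isProbabilityMeasure_uniformSphere hn0
  set P := pot G (supp A) p with hP
  have hP0 : 0 ≤ P := pot_nonneg _ _
  set X : UnitSphere n → ℝ := fun y =>
    sqSum G (supp A) (centered G A p (y : EuclideanSpace ℝ (Fin n))) with hX
  set E : Set (UnitSphere n) := {y | GoodDirection G A p η (y : EuclideanSpace ℝ (Fin n))} with hE
  have hEm : MeasurableSet E := measurableSet_goodDirection A p η
  have hX0 : ∀ y, 0 ≤ X y := fun y => sqSum_nonneg G _ _
  have hXint : Integrable X (uniformSphere n) := integrable_sqSum_centered hn0 A p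
  have hXP : ∀ y, X y ≤ P := fun y => sqSum_centered_le_pot A p y
  have hXE : ∀ y ∈ E, X y ≤ η * P := by
    intro y hy
    simp only [hX, hP, pot, sqSum, Finset.mul_sum]
    refine Finset.sum_le_sum fun v _ => ?_
    rw [Real.norm_eq_abs, sq_abs, mul_left_comm]
    exact mul_le_mul_of_nonneg_left (hy.2.2 v) (Nat.cast_nonneg _)
  -- Outside the good event only monotonicity of the potential is used.
  set h : UnitSphere n → ℝ := fun y => P - κ * E.indicator X y with hh
  have hhint : Integrable h (uniformSphere n) :=
    (integrable_const P).sub ((hXint.indicator hEm).const_mul κ)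
  have hΨh : ∀ y, Ψ y ≤ h y := by
    intro y
    by_cases hy : y ∈ E
    · simp only [hh, Set.indicator_of_mem hy]
      exact hdrop y hy
    · simp only [hh, Set.indicator_of_notMem hy, mul_zero, sub_zero]
      exact hΨ y
  -- Non-negativity, which rests on `κ * η ≤ 1`, permits passing between the two kinds of integral.
  have hh0 : ∀ y, 0 ≤ h y := by
    intro y
    by_cases hy : y ∈ E
    · simp only [hh, Set.indicator_of_mem hy]
      have h1 := mul_le_mul_of_nonneg_left (hXE y hy) hκ
      have h2 := mul_le_mul_of_nonneg_right hκη hP0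
      linarith
    · simp only [hh, Set.indicator_of_notMem hy, mul_zero, sub_zero]
      exact hP0
  have hint : ∫ y, h y ∂uniformSphere n ≤ (1 - κ / (2 * n)) * P := by
    have h1 : ∫ y, h y ∂uniformSphere n = P - κ * ∫ y, E.indicator X y ∂uniformSphere n := by
      rw [hh, integral_sub (integrable_const P) ((hXint.indicator hEm).const_mul κ),
        integral_const_mul]
      simp
    -- Restricting to the good event costs at most `P` on an event of probability at most `1 /
    -- (2n)`, so half of the mean `P / n` survives.
    have h2 : P / n - P * (1 / (2 * n)) ≤ ∫ y, E.indicator X y ∂uniformSphere n := by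
      have h3 : ∫ y, X y ∂uniformSphere n - ∫ y, Eᶜ.indicator (fun _ => P) y ∂uniformSphere n ≤
          ∫ y, E.indicator X y ∂uniformSphere n := by
        rw [← integral_sub hXint ((integrable_const P).indicator hEm.compl)]
        refine integral_mono (hXint.sub ((integrable_const P).indicator hEm.compl))
          (hXint.indicator hEm) fun y => ?_
        by_cases hy : y ∈ E
        · simp [hy]
        · simp [hy, hXP y]
      have h4 : ∫ y, Eᶜ.indicator (fun _ => P) y ∂uniformSphere n ≤ P * (1 / (2 * n)) := by
        rw [integral_indicator_const _ hEm.compl, smul_eq_mul, mul_comm]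
        refine mul_le_mul_of_nonneg_left ?_ hP0
        refine ENNReal.toReal_le_of_le_ofReal (by positivity) ?_
        refine le_trans ?_ (ENNReal.ofReal_le_ofReal hprob)
        exact uniformSphere_not_goodDirection_le hn A p hη hη2
      have h5 : ∫ y, X y ∂uniformSphere n = P / n := integral_sqSum_centered hn0 A p
      linarith
    rw [h1]
    have h3 := mul_le_mul_of_nonneg_left h2 hκ
    have e : κ * (P / n - P * (1 / (2 * n))) = κ / (2 * n) * P := by
      have : (n : ℝ) ≠ 0 := by positivity
      field_simp
      ring
    linarith
  calc ∫⁻ y, ENNReal.ofReal (Ψ y) ∂uniformSphere n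
      ≤ ∫⁻ y, ENNReal.ofReal (h y) ∂uniformSphere n :=
        lintegral_mono fun y => ENNReal.ofReal_le_ofReal (hΨh y)
    _ = ENNReal.ofReal (∫ y, h y ∂uniformSphere n) :=
        (ofReal_integral_eq_lintegral_ofReal hhint (Filter.Eventually.of_forall hh0)).symm
    _ ≤ _ := ENNReal.ofReal_le_ofReal hint

end Expectation

/-! ### The procedure as a random process -/

section Iteration

variable {n : ℕ} (G : SimpleGraph (Fin n)) [DecidableRel G.Adj]

/-- The sweep cut in state `s` with random vector `y`. -/
def cutOf (γ τ : ℝ) (s : State n) (y : Fin n → ℝ) : Option ((Fin n → Bool) × ℝ) :=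
  (sweepCut G s.A γ τ (walkVector G s.hist y).val).val

/-- The output or the next state, given the sweep cut. -/
def stepOf (τ : ℝ) (s : State n) : Option ((Fin n → Bool) × ℝ) → Outcome n ⊕ State n
  | none => Sum.inr { s with hist := s.A :: s.hist }
  | some (S, x) =>
    if τ ≤ x then Sum.inl (Outcome.balanced S)
    else if τ ≤ s.volL + x then Sum.inl (Outcome.balanced (fun v => s.A v && !(S v)))
    else Sum.inr { A := fun v => s.A v && !(S v), emptyL := false, volL := s.volL + x,
                   hist := s.A :: s.hist }

lemma iterate_succ_val (γ τ : ℝ) (r : ℕ → Fin n → ℝ) (k t : ℕ) (s : State n) :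
    (iterate G γ τ r (k + 1) t s).val =
      Sum.elim id (fun s' => (iterate G γ τ r k (t + 1) s').val)
        (stepOf τ s (cutOf G γ τ s (r t))) := by
  rw [iterate]
  simp only [val_bind, cutOf]
  rcases (sweepCut G s.A γ τ (walkVector G s.hist (r t)).val).val with _ | ⟨S, x⟩
  · rfl
  · simp only [val_ite, val_bind, val_pure, tabulate_val, stepOf]
    split_ifs <;> rfl

variable {G}

open Classical in
/-- The order of the walk vector in state `s` with random vector `y`. -/
def orderOf (G : SimpleGraph (Fin n)) [DecidableRel G.Adj] (s : State n) (y : UnitSphere n) :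
    Fin n × Fin n → Bool := fun p =>
  decide ((walkVector G s.hist (fun v => y.1 v)).val p.1 ≤
    (walkVector G s.hist (fun v => y.1 v)).val p.2)

lemma measurable_orderOf (s : State n) : Measurable (orderOf G s) := by
  refine measurable_pi_iff.2 fun p => ?_
  simp only [orderOf, walkVector_eq_inner]
  refine measurable_to_bool ?_
  have : (fun y : UnitSphere n => decide (inner ℝ (y : EuclideanSpace ℝ (Fin n))
      (rows G s.hist p.1) ≤ inner ℝ (y : EuclideanSpace ℝ (Fin n)) (rows G s.hist p.2))) ⁻¹' {true}
      = {y : UnitSphere n | inner ℝ (y : EuclideanSpace ℝ (Fin n)) (rows G s.hist p.1) ≤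
        inner ℝ (y : EuclideanSpace ℝ (Fin n)) (rows G s.hist p.2)} := by
    ext y; simp
  rw [this]
  exact measurableSet_le (measurable_inner_sphere _) (measurable_inner_sphere _)

lemma cutOf_congr (γ τ : ℝ) (s : State n) {y y' : UnitSphere n}
    (h : orderOf G s y = orderOf G s y') :
    cutOf G γ τ s (fun v => y.1 v) = cutOf G γ τ s (fun v => y'.1 v) := by
  refine sweepCut_congr G (fun v w => ?_) s.A γ τ
  have := congrFun h (v, w)
  simpa [orderOf] using this

/-- Failure probability of the iterations, for a process whose potential decreases by the factor
`ρ` in expectation. -/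
lemma measure_iterate_le {γ τ : ℝ} {T : ℕ} {Good : Outcome n → Prop} {Inv : State n → Prop}
    {Pot : State n → ℝ} {ρ K : ℝ} (hρ : 0 ≤ ρ) (hK : 0 ≤ K) (hPot : ∀ s, 0 ≤ Pot s)
    (hstep : ∀ s, Inv s → ∀ y : UnitSphere n,
      Sum.elim Good (fun s' => Inv s' ∧ s'.hist.length = s.hist.length + 1)
        (stepOf τ s (cutOf G γ τ s (fun v => y.1 v))))
    (hexp : ∀ s, Inv s → ∫⁻ y : UnitSphere n, ENNReal.ofReal (Sum.elim (fun _ => 0) Pot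
      (stepOf τ s (cutOf G γ τ s (fun v => y.1 v)))) ∂uniformSphere n ≤
        ENNReal.ofReal (ρ * Pot s))
    (hfin : ∀ s, Inv s → s.hist.length = T → K * Pot s < 1 →
      Good (if s.emptyL then Outcome.expander else Outcome.unbalanced s.A))
    {Ω : Type*} [MeasurableSpace Ω] {μ : Measure Ω} [IsProbabilityMeasure μ]
    {r : ℕ → Ω → UnitSphere n} (hr : ∀ t, Measurable (r t)) (hind : iIndepFun r μ)
    (hunif : ∀ t, μ.map (r t) = uniformSphere n) (k t : ℕ) (s : State n) (hs : Inv s)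
    (hlen : s.hist.length + k = T) (C : ℕ → Set (UnitSphere n)) (hC : ∀ i, MeasurableSet (C i)) :
    μ ((⋂ i ∈ Finset.range t, r i ⁻¹' C i) ∩
      {ω | ¬ Good (iterate G γ τ (fun t v => (r t ω).1 v) k t s).val}) ≤
      μ (⋂ i ∈ Finset.range t, r i ⁻¹' C i) * ENNReal.ofReal (K * (Pot s * ρ ^ k)) := by
  induction k generalizing t s C with
  | zero =>
    have hval : ∀ ω, (iterate G γ τ (fun t v => (r t ω).1 v) 0 t s).val =
        if s.emptyL then Outcome.expander else Outcome.unbalanced s.A := fun ω => rfl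
    simp only [hval]
    -- Markov's inequality: a failure is possible only if `K * Pot s` is at least 1, and then the
    -- claimed bound is trivial.
    by_cases hK1 : K * Pot s < 1
    · have := hfin s hs hlen hK1
      simp [this]
    · refine (measure_mono Set.inter_subset_left).trans ?_
      rw [pow_zero, mul_one]
      have h1 : (1 : ENNReal) ≤ ENNReal.ofReal (K * Pot s) := by
        rw [← ENNReal.ofReal_one]
        exact ENNReal.ofReal_le_ofReal (not_lt.1 hK1)
      calc _ = μ (⋂ i ∈ Finset.range t, r i ⁻¹' C i) * 1 := (mul_one _).symm
        _ ≤ _ := by gcongr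
  | succ k ih =>
    set B := ⋂ i ∈ Finset.range t, r i ⁻¹' C i with hB
    set D : (Fin n × Fin n → Bool) → Set (UnitSphere n) := fun o => orderOf G s ⁻¹' {o} with hD
    have hDm : ∀ o, MeasurableSet (D o) := fun o =>
      measurable_orderOf s (measurableSet_singleton o)
    -- The past enters only through the product event `B`. Extending the sets `C` at position `t`
    -- makes independence for a finite family directly applicable.
    have hprod : ∀ o, μ (B ∩ r t ⁻¹' D o) = μ B * uniformSphere n (D o) := by
      intro o
      have h1 := hind.measure_inter_preimage_eq_mul (Finset.range (t + 1))
        (sets := Function.update C t (D o)) (fun i _ => by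
          by_cases hi : i = t
          · subst hi; simpa using hDm o
          · simpa [hi] using hC i)
      have h2 := hind.measure_inter_preimage_eq_mul (Finset.range t) (sets := C)
        (fun i _ => hC i)
      rw [Finset.prod_range_succ, Function.update_self] at h1
      have h3 : ∏ i ∈ Finset.range t, μ (r i ⁻¹' Function.update C t (D o) i) =
          ∏ i ∈ Finset.range t, μ (r i ⁻¹' C i) := by
        refine Finset.prod_congr rfl fun i hi => ?_
        rw [Function.update_of_ne (Finset.mem_range.1 hi).ne]
      rw [h3, ← h2, ← Measure.map_apply (hr t) (hDm o), hunif] at h1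
      rw [← h1]
      congr 1
      ext ω
      simp only [hB, Set.mem_inter_iff, Set.mem_iInter, Finset.mem_range, Set.mem_preimage]
      constructor
      · rintro ⟨h4, h5⟩ i hi
        rcases Nat.lt_succ_iff_lt_or_eq.1 hi with hi | rfl
        · rw [Function.update_of_ne hi.ne]; exact h4 i hi
        · rw [Function.update_self]; exact h5
      · intro h4
        refine ⟨fun i hi => ?_, ?_⟩
        · have := h4 i (by omega)
          rwa [Function.update_of_ne hi.ne] at this
        · have := h4 t (by omega)
          rwa [Function.update_self] at this
    have hset : ∀ o, (⋂ i ∈ Finset.range (t + 1), r i ⁻¹' Function.update C t (D o) i) =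
        B ∩ r t ⁻¹' D o := by
      intro o
      ext ω
      simp only [hB, Set.mem_inter_iff, Set.mem_iInter, Finset.mem_range, Set.mem_preimage]
      constructor
      · intro h4
        refine ⟨fun i hi => ?_, ?_⟩
        · have := h4 i (by omega)
          rwa [Function.update_of_ne hi.ne] at this
        · have := h4 t (by omega)
          rwa [Function.update_self] at this
      · rintro ⟨h4, h5⟩ i hi
        rcases Nat.lt_succ_iff_lt_or_eq.1 hi with hi | rfl
        · rw [Function.update_of_ne hi.ne]; exact h4 i hi
        · rw [Function.update_self]; exact h5
    set Ψ : UnitSphere n → ℝ := fun y => Sum.elim (fun _ => 0) Pot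
      (stepOf τ s (cutOf G γ τ s (fun v => y.1 v))) with hΨ
    have hΨc : ∀ y y', orderOf G s y = orderOf G s y' → Ψ y = Ψ y' := fun y y' h => by
      simp only [hΨ, cutOf_congr γ τ s h]
    have hΨ0 : ∀ y, 0 ≤ Ψ y := by
      intro y
      simp only [hΨ]
      rcases stepOf τ s (cutOf G γ τ s (fun v => y.1 v)) with a | a
      · exact le_rfl
      · exact hPot a
    -- The next potential factors through the order, so its integral becomes a finite sum over the
    -- cells `D o`.
    obtain ⟨f, hf⟩ : ∃ f : (Fin n × Fin n → Bool) → ENNReal,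
        ∀ y, f (orderOf G s y) = ENNReal.ofReal (Ψ y) := by
      classical
      refine ⟨fun o => if h : ∃ y, orderOf G s y = o then ENNReal.ofReal (Ψ h.choose) else 0,
        fun y => ?_⟩
      have h : ∃ y', orderOf G s y' = orderOf G s y := ⟨y, rfl⟩
      simp only [dif_pos h, hΨc _ _ h.choose_spec]
    -- On a cell the cut, and so the output or next state, is constant: either the output is good,
    -- or the induction hypothesis applies with the cell as an additional past event.
    have hcell : ∀ o, μ (B ∩ r t ⁻¹' D o ∩
        {ω | ¬ Good (iterate G γ τ (fun t v => (r t ω).1 v) (k + 1) t s).val}) ≤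
        μ B * ENNReal.ofReal (K * ρ ^ k) * (uniformSphere n (D o) * f o) := by
      intro o
      rcases Set.eq_empty_or_nonempty (D o) with he | ⟨y, hy⟩
      · simp [he]
      have hfo : f o = ENNReal.ofReal (Ψ y) := by rw [← hf y, hy]
      have hval : ∀ ω ∈ r t ⁻¹' D o, (iterate G γ τ (fun t v => (r t ω).1 v) (k + 1) t s).val =
          Sum.elim id (fun s' => (iterate G γ τ (fun t v => (r t ω).1 v) k (t + 1) s').val)
            (stepOf τ s (cutOf G γ τ s (fun v => y.1 v))) := by
        intro ω hω
        have h1 : orderOf G s (r t ω) = orderOf G s y := Eq.trans hω (Eq.symm hy)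
        rw [iterate_succ_val, cutOf_congr γ τ s h1]
      have hst := hstep s hs y
      have hΨy : Ψ y = Sum.elim (fun _ => 0) Pot
        (stepOf τ s (cutOf G γ τ s (fun v => y.1 v))) := rfl
      rcases hcase : stepOf τ s (cutOf G γ τ s (fun v => y.1 v)) with out | s'
      · rw [hcase] at hst hval
        have : B ∩ r t ⁻¹' D o ∩
            {ω | ¬ Good (iterate G γ τ (fun t v => (r t ω).1 v) (k + 1) t s).val} = ∅ := by
          ext ω
          simp only [Set.mem_inter_iff, Set.mem_ofPred_eq, Set.mem_empty_iff_false, iff_false,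
            not_and, not_not]
          intro hω
          rw [hval ω hω.2]
          exact hst
        rw [this]
        simp
      · rw [hcase] at hst hval hΨy
        have h1 := ih (t + 1) s' hst.1 (by rw [hst.2]; omega) (Function.update C t (D o))
          (fun i => by
            by_cases hi : i = t
            · subst hi; simpa using hDm o
            · simpa [hi] using hC i)
        rw [hset, hprod] at h1
        refine le_trans (le_of_eq ?_) (h1.trans (le_of_eq ?_))
        · congr 1
          ext ω
          simp only [Set.mem_inter_iff, Set.mem_ofPred_eq]
          refine and_congr_right fun hω => ?_
          rw [hval ω hω.2]
          rfl
        · rw [hfo, hΨy]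
          have e : K * (Pot s' * ρ ^ k) = (K * ρ ^ k) * Pot s' := by ring
          rw [e, ENNReal.ofReal_mul (by positivity)]
          simp only [Sum.elim_inr]
          ring
    -- Only subadditivity over finitely many cells is needed, so measurability of the failure event
    -- plays no role.
    have hcover : B ∩ {ω | ¬ Good (iterate G γ τ (fun t v => (r t ω).1 v) (k + 1) t s).val} ⊆
        ⋃ o, (B ∩ r t ⁻¹' D o ∩
          {ω | ¬ Good (iterate G γ τ (fun t v => (r t ω).1 v) (k + 1) t s).val}) := by
      rintro ω ⟨h1, h2⟩
      exact Set.mem_iUnion.2 ⟨orderOf G s (r t ω), ⟨h1, rfl⟩, h2⟩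
    have hlint : ∑ o, uniformSphere n (D o) * f o = ∫⁻ y, ENNReal.ofReal (Ψ y)
        ∂uniformSphere n := by
      simp only [← hf]
      rw [← lintegral_map (measurable_of_finite f) (measurable_orderOf s), lintegral_fintype]
      refine Finset.sum_congr rfl fun o _ => ?_
      rw [Measure.map_apply (measurable_orderOf s) (measurableSet_singleton o), mul_comm]
    calc _ ≤ ∑ o, μ (B ∩ r t ⁻¹' D o ∩
          {ω | ¬ Good (iterate G γ τ (fun t v => (r t ω).1 v) (k + 1) t s).val}) :=
          (measure_mono hcover).trans (measure_iUnion_fintype_le _ _)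
      _ ≤ ∑ o, μ B * ENNReal.ofReal (K * ρ ^ k) * (uniformSphere n (D o) * f o) :=
          Finset.sum_le_sum fun o _ => hcell o
      _ = μ B * ENNReal.ofReal (K * ρ ^ k) * ∫⁻ y, ENNReal.ofReal (Ψ y) ∂uniformSphere n := by
          rw [← Finset.mul_sum, hlint]
      _ ≤ μ B * ENNReal.ofReal (K * ρ ^ k) * ENNReal.ofReal (ρ * Pot s) := by
          gcongr
          exact hexp s hs
      _ = μ B * ENNReal.ofReal (K * (Pot s * ρ ^ (k + 1))) := by
          rw [mul_assoc, ← ENNReal.ofReal_mul (by positivity)]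
          congr 2
          ring

end Iteration

/-! ### What the outputs promise -/

section Promise

variable {n : ℕ} {G : SimpleGraph (Fin n)} [DecidableRel G.Adj]

lemma vol_add_compl (X : Finset (Fin n)) : vol G X + vol G Xᶜ = 2 * numEdges G := by
  rw [← vol_univ, ← vol_union G disjoint_compl_right, Finset.union_compl]

lemma nonempty_of_vol_pos {X : Finset (Fin n)} (h : 0 < vol G X) : X.Nonempty := by
  rw [Finset.nonempty_iff_ne_empty]
  rintro rfl
  simp [vol] at h

lemma border_le_compl (X : Finset (Fin n)) : (border G X : ℝ) = border G Xᶜ := by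
  rw [border_eq, border_eq, compl_compl, edges_comm]

lemma vol_pos (hdeg : ∀ v, 0 < G.degree v) {X : Finset (Fin n)} (h : X.Nonempty) :
    0 < vol G X := by
  obtain ⟨v, hv⟩ := h
  exact lt_of_lt_of_le (hdeg v)
    (Finset.single_le_sum (f := fun v => G.degree v) (fun _ _ => Nat.zero_le _) hv)

/-- The smaller side of any cut has at most half of the total volume, so near expansion of the whole
vertex set applies to it. The factor 6 is more than needed. -/
lemma le_conductance_of_isNearExpander (hdeg : ∀ v, 0 < G.degree v) {φ : ℝ} (h0 : 0 < φ)
    (h1 : φ ≤ 1) (h : IsNearExpander G (6 * φ) Finset.univ) : φ ≤ conductance G := by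
  classical
  have key : ∀ X : Finset (Fin n), X.Nonempty → vol G X ≤ vol G Xᶜ →
      φ * vol G X ≤ border G X := by
    intro X hX hle
    have h2 := vol_add_compl (G := G) X
    have h3 : (vol G X : ℝ) ≤ (vol G Finset.univ : ℝ) / 2 := by
      rw [vol_univ]
      have : vol G X ≤ numEdges G := by omega
      have : (vol G X : ℝ) ≤ numEdges G := by exact_mod_cast this
      push_cast
      linarith
    have h4 := h X (Finset.subset_univ _) h3
    have h5 : 0 ≤ φ * vol G X := mul_nonneg h0.le (Nat.cast_nonneg _)
    linarith
  unfold conductance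
  dsimp only
  split_ifs with hne
  · refine (Finset.le_inf'_iff _ _).2 fun X hX => ?_
    obtain ⟨hX1, hX2⟩ := (Finset.mem_filter.1 hX).2
    have p1 := vol_pos hdeg hX1
    have p2 := vol_pos hdeg hX2
    have hm : (0 : ℝ) < (min (vol G X) (vol G Xᶜ) : ℕ) := by
      exact_mod_cast lt_min p1 p2
    rw [cutConductance, le_div_iff₀ hm]
    rcases le_total (vol G X) (vol G Xᶜ) with h5 | h5
    · rw [min_eq_left h5]
      exact key X hX1 h5
    · rw [min_eq_right h5, border_le_compl]
      refine key _ hX2 ?_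
      rwa [compl_compl]
  · exact h1

/-- The conditions under which the bounds on border and volume imply the promised bounds. -/
structure Scaling (G : SimpleGraph (Fin n)) [DecidableRel G.Adj] (C φ γ τ : ℝ) : Prop where
  cond_le : 2 * γ ≤ C * (√φ * Real.logb 2 (numEdges G) ^ (3 / 2 : ℝ))
  le_vol : C⁻¹ * (numEdges G * √φ / Real.logb 2 (numEdges G) ^ (3 / 2 : ℝ)) ≤ τ
  vol_le : τ ≤ C * (numEdges G * √φ / Real.logb 2 (numEdges G) ^ (3 / 2 : ℝ))
  pos : 0 < γ
  vol_pos : 0 < τ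
  small : 32 * τ ≤ numEdges G

variable {C φ γ τ : ℝ}

lemma cutConductance_le_of_edges_le {a : ℝ} {X : Finset (Fin n)} (h1 : 0 < vol G X)
    (h2 : 0 < vol G Xᶜ) (h3 : edges G X Xᶜ ≤ a * vol G X) (h4 : edges G X Xᶜ ≤ a * vol G Xᶜ) :
    cutConductance G X ≤ a := by
  have hm : (0 : ℝ) < (min (vol G X) (vol G Xᶜ) : ℕ) := by
    exact_mod_cast lt_min h1 h2
  rw [cutConductance, div_le_iff₀ hm, border_eq]
  rcases le_total (vol G X) (vol G Xᶜ) with h5 | h5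
  · rwa [min_eq_left h5]
  · rwa [min_eq_right h5]

lemma Scaling.balanced (hsc : Scaling G C φ γ τ) {S : Fin n → Bool}
    (h1 : τ ≤ vol G (supp S)) (h2 : τ ≤ vol G (supp S)ᶜ)
    (h3 : edges G (supp S) (supp S)ᶜ ≤ 2 * γ * vol G (supp S))
    (h4 : edges G (supp S) (supp S)ᶜ ≤ 2 * γ * vol G (supp S)ᶜ) :
    Guarantee G C φ (Outcome.balanced S) := by
  have p1 : 0 < vol G (supp S) := by exact_mod_cast hsc.vol_pos.trans_le h1
  have p2 : 0 < vol G (supp S)ᶜ := by exact_mod_cast hsc.vol_pos.trans_le h2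
  exact ⟨⟨nonempty_of_vol_pos p1, nonempty_of_vol_pos p2⟩,
    (cutConductance_le_of_edges_le p1 p2 h3 h4).trans hsc.cond_le,
    hsc.le_vol.trans h1, hsc.le_vol.trans h2⟩

/-- The invariant of the iterations. -/
structure Inv (G : SimpleGraph (Fin n)) [DecidableRel G.Adj] (γ τ : ℝ) (s : State n) : Prop where
  volL_eq : s.volL = vol G (supp s.A)ᶜ
  volL_lt : s.volL < τ
  edges_le : edges G (supp s.A)ᶜ (supp s.A) ≤ γ * s.volL
  full : s.emptyL = true → supp s.A = Finset.univ
  proper : s.emptyL = false → (supp s.A)ᶜ.Nonempty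

lemma Inv.initial (hτ : 0 < τ) : Inv G γ τ
    { A := fun _ => true, emptyL := true, volL := 0, hist := [] } := by
  have h : supp (fun _ : Fin n => true) = Finset.univ := by ext; simp
  refine ⟨?_, hτ, ?_, fun _ => h, by simp⟩
  · simp [h, vol]
  · simp [h, edges]

lemma Inv.vol_ge (hsc : Scaling G C φ γ τ) {s : State n} (hs : Inv G γ τ s) :
    63 * τ ≤ vol G (supp s.A) := by
  have h1 : (vol G (supp s.A) : ℝ) + vol G (supp s.A)ᶜ = 2 * numEdges G := by
    exact_mod_cast vol_add_compl (supp s.A)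
  have h2 := hs.volL_eq
  have h3 := hs.volL_lt
  have h4 := hsc.small
  linarith

lemma supp_sdiff (A S : Fin n → Bool) : supp (fun v => A v && !(S v)) = supp A \ supp S := by
  ext v
  simp

lemma compl_sdiff' (A S : Finset (Fin n)) : (A \ S)ᶜ = Aᶜ ∪ S := by
  ext v
  simp
  tauto

lemma Inv.vol_pos (hsc : Scaling G C φ γ τ) {s : State n} (hs : Inv G γ τ s) :
    0 < vol G (supp s.A) := by
  have h1 := hs.vol_ge hsc
  have h2 := hsc.vol_pos
  have : (0 : ℝ) < vol G (supp s.A) := by linarith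
  exact_mod_cast this

/-- The border of `S` in `G` consists of its border inside `A`, below `γ * vol S`, and edges to `L`.
The latter number at most `γ * vol L`, and `vol L < τ ≤ vol S`; hence the factor 2. -/
lemma Inv.balanced_cut (hsc : Scaling G C φ γ τ) {s : State n} (hs : Inv G γ τ s)
    {u : Fin n → ℝ} {S : Fin n → Bool} {x : ℝ}
    (h : SweepSpec G (supp s.A) u γ τ (some (S, x))) (hx : τ ≤ x) :
    Guarantee G C φ (Outcome.balanced S) := by
  obtain ⟨hSA, hxv, h2, hbd, -⟩ := h
  set A := supp s.A
  set X := supp S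
  have hle : vol G X ≤ vol G Xᶜ := by
    have h3 := vol_sdiff G hSA
    have h4 : vol G (A \ X) ≤ vol G Xᶜ := vol_mono G fun v hv => by
      simp only [Finset.mem_sdiff, Finset.mem_compl] at hv ⊢
      exact hv.2
    omega
  have hle' : (vol G X : ℝ) ≤ vol G Xᶜ := by exact_mod_cast hle
  have he : edges G X Xᶜ ≤ 2 * γ * vol G X := by
    have h3 : Xᶜ = (A \ X) ∪ Aᶜ := by
      ext v
      simp only [Finset.mem_compl, Finset.mem_union, Finset.mem_sdiff]
      have := @hSA v
      tauto
    have h4 : Disjoint (A \ X) Aᶜ := by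
      rw [Finset.disjoint_left]
      intro v hv
      simp only [Finset.mem_compl, Finset.mem_sdiff] at hv ⊢
      tauto
    rw [h3, edges_union_right G h4]
    have h5 : edges G X Aᶜ ≤ edges G A Aᶜ := edges_mono G hSA subset_rfl
    rw [edges_comm G A] at h5
    have h6 := hs.edges_le
    have h7 := hs.volL_lt
    have h8 : γ * s.volL ≤ γ * vol G X :=
      mul_le_mul_of_nonneg_left (by linarith) hsc.pos.le
    have h9 : edges G X (A \ X) < γ * vol G X := hbd
    linarith
  have hγ := hsc.pos
  exact hsc.balanced (by linarith) (by linarith) he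
    (he.trans (mul_le_mul_of_nonneg_left hle' (by linarith)))

lemma Inv.compl_next {s : State n} (hs : Inv G γ τ s) {S : Fin n → Bool}
    (hSA : supp S ⊆ supp s.A) :
    (vol G (supp s.A \ supp S)ᶜ : ℝ) = s.volL + vol G (supp S) := by
  rw [compl_sdiff', vol_union, hs.volL_eq]
  · push_cast; ring
  · exact Finset.disjoint_of_subset_right hSA disjoint_compl_left

lemma Inv.edges_next {s : State n} (hs : Inv G γ τ s) {S : Fin n → Bool}
    (hSA : supp S ⊆ supp s.A)
    (hbd : bd G (supp s.A) (supp S) < γ * vol G (supp S)) :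
    edges G (supp s.A \ supp S)ᶜ (supp s.A \ supp S) ≤ γ * (s.volL + vol G (supp S)) := by
  rw [compl_sdiff', edges_union_left]
  · have h1 : edges G (supp s.A)ᶜ (supp s.A \ supp S) ≤ edges G (supp s.A)ᶜ (supp s.A) :=
      edges_mono G subset_rfl Finset.sdiff_subset
    have h2 := hs.edges_le
    have h3 : edges G (supp S) (supp s.A \ supp S) < γ * vol G (supp S) := hbd
    linarith
  · exact Finset.disjoint_of_subset_right hSA disjoint_compl_left

lemma Inv.step (hsc : Scaling G C φ γ τ) {s : State n} (hs : Inv G γ τ s) (y : Fin n → ℝ) :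
    Sum.elim (Guarantee G C φ) (fun s' => Inv G γ τ s' ∧ s'.hist.length = s.hist.length + 1)
      (stepOf τ s (cutOf G γ τ s y)) := by
  have hspec := sweepCut_spec G (hs.vol_pos hsc) γ τ (walkVector G s.hist y).val
  change SweepSpec G _ _ γ τ (cutOf G γ τ s y) at hspec
  rcases hc : cutOf G γ τ s y with _ | ⟨S, x⟩
  · exact ⟨⟨hs.volL_eq, hs.volL_lt, hs.edges_le, hs.full, hs.proper⟩, rfl⟩
  rw [hc] at hspec
  have hspec' := hspec
  obtain ⟨hSA, hxv, h2, hbd, -⟩ := hspec'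
  have hvol := hs.compl_next hSA
  have hedge := hs.edges_next hSA hbd
  -- A strict bound on the border rules out volume 0, so `L` really becomes non-empty.
  have hpos : 0 < vol G (supp S) := by
    by_contra h0
    have h0 : vol G (supp S) = 0 := by omega
    rw [h0] at hbd
    have := bd_nonneg G (supp s.A) (supp S)
    simp at hbd
    linarith
  simp only [stepOf]
  split_ifs with h3 h4
  · exact hs.balanced_cut hsc hspec h3
  -- Two volumes below `τ` were added, so `vol L` lies between `τ` and `2 * τ`, while `A` keeps at
  -- least `62 * τ`.
  · have hγ := hsc.pos
    have h5 : (vol G (supp s.A \ supp S) : ℝ) + vol G (supp s.A \ supp S)ᶜ = 2 * numEdges G := by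
      exact_mod_cast vol_add_compl (supp s.A \ supp S)
    have h6 := hs.volL_lt
    have h7 := hsc.small
    have h8 := hsc.vol_pos
    rw [edges_comm, ← hvol] at hedge
    have h9 : (vol G (supp s.A \ supp S)ᶜ : ℝ) ≤ vol G (supp s.A \ supp S) := by
      linarith
    have h10 : (0 : ℝ) ≤ γ * vol G (supp s.A \ supp S)ᶜ := by positivity
    have h11 : γ * vol G (supp s.A \ supp S)ᶜ ≤ γ * vol G (supp s.A \ supp S) :=
      mul_le_mul_of_nonneg_left h9 hγ.le
    refine hsc.balanced ?_ ?_ ?_ ?_ <;> rw [supp_sdiff] <;> linarith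
  · refine ⟨⟨?_, ?_, ?_, ?_, ?_⟩, by simp⟩
    · rw [supp_sdiff, hvol, hxv]
    · simpa using h4
    · rw [supp_sdiff]
      simpa [hxv] using hedge
    · simp
    · intro _
      rw [supp_sdiff, compl_sdiff']
      exact (nonempty_of_vol_pos hpos).mono Finset.subset_union_right

lemma Inv.final (hdeg : ∀ v, 0 < G.degree v) (h0 : 0 < φ) (h1 : φ ≤ 1)
    (hsc : Scaling G C φ γ τ) {s : State n} (hs : Inv G γ τ s)
    (hexp : IsNearExpander G (6 * φ) (supp s.A)) :
    Guarantee G C φ (if s.emptyL then Outcome.expander else Outcome.unbalanced s.A) := by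
  rcases he : s.emptyL with _ | _
  · have p1 := hs.vol_pos hsc
    have hne := hs.proper he
    have p2 : 0 < vol G (supp s.A)ᶜ := CutProc.vol_pos hdeg hne
    have hL := hs.edges_le
    rw [edges_comm, hs.volL_eq] at hL
    have hlt := hs.volL_lt
    rw [hs.volL_eq] at hlt
    have hγ := hsc.pos
    have hτ := hsc.vol_pos
    have hle : (vol G (supp s.A)ᶜ : ℝ) ≤ vol G (supp s.A) := by
      have := hs.vol_ge hsc
      linarith
    have h5 : (0 : ℝ) ≤ γ * vol G (supp s.A)ᶜ := by positivity
    have h6 : γ * vol G (supp s.A)ᶜ ≤ γ * vol G (supp s.A) :=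
      mul_le_mul_of_nonneg_left hle hγ.le
    exact ⟨⟨nonempty_of_vol_pos p1, hne⟩,
      (cutConductance_le_of_edges_le p1 p2 (a := 2 * γ) (by linarith) (by linarith)).trans
        hsc.cond_le, hlt.le.trans hsc.vol_le, hexp⟩
  · rw [hs.full he] at hexp
    exact le_conductance_of_isNearExpander hdeg h0 h1 hexp

end Promise

/-! ### The decrease of the potential in one iteration -/

section Drop

variable {n : ℕ} {G : SimpleGraph (Fin n)} [DecidableRel G.Adj] {C φ γ τ : ℝ}

/-- The potential of a state. -/
def statePot (G : SimpleGraph (Fin n)) [DecidableRel G.Adj] (s : State n) : ℝ :=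
  pot G (supp s.A) (rows G s.hist)

lemma statePot_nonneg (s : State n) : 0 ≤ statePot G s := pot_nonneg _ _

/-- An output counts as potential 0. If the iteration goes on, the sweep cut was empty or of volume
below `τ`, and the expansion of all sweep sets gives the drop. -/
lemma Inv.step_drop (hdeg : ∀ v, 0 < G.degree v) (hsc : Scaling G C φ γ τ) (hγ1 : γ ≤ 1)
    {η : ℝ} (hη : 0 < η) (hγη : γ ^ 2 ≤ 64) {s : State n} (hs : Inv G γ τ s) (y : UnitSphere n) :
    Sum.elim (fun _ => 0) (statePot G) (stepOf τ s (cutOf G γ τ s (fun v => y.1 v))) ≤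
      statePot G s ∧
    (GoodDirection G s.A (rows G s.hist) η (y : EuclideanSpace ℝ (Fin n)) →
      Sum.elim (fun _ => 0) (statePot G) (stepOf τ s (cutOf G γ τ s (fun v => y.1 v))) ≤
        statePot G s - γ ^ 2 / (64 * η) * sqSum G (supp s.A)
          (centered G s.A (rows G s.hist) (y : EuclideanSpace ℝ (Fin n)))) := by
  have hA := hs.vol_pos hsc
  have hspec := sweepCut_spec G hA γ τ (walkVector G s.hist (fun v => y.1 v)).val
  change SweepSpec G _ _ γ τ (cutOf G γ τ s (fun v => y.1 v)) at hspec
  rw [walkVector_eq_inner] at hspec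
  -- For a good direction the subtracted term is at most `γ² / 64` times the potential, so the right
  -- side stays non-negative and covers the case of an output.
  have hout : GoodDirection G s.A (rows G s.hist) η (y : EuclideanSpace ℝ (Fin n)) →
      0 ≤ statePot G s - γ ^ 2 / (64 * η) * sqSum G (supp s.A)
          (centered G s.A (rows G s.hist) (y : EuclideanSpace ℝ (Fin n))) := by
    intro hy
    have h1 : sqSum G (supp s.A) (centered G s.A (rows G s.hist)
        (y : EuclideanSpace ℝ (Fin n))) ≤ η * statePot G s := by
      simp only [statePot, pot, sqSum, Finset.mul_sum]
      refine Finset.sum_le_sum fun v _ => ?_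
      rw [Real.norm_eq_abs, sq_abs, mul_left_comm]
      exact mul_le_mul_of_nonneg_left (hy.2.2 v) (Nat.cast_nonneg _)
    have h2 : γ ^ 2 / (64 * η) * (η * statePot G s) = γ ^ 2 / 64 * statePot G s := by
      field_simp
    have h3 := mul_le_mul_of_nonneg_left h1 (by positivity : 0 ≤ γ ^ 2 / (64 * η))
    nlinarith [statePot_nonneg (G := G) s]
  rcases hc : cutOf G γ τ s (fun v => y.1 v) with _ | ⟨S, x⟩
  · rw [hc] at hspec
    have hexp := sweepExpands_none hsc.pos hspec
    have hA' : 0 < vol G (supp s.A \ ∅) := by rwa [Finset.sdiff_empty]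
    have h1 := pot_walk_le_pot hdeg (Finset.empty_subset (supp s.A)) hA' (rows G s.hist)
    rw [Finset.sdiff_empty] at h1
    refine ⟨h1, fun hy => ?_⟩
    have h2 := pot_drop hdeg hA hA' (Finset.empty_subset (supp s.A)) hsc.pos hγ1 hη hexp
      (by simp [vol]) hy
    rw [Finset.sdiff_empty] at h2
    exact h2
  rw [hc] at hspec
  simp only [stepOf]
  split_ifs with h3 h4
  · exact ⟨statePot_nonneg s, hout⟩
  · exact ⟨statePot_nonneg s, hout⟩
  · have hspec' := hspec
    obtain ⟨hSA, hxv, h2, hbd, -⟩ := hspec'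
    have hvA := hs.vol_ge hsc
    have hτ := hsc.vol_pos
    -- The volume of `A` is at least `63 * τ`, and `S` has volume below `τ`.
    have hsmall' : 32 * (vol G (supp S) : ℝ) ≤ vol G (supp s.A) := by
      rw [← hxv]
      linarith
    have hsmall : 32 * vol G (supp S) ≤ vol G (supp s.A) := by exact_mod_cast hsmall'
    have hAS : 0 < vol G (supp s.A \ supp S) := by
      have := vol_sdiff G hSA
      omega
    have hexp := sweepExpands_some hsc.pos hspec (not_le.1 h3) (by omega)
    have h5 := pot_walk_le_pot hdeg hSA hAS (rows G s.hist)
    simp only [Sum.elim_inr, statePot]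
    rw [supp_sdiff]
    refine ⟨h5, fun hy => ?_⟩
    exact pot_drop hdeg hA hAS hSA hsc.pos hγ1 hη hexp hsmall hy

/-- The variance is at most the second moment about 0, to which each vertex contributes `d_v * (1 /
d_v)² ≤ 1`. -/
lemma statePot_initial_le (hdeg : ∀ v, 0 < G.degree v) (hm : 0 < numEdges G) : statePot G
    { A := fun _ => true, emptyL := true, volL := 0, hist := [] } ≤ n := by
  have h : supp (fun _ : Fin n => true) = Finset.univ := by ext; simp
  unfold statePot
  simp only [h]
  refine (pot_le_sqSum (by rw [vol_univ]; omega) _).trans ?_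
  have : ∀ v : Fin n, (G.degree v : ℝ) * ‖rows G [] v‖ ^ 2 ≤ 1 := by
    intro v
    have hd : (1 : ℝ) ≤ G.degree v := by exact_mod_cast hdeg v
    simp only [rows, walks, norm_smul, PiLp.norm_single, norm_inv, norm_one, mul_one,
      RCLike.norm_natCast]
    rw [inv_pow, pow_two, mul_inv, ← mul_assoc, mul_inv_cancel₀ (by positivity), one_mul]
    exact inv_le_one_of_one_le₀ hd
  calc sqSum G Finset.univ (rows G []) ≤ ∑ v : Fin n, (1 : ℝ) :=
        Finset.sum_le_sum fun v _ => this v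
    _ = n := by simp

/-- The failure probability in case `γ ≤ 1`. -/
lemma measure_not_guarantee_le (hn : 2 ≤ n) (hdeg : ∀ v, 0 < G.degree v) (h0 : 0 < φ)
    (h1 : φ ≤ 1) {T : ℕ} (hT : T * φ * 60 ≤ 8) (hsc : Scaling G C φ γ τ) (hγ1 : γ ≤ 1) {η : ℝ}
    (hη : 0 < η) (hη2 : η ≤ 1 / 2)
    (hprob : 4 * n ^ 2 * Real.exp (-(η * n / 2)) ≤ 1 / (2 * n))
    {Ω : Type*} [MeasurableSpace Ω] {μ : Measure Ω} [IsProbabilityMeasure μ]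
    {r : ℕ → Ω → UnitSphere n} (hr : ∀ t, Measurable (r t)) (hind : iIndepFun r μ)
    (hunif : ∀ t, μ.map (r t) = uniformSphere n) :
    μ {ω | ¬ Guarantee G C φ (iterate G γ τ (fun t v => (r t ω).1 v) T 1
      { A := fun _ => true, emptyL := true, volL := 0, hist := [] }).val} ≤
      ENNReal.ofReal (400 * numEdges G ^ 2 *
        (n * Real.exp (-(γ ^ 2 / (128 * (η * n)) * T)))) := by
  have hn0 : (0 : ℝ) < n := by exact_mod_cast (by omega : 0 < n)
  -- The contraction factor `1 - x` is replaced by `exp (-x)`. The weight `400 m²` is the inverse of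
  -- the potential at which `isNearExpander_of_pot` applies.
  set ρ := Real.exp (-(γ ^ 2 / (128 * (η * n)))) with hρ
  have hmain := measure_iterate_le (G := G) (γ := γ) (τ := τ) (T := T) (Good := Guarantee G C φ)
    (Inv := Inv G γ τ) (Pot := statePot G) (ρ := ρ) (K := 400 * (numEdges G : ℝ) ^ 2)
    (Real.exp_pos _).le (by positivity) statePot_nonneg (fun s hs y => hs.step hsc _)
    (fun s hs => by
      have h64 : γ ^ 2 ≤ 64 := by nlinarith [hsc.pos]
      have h2 := lintegral_pot_le hn s.A (rows G s.hist) hη hη2 (κ := γ ^ 2 / (64 * η))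
        (by positivity)
        (by
          have : γ ^ 2 / (64 * η) * η = γ ^ 2 / 64 := by field_simp
          rw [this]; linarith)
        hprob _ (fun y => (hs.step_drop hdeg hsc hγ1 hη h64 y).1)
        (fun y hy => (hs.step_drop hdeg hsc hγ1 hη h64 y).2 hy)
      refine h2.trans (ENNReal.ofReal_le_ofReal ?_)
      refine mul_le_mul_of_nonneg_right ?_ (statePot_nonneg s)
      have h3 := Real.add_one_le_exp (-(γ ^ 2 / (128 * (η * n))))
      have h4 : γ ^ 2 / (64 * η) / (2 * n) = γ ^ 2 / (128 * (η * n)) := by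
        field_simp
        ring
      rw [h4]
      linarith)
    (fun s hs hlen hK => hs.final hdeg h0 h1 hsc
      (isNearExpander_of_pot hdeg h0 (by rwa [hlen]) (by rw [mul_comm]; exact hK.le)))
    hr hind hunif T 1 _ (Inv.initial hsc.vol_pos) (by simp) (fun _ => Set.univ)
    (fun _ => MeasurableSet.univ)
  simp only [Set.preimage_univ, Set.iInter_univ, Set.univ_inter, measure_univ, one_mul] at hmain
  refine hmain.trans (ENNReal.ofReal_le_ofReal ?_)
  have hm : 0 < numEdges G := by
    have := numEdges_ge G hdeg
    omega
  have h5 : ρ ^ T = Real.exp (-(γ ^ 2 / (128 * (η * n)) * T)) := by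
    rw [hρ, ← Real.exp_nat_mul]
    congr 1
    ring
  rw [h5]
  have h6 := statePot_initial_le hdeg hm
  gcongr

end Drop

/-! ### A threshold above one -/

section LargeThreshold

variable {n : ℕ} {G : SimpleGraph (Fin n)} [DecidableRel G.Adj] {C φ γ τ : ℝ}

lemma bd_le_vol (A S : Finset (Fin n)) : bd G A S ≤ vol G S := edges_le_vol G _ _

/-- Along an injective vector some sweep cut is nearly balanced. -/
lemma exists_balanced_sweep (hm : 0 < numEdges G) {u : Fin n → ℝ} (hu : Function.Injective u) :
    ∃ P, (IsLower u Finset.univ P ∨ IsUpper u Finset.univ P) ∧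
      2 * vol G P ≤ vol G Finset.univ ∧ numEdges G ≤ 2 * vol G P := by
  obtain ⟨c, h1, h2, h3⟩ := exists_median (G := G) Finset.univ u
  have hne : (Finset.univ : Finset (Fin n)).Nonempty :=
    nonempty_of_vol_pos (G := G) (by rw [vol_univ]; omega)
  obtain ⟨x, -, hx⟩ := h3 hne
  -- By injectivity only one vertex sits at the median. It carries at most half of the total volume
  -- `2m`, so the larger of the two sides has volume at least `m / 2`.
  have hdeg : G.degree x ≤ numEdges G := by
    rw [← SimpleGraph.card_incidenceFinset_eq_degree]
    exact Finset.card_le_card (G.incidenceFinset_subset x)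
  have hsum : vol G (Finset.univ.filter (fun v => u v < c)) +
      vol G (Finset.univ.filter (fun v => c < u v)) + G.degree x = 2 * numEdges G := by
    rw [← vol_univ]
    have e1 : G.degree x = vol G {x} := by simp [vol]
    have d1 : Disjoint (Finset.univ.filter (fun v => u v < c))
        (Finset.univ.filter (fun v => c < u v)) := by
      rw [Finset.disjoint_left]
      intro v hv hv'
      simp only [Finset.mem_filter, Finset.mem_univ, true_and] at hv hv'
      linarith
    have d2 : Disjoint (Finset.univ.filter (fun v => u v < c) ∪
        Finset.univ.filter (fun v => c < u v)) {x} := by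
      rw [Finset.disjoint_singleton_right]
      simp [hx]
    rw [e1, ← vol_union G d1, ← vol_union G d2]
    congr 1
    ext v
    simp only [Finset.mem_union, Finset.mem_filter, Finset.mem_univ, true_and,
      Finset.mem_singleton, iff_true]
    rcases lt_trichotomy (u v) c with h | h | h
    · exact Or.inl (Or.inl h)
    · exact Or.inr (hu (h.trans hx.symm))
    · exact Or.inl (Or.inr h)
  rcases le_total (vol G (Finset.univ.filter (fun v => u v < c)))
    (vol G (Finset.univ.filter (fun v => c < u v))) with h | h
  · refine ⟨_, Or.inr ⟨Finset.filter_subset _ _, fun v hv w _ hvw => ?_⟩, h2, by omega⟩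
    simp only [Finset.mem_filter, Finset.mem_univ, true_and] at hv ⊢
    linarith
  · refine ⟨_, Or.inl ⟨Finset.filter_subset _ _, fun v hv w _ hvw => ?_⟩, h1, by omega⟩
    simp only [Finset.mem_filter, Finset.mem_univ, true_and] at hv ⊢
    linarith

/-- A border never exceeds the volume, so for `γ > 1` every sweep set of positive volume is sparse.
The nearly balanced one excludes an empty result and, by maximality, a result of volume below `τ`.
-/
lemma SweepSpec.exists_of_one_lt (hm : 0 < numEdges G) {u : Fin n → ℝ}
    (hu : Function.Injective u) (hγ : 1 < γ) (hτ : 2 * τ ≤ numEdges G)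
    {o : Option ((Fin n → Bool) × ℝ)} (h : SweepSpec G Finset.univ u γ τ o) :
    ∃ S x, o = some (S, x) ∧ τ ≤ x := by
  obtain ⟨P, hP, h2, hmP⟩ := exists_balanced_sweep hm hu
  have hpos : (0 : ℝ) < vol G P := by exact_mod_cast (by omega : 0 < vol G P)
  have hbd : bd G Finset.univ P < γ * vol G P := by
    have := bd_le_vol (G := G) Finset.univ P
    nlinarith
  have hmP' : (numEdges G : ℝ) ≤ 2 * vol G P := by exact_mod_cast hmP
  rcases o with _ | ⟨S, x⟩
  · exact absurd (h P hP h2) (not_le.2 hbd)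
  · refine ⟨S, x, rfl, ?_⟩
    by_contra! hx
    obtain ⟨-, hxv, -, -, h3⟩ := h
    have h4 : IsTwoEnded u Finset.univ P := by
      rcases hP with hP | hP
      · exact ⟨P, ∅, hP, isUpper_empty _ _, by simp⟩
      · exact ⟨∅, P, isLower_empty _ _, hP, by simp⟩
    have h5 : (vol G P : ℝ) ≤ vol G (supp S) := by exact_mod_cast (h3 hx).2 P h4 h2 hbd
    linarith

lemma rows_nil_sub_ne_zero (hdeg : ∀ v, 0 < G.degree v) {v w : Fin n} (h : v ≠ w) :
    rows G [] v - rows G [] w ≠ 0 := by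
  intro h0
  have h1 := congrArg (fun a : EuclideanSpace ℝ (Fin n) => a v) h0
  have hd := hdeg v
  simp [rows, walks, h] at h1
  omega

/-- In the first iteration the rows are distinct, and two projections agree only on a hyperplane. -/
lemma uniformSphere_not_injective (hn : 0 < n) (hdeg : ∀ v, 0 < G.degree v) :
    uniformSphere n {y : UnitSphere n | ¬ Function.Injective (fun v =>
      inner ℝ (y : EuclideanSpace ℝ (Fin n)) (rows G [] v))} = 0 := by
  have hsub : {y : UnitSphere n | ¬ Function.Injective (fun v =>
      inner ℝ (y : EuclideanSpace ℝ (Fin n)) (rows G [] v))} ⊆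
      ⋃ p : {p : Fin n × Fin n // p.1 ≠ p.2}, {y : UnitSphere n |
        inner ℝ (y : EuclideanSpace ℝ (Fin n)) (rows G [] p.1.1 - rows G [] p.1.2) = 0} := by
    intro y hy
    obtain ⟨v, w, h1, h2⟩ : ∃ v w, inner ℝ (y : EuclideanSpace ℝ (Fin n)) (rows G [] v) =
        inner ℝ (y : EuclideanSpace ℝ (Fin n)) (rows G [] w) ∧ v ≠ w := by
      simpa [Function.Injective] using hy
    refine Set.mem_iUnion.2 ⟨⟨(v, w), h2⟩, ?_⟩
    simp only [Set.mem_ofPred_eq, inner_sub_right, h1, sub_self]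
  exact measure_mono_null hsub (measure_iUnion_null fun p =>
    uniformSphere_hyperplane hn (rows_nil_sub_ne_zero hdeg p.2))

/-- In case `1 < γ` the first iteration almost surely returns a balanced cut. -/
lemma measure_not_guarantee_eq_zero (hn : 0 < n) (hdeg : ∀ v, 0 < G.degree v) {T : ℕ}
    (hT : 0 < T) (hsc : Scaling G C φ γ τ) (hγ : 1 < γ)
    {Ω : Type*} [MeasurableSpace Ω] {μ : Measure Ω}
    {r : ℕ → Ω → UnitSphere n} (hr : ∀ t, Measurable (r t))
    (hunif : ∀ t, μ.map (r t) = uniformSphere n) :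
    μ {ω | ¬ Guarantee G C φ (iterate G γ τ (fun t v => (r t ω).1 v) T 1
      { A := fun _ => true, emptyL := true, volL := 0, hist := [] }).val} = 0 := by
  have hm : 0 < numEdges G := by
    have := numEdges_ge G hdeg
    omega
  obtain ⟨k, rfl⟩ : ∃ k, T = k + 1 := ⟨T - 1, by omega⟩
  have hnull : μ (r 1 ⁻¹' {y : UnitSphere n | ¬ Function.Injective (fun v =>
      inner ℝ (y : EuclideanSpace ℝ (Fin n)) (rows G [] v))}) = 0 := by
    refine le_antisymm ((Measure.le_map_apply (hr 1).aemeasurable _).trans ?_) zero_le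
    rw [hunif, uniformSphere_not_injective hn hdeg]
  refine measure_mono_null (fun ω hω => ?_) hnull
  by_contra hinj
  have hinj' : Function.Injective (fun v =>
      inner ℝ (r 1 ω : EuclideanSpace ℝ (Fin n)) (rows G [] v)) := by
    by_contra h
    exact hinj h
  refine hω ?_
  set s : State n := { A := fun _ => true, emptyL := true, volL := 0, hist := [] } with hs
  have hI : Inv G γ τ s := Inv.initial hsc.vol_pos
  have hspec := sweepCut_spec G (hI.vol_pos hsc) γ τ
    (walkVector G s.hist (fun v => (r 1 ω).1 v)).val
  have hst := hI.step hsc (fun v => (r 1 ω).1 v)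
  rw [iterate_succ_val]
  change SweepSpec G _ _ γ τ (cutOf G γ τ s (fun v => (r 1 ω).1 v)) at hspec
  rw [walkVector_eq_inner, hI.full rfl] at hspec
  have h32 := hsc.small
  have hτ := hsc.vol_pos
  obtain ⟨S, x, ho, hx⟩ := hspec.exists_of_one_lt hm hinj' hγ (by linarith)
  rw [ho] at hst ⊢
  simp only [stepOf, if_pos hx] at hst ⊢
  exact hst

end LargeThreshold

/-! ### The parameters -/

section Parameters

variable {n : ℕ} {G : SimpleGraph (Fin n)} [DecidableRel G.Adj] {φ : ℝ}

lemma logb_pow_three {m : ℝ} (hm : 0 < m) :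
    Real.logb 2 (32 * m ^ 3) = 5 + 3 * Real.logb 2 m := by
  rw [Real.logb_mul (by norm_num) (by positivity), Real.logb_pow]
  have : Real.logb 2 32 = 5 := by
    rw [show (32 : ℝ) = 2 ^ (5 : ℝ) by norm_num, Real.logb_rpow (by norm_num) (by norm_num)]
  rw [this]
  norm_num

lemma log_le_logb_two {x : ℝ} (hx : 1 ≤ x) : Real.log x ≤ Real.logb 2 x := by
  have h1 := Real.log_nonneg hx
  have h2 := Real.log_two_lt_d9
  have h3 : 0 < Real.log 2 := Real.log_pos (by norm_num)
  rw [Real.logb, le_div_iff₀ h3]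
  nlinarith

lemma sixteen_le_logb_numEdges (hdeg : ∀ v, 0 < G.degree v) (hn : 2 ^ 17 ≤ n) :
    16 ≤ Real.logb 2 (numEdges G) := by
  have h1 := numEdges_ge G hdeg
  have h2 : 2 ^ 16 ≤ numEdges G := by omega
  have h3 : (2 : ℝ) ^ (16 : ℝ) ≤ numEdges G := by
    have : ((2 ^ 16 : ℕ) : ℝ) ≤ numEdges G := by exact_mod_cast h2
    refine le_trans (le_of_eq ?_) this
    norm_num
  calc (16 : ℝ) = Real.logb 2 ((2 : ℝ) ^ (16 : ℝ)) :=
        (Real.logb_rpow (by norm_num) (by norm_num)).symm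
    _ ≤ _ := Real.logb_le_logb_of_le (by norm_num) (by positivity) h3

lemma logb_le_two_mul (hdeg : ∀ v, 0 < G.degree v) (hn : 2 ^ 17 ≤ n) :
    Real.logb 2 n ≤ 2 * Real.logb 2 (numEdges G) := by
  have h1 : (n : ℝ) ≤ 2 * numEdges G := by exact_mod_cast numEdges_ge G hdeg
  have h0 : (0 : ℝ) < n := by exact_mod_cast (by omega : 0 < n)
  have h2 := Real.logb_le_logb_of_le (b := 2) (by norm_num) h0 h1
  rw [Real.logb_mul (by norm_num) (by linarith), Real.logb_self_eq_one (by norm_num)] at h2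
  have := sixteen_le_logb_numEdges hdeg hn
  linarith

lemma sq_cutThreshold (h0 : 0 < φ) (hm : 0 < numEdges G)
    (hlog : 0 ≤ Real.logb 2 (numEdges G)) : cutThreshold G φ ^ 2 =
      343 ^ 2 * (φ * (5 + 3 * Real.logb 2 (numEdges G)) * Real.logb 2 n ^ 2) := by
  rw [cutThreshold, mul_pow, logb_pow_three (by exact_mod_cast hm), Real.sq_sqrt (by positivity)]

lemma rpow_three_halves {x : ℝ} (hx : 0 ≤ x) : x ^ (3 / 2 : ℝ) = √(x ^ 3) := by
  rw [Real.sqrt_eq_rpow, ← Real.rpow_natCast, ← Real.rpow_mul hx]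
  norm_num

lemma scaling (hdeg : ∀ v, 0 < G.degree v) (hn : 2 ^ 17 ≤ n) (h0 : 0 < φ) (h1 : φ ≤ 1) :
    Scaling G 5000 φ (cutThreshold G φ) (balance G φ * numEdges G) := by
  have hm : 0 < numEdges G := by
    have := numEdges_ge G hdeg
    omega
  have hm' : (0 : ℝ) < numEdges G := by exact_mod_cast hm
  have hL := sixteen_le_logb_numEdges hdeg hn
  have hLn := logb_le_two_mul hdeg hn
  have hn1 : (1 : ℝ) < n := by exact_mod_cast (by omega : 1 < n)
  have hLn0 : 0 < Real.logb 2 n := Real.logb_pos (by norm_num) hn1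
  have hlog3 := logb_pow_three hm'
  set L := Real.logb 2 (numEdges G) with hLdef
  have hL0 : 0 < L := by linarith
  have hW : L ^ (3 / 2 : ℝ) = √(L ^ 3) := rpow_three_halves hL0.le
  -- The lower bound `2 ^ 17` on `n` gives `L ≥ 16`; the resulting 64 is what makes `32 * τ ≤ m`
  -- true.
  have hW64 : 64 ≤ √(L ^ 3) := by
    refine Real.le_sqrt_of_sq_le ?_
    calc (64 : ℝ) ^ 2 = 16 ^ 3 := by norm_num
      _ ≤ L ^ 3 := pow_le_pow_left₀ (by norm_num) hL 3
  have hsφ : 0 < √φ := Real.sqrt_pos.2 h0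
  have hsφ1 : √φ ≤ 1 := Real.sqrt_le_one.2 h1
  have hbal : balance G φ * numEdges G = 2 * (numEdges G * √φ / √(L ^ 3)) := by
    rw [balance, ← hLdef, hW]
    ring
  have hX : 0 < numEdges G * √φ / √(L ^ 3) := by positivity
  refine ⟨?_, ?_, ?_, ?_, ?_, ?_⟩
  · rw [← hLdef, hW, cutThreshold, hlog3]
    -- From `5 + 3L ≤ 8L` and `log n ≤ 2L` the factor is 32, rounded up to a square. The constant
    -- becomes `2 * 343 * 6 = 4116`, which is below 5000.
    have h2 : φ * (5 + 3 * L) * Real.logb 2 n ^ 2 ≤ 6 ^ 2 * (φ * L ^ 3) := by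
      have h3 : Real.logb 2 n ^ 2 ≤ (2 * L) ^ 2 := pow_le_pow_left₀ hLn0.le hLn 2
      have h4 : φ * (5 + 3 * L) ≤ φ * (8 * L) := mul_le_mul_of_nonneg_left (by linarith) h0.le
      calc φ * (5 + 3 * L) * Real.logb 2 n ^ 2 ≤ φ * (8 * L) * (2 * L) ^ 2 :=
            mul_le_mul h4 h3 (by positivity) (by positivity)
        _ = 32 * (φ * L ^ 3) := by ring
        _ ≤ _ := by nlinarith [mul_pos h0 (pow_pos hL0 3)]
    have h5 := Real.sqrt_le_sqrt h2
    rw [Real.sqrt_mul (by norm_num) (φ * L ^ 3), Real.sqrt_sq (by norm_num),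
      Real.sqrt_mul h0.le] at h5
    have h6 : 0 < √φ * √(L ^ 3) := by positivity
    linarith
  · rw [← hLdef, hW, hbal]
    linarith
  · rw [← hLdef, hW, hbal]
    linarith
  · rw [cutThreshold, hlog3]
    positivity
  · rw [hbal]
    positivity
  · rw [hbal]
    have h2 : numEdges G * √φ / √(L ^ 3) ≤ numEdges G / 64 := by
      rw [div_le_div_iff₀ (by positivity) (by norm_num)]
      have h3 : (numEdges G : ℝ) * √φ ≤ numEdges G := by nlinarith
      nlinarith
    linarith

lemma le_iterations (φ : ℝ) : 1 / (12 * φ) ≤ iterations φ := Nat.le_ceil _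

lemma iterations_pos (h0 : 0 < φ) : 0 < iterations φ := Nat.ceil_pos.2 (by positivity)

/-- Rounding up adds at most `φ` to `1/12`, and `60 * (1/12 + 1/20) = 8`. -/
lemma iterations_mul_le (h0 : 0 < φ) (h1 : φ ≤ 1 / 20) : iterations φ * φ * 60 ≤ 8 := by
  have h2 : (iterations φ : ℝ) < 1 / (12 * φ) + 1 := Nat.ceil_lt_add_one (by positivity)
  have h3 : (iterations φ : ℝ) * φ ≤ (1 / (12 * φ) + 1) * φ :=
    mul_le_mul_of_nonneg_right h2.le h0.le
  have h4 : (1 / (12 * φ) + 1) * φ = 1 / 12 + φ := by field_simp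
  linarith

/-- A threshold of at most 1 forces `343² * φ ≤ 1`, so in this case rounding the number of
iterations is harmless. -/
lemma le_of_cutThreshold_le_one (hdeg : ∀ v, 0 < G.degree v) (hn : 2 ^ 17 ≤ n) (h0 : 0 < φ)
    (hγ : 0 < cutThreshold G φ) (hγ1 : cutThreshold G φ ≤ 1) : φ ≤ 1 / 20 := by
  have hm : 0 < numEdges G := by
    have := numEdges_ge G hdeg
    omega
  have hL := sixteen_le_logb_numEdges hdeg hn
  have h2 := sq_cutThreshold h0 hm (by linarith)
  have h3 : cutThreshold G φ ^ 2 ≤ 1 := by nlinarith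
  have h4 : 1 ≤ Real.logb 2 n := by
    rw [Real.le_logb_iff_rpow_le (by norm_num) (by exact_mod_cast (by omega : 0 < n))]
    norm_num
    exact_mod_cast (by omega : 2 ≤ n)
  have h5 : 1 ≤ Real.logb 2 n ^ 2 := one_le_pow₀ h4
  have h6 : φ * 1 * 1 ≤ φ * (5 + 3 * Real.logb 2 (numEdges G)) * Real.logb 2 n ^ 2 := by
    gcongr
    linarith
  linarith

lemma sixteen_log_le {x : ℝ} (hx : 1024 ≤ x) : 16 * Real.log x ≤ x := by
  have h0 : 0 ≤ x := by linarith
  have h1 : √x ^ 2 = x := Real.sq_sqrt h0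
  have h2 : 32 ≤ √x := Real.le_sqrt_of_sq_le (by linarith)
  have h3 : Real.log x = 2 * Real.log √x := by
    rw [← Real.log_rpow (by linarith)]
    congr 1
    rw [Real.rpow_two, h1]
  have h4 := Real.log_le_sub_one_of_pos (by linarith : 0 < √x)
  nlinarith

/-- The failure probability is polynomially small. -/
lemma failure_le {m x c δ : ℝ} (hm : Real.exp 1 ≤ m) (hx : Real.exp 6 ≤ x)
    (hc : c ≤ Real.log m) (hδ : 28 * (Real.log m * Real.log x) ≤ δ) :
    400 * m ^ 2 * (x * Real.exp (-δ)) ≤ x ^ (-c) := by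
  have hm0 : 0 < m := (Real.exp_pos _).trans_le hm
  have hx0 : 0 < x := (Real.exp_pos _).trans_le hx
  have h1 : 1 ≤ Real.log m := (Real.le_log_iff_exp_le hm0).2 hm
  have h2 : 6 ≤ Real.log x := (Real.le_log_iff_exp_le hx0).2 hx
  have h3 : (400 : ℝ) ≤ Real.exp 6 := by
    have := Real.exp_one_gt_d9
    have h4 : Real.exp 6 = Real.exp 1 ^ 6 := by rw [← Real.exp_nat_mul]; norm_num
    rw [h4]
    calc (400 : ℝ) ≤ 2.718 ^ 6 := by norm_num
      _ ≤ _ := pow_le_pow_left₀ (by norm_num) (by linarith) 6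
  have h4 : m ^ 2 = Real.exp (2 * Real.log m) := by
    rw [two_mul, Real.exp_add, Real.exp_log hm0, pow_two]
  have h5 : x = Real.exp (Real.log x) := (Real.exp_log hx0).symm
  calc 400 * m ^ 2 * (x * Real.exp (-δ))
      ≤ Real.exp 6 * Real.exp (2 * Real.log m) * (Real.exp (Real.log x) * Real.exp (-δ)) := by
        rw [← h4, ← h5]
        gcongr
    _ = Real.exp (6 + 2 * Real.log m + (Real.log x + -δ)) := by
        rw [Real.exp_add, Real.exp_add, Real.exp_add]
    _ ≤ Real.exp (Real.log x * -c) := by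
        -- Each of `6`, `log m`, `log x` and `c * log x` is at most `log m * log x`; five such
        -- products are needed, and `δ` provides 28.
        refine Real.exp_le_exp.2 ?_
        have e1 : Real.log x ≤ Real.log m * Real.log x := by nlinarith
        have e2 : Real.log m ≤ Real.log m * Real.log x := by nlinarith
        have e3 : c * Real.log x ≤ Real.log m * Real.log x :=
          mul_le_mul_of_nonneg_right hc (by linarith)
        nlinarith
    _ = x ^ (-c) := by rw [Real.rpow_def_of_pos hx0]

/-- With high probability the output of the cut procedure is as promised. -/
theorem measure_cutProcedure_le (hdeg : ∀ v, 0 < G.degree v) (hn : 2 ^ 17 ≤ n) {c : ℝ}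
    (hc : 2 * Real.exp c ≤ n) (h0 : 0 < φ) (h1 : φ ≤ 1)
    {Ω : Type*} [MeasurableSpace Ω] {μ : Measure Ω} [IsProbabilityMeasure μ]
    {r : ℕ → Ω → UnitSphere n} (hr : ∀ t, Measurable (r t)) (hind : iIndepFun r μ)
    (hunif : ∀ t, μ.map (r t) = uniformSphere n) :
    μ {ω | ¬ Guarantee G 5000 φ (cutProcedure G φ (fun t v => (r t ω).1 v)).val} ≤
      ENNReal.ofReal ((n : ℝ) ^ (-c)) := by
  have hsc := scaling hdeg hn h0 h1
  change μ {ω | ¬ Guarantee G 5000 φ (iterate G (cutThreshold G φ) (balance G φ * numEdges G)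
    (fun t v => (r t ω).1 v) (iterations φ) 1
    { A := fun _ => true, emptyL := true, volL := 0, hist := [] }).val} ≤ _
  -- The drop estimate needs a threshold of at most 1; a larger one is settled by the first
  -- iteration alone.
  rcases lt_or_ge 1 (cutThreshold G φ) with hγ | hγ
  · rw [measure_not_guarantee_eq_zero (by omega) hdeg (iterations_pos h0) hsc hγ hr hunif]
    exact zero_le
  have hφ := le_of_cutThreshold_le_one hdeg hn h0 hsc.pos hγ
  have hnr : (131072 : ℝ) ≤ n := by exact_mod_cast (by omega : 131072 ≤ n)
  have hn0 : (0 : ℝ) < n := by linarith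
  have hm2 : (n : ℝ) ≤ 2 * numEdges G := by exact_mod_cast numEdges_ge G hdeg
  have hm0 : (0 : ℝ) < numEdges G := by linarith
  have hx6 : Real.exp 6 ≤ n := by
    have := Real.exp_one_lt_d9
    have h4 : Real.exp 6 = Real.exp 1 ^ 6 := by rw [← Real.exp_nat_mul]; norm_num
    rw [h4]
    calc Real.exp 1 ^ 6 ≤ 3 ^ 6 := pow_le_pow_left₀ (Real.exp_pos _).le (by linarith) 6
      _ ≤ _ := by linarith
  have hm1 : Real.exp 1 ≤ numEdges G := by
    have := Real.exp_one_lt_d9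
    linarith
  have hlogn : 6 ≤ Real.log n := (Real.le_log_iff_exp_le hn0).2 hx6
  -- With this choice each tail is of order `n ^ (-4)`, so that after the union bound a bad
  -- direction has probability at most `4 / n² ≤ 1 / (2n)`.
  set η := 8 * Real.log n / n with hη
  have hη0 : 0 < η := by positivity
  have hηn : η * n = 8 * Real.log n := by rw [hη]; field_simp
  have hη2 : η ≤ 1 / 2 := by
    rw [hη, div_le_iff₀ hn0]
    have := sixteen_log_le (by linarith : (1024 : ℝ) ≤ n)
    linarith
  have hprob : 4 * (n : ℝ) ^ 2 * Real.exp (-(η * n / 2)) ≤ 1 / (2 * n) := by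
    have e : Real.exp (-(η * n / 2)) = ((n : ℝ) ^ 4)⁻¹ := by
      rw [hηn, Real.exp_neg]
      congr 1
      rw [show 8 * Real.log (n : ℝ) / 2 = (4 : ℕ) * Real.log n by push_cast; ring,
        Real.exp_nat_mul, Real.exp_log hn0]
    rw [e, ← div_eq_mul_inv, div_le_div_iff₀ (by positivity) (by positivity)]
    nlinarith [pow_pos hn0 3]
  have hmain := measure_not_guarantee_le (by omega : 2 ≤ n) hdeg h0 h1
    (iterations_mul_le h0 hφ) hsc hγ hη0 hη2 hprob hr hind hunif
  refine hmain.trans (ENNReal.ofReal_le_ofReal ?_)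
  refine failure_le hm1 hx6 ((Real.le_log_iff_exp_le hm0).2 (by linarith)) ?_
  rw [hηn, sq_cutThreshold h0 (by exact_mod_cast hm0)
    (by have := sixteen_le_logb_numEdges hdeg hn; linarith)]
  have hT := le_iterations φ
  have hLm : Real.log (numEdges G) ≤ Real.logb 2 (numEdges G) :=
    log_le_logb_two (by have := Real.add_one_le_exp (1 : ℝ); linarith)
  have hLn : Real.log n ≤ Real.logb 2 n := log_le_logb_two (by linarith)
  have hlm : 1 ≤ Real.log (numEdges G) := (Real.le_log_iff_exp_le hm0).2 hm1
  -- The constant 343 of the threshold enters here: `343² * 3 / (128 * 8 * 12)` is just above 28.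
  -- The factor `φ` in the squared threshold cancels against the number of iterations.
  calc 28 * (Real.log (numEdges G) * Real.log n)
      ≤ 343 ^ 2 * (φ * (3 * Real.log (numEdges G)) * Real.log n ^ 2) /
          (128 * (8 * Real.log n)) * (1 / (12 * φ)) := by
        have e : 343 ^ 2 * (φ * (3 * Real.log (numEdges G)) * Real.log n ^ 2) /
          (128 * (8 * Real.log n)) * (1 / (12 * φ)) = 343 ^ 2 * 3 / (128 * 8 * 12) *
            (Real.log (numEdges G) * Real.log n) := by field_simp
        rw [e]
        refine mul_le_mul_of_nonneg_right (by norm_num) (by positivity)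
    _ ≤ _ := by
        have hlog := (zero_le_one.trans hlm).trans hLm
        gcongr
        linarith

end Parameters

end CutProc

theorem theorem2 :
    ∃ C : ℝ, 0 < C ∧
      -- the number of steps, for all values of the random vectors
      (∀ (n : ℕ) (G : SimpleGraph (Fin n)) [DecidableRel G.Adj] (φ : ℝ)
          (r : ℕ → CutProc.UnitSphere n),
        2 ≤ n → (∀ v, 0 < G.degree v) → 0 < φ → φ ≤ 1 →
          ((CutProc.cutProcedure G φ (fun t v => (r t).1 v)).steps : ℝ) ≤
            C * (CutProc.numEdges G * Real.logb 2 n / φ ^ 2)) ∧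
      -- the output, with high probability
      (∀ c : ℝ, 0 < c → ∃ n₀ : ℕ, ∀ n : ℕ, n₀ ≤ n →
        ∀ (G : SimpleGraph (Fin n)) [DecidableRel G.Adj] (φ : ℝ),
          (∀ v, 0 < G.degree v) → 0 < φ → φ ≤ 1 →
          ∀ (Ω : Type*) [MeasurableSpace Ω] (μ : MeasureTheory.Measure Ω)
            [MeasureTheory.IsProbabilityMeasure μ] (r : ℕ → Ω → CutProc.UnitSphere n),
            (∀ t, Measurable (r t)) → ProbabilityTheory.iIndepFun r μ →
            (∀ t, μ.map (r t) = CutProc.uniformSphere n) →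
              μ {ω | ¬ CutProc.Guarantee G C φ
                    (CutProc.cutProcedure G φ (fun t v => (r t ω).1 v)).val} ≤
                ENNReal.ofReal ((n : ℝ) ^ (-c))) := by
  refine ⟨5000, by norm_num, ?_, ?_⟩
  · intro n G _ φ r hn hdeg h0 h1
    refine (CutProc.cutProcedure_steps_le G hn hdeg h0 h1 _).trans ?_
    have hn1 : (1 : ℝ) ≤ n := by exact_mod_cast (by omega : 1 ≤ n)
    have hlog : 0 ≤ Real.logb 2 n := Real.logb_nonneg (by norm_num) hn1
    exact mul_le_mul_of_nonneg_right (by norm_num) (by positivity)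
  · intro c _
    -- The first bound makes `log m` at least 16; the second gives `c ≤ ln m`, because `n ≤ 2m`.
    refine ⟨max (2 ^ 17) ⌈2 * Real.exp c⌉₊, ?_⟩
    intro n hn G _ φ hdeg h0 h1 Ω _ μ _ r hr hind hunif
    exact CutProc.measure_cutProcedure_le hdeg ((le_max_left _ _).trans hn)
      (Nat.ceil_le.1 ((le_max_right _ _).trans hn)) h0 h1 hr hind hunif

end
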